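/- **Setting.** Let $d,N\ge 0$ and $N_i\ge 1$ be integers. Let $h:\mathbb R\to\mathbb R$ be differentiable, with $h'$ differentiable almost everywhere, and suppose that $g=h'$ satisfies the following condition (C1): there is no set $S\subset\mathbb R$ of positive Lebesgue measure for which there are constants $c_1,c_2,c_3$ with either $g'(x)=c_1$ for all $x\in S$, or $(x+c_2)g'(x)+g(x)=c_3$ for all $x\in S$. For a vector $z$, $h(z)$ and $h'(z)$ are taken componentwise. *Data.* $(u^1,v^1),\dots,(u^N,v^N)\in\mathbb R^d\times\mathbb R$ are independent random pairs and the law of each $u^i$ is absolutely continuous with respect to Lebesgue measure ($v^i$ may depend on $u^i$). Put $$f(W,\theta)=\frac1{2N}\sum_{i=1}^N\bigl(v^i-\theta^{T}h(Wu^i)\bigr)^2,\qquad W\in\mathbb R^{d\times d},\ \theta\in\mathbb R^d .$$ *Algorithm.* Let $\mathcal R=\mathbb R^d$, or let $d\ge 2$ and $\mathcal R=\{z:\|z\|_2\le R/2\}$ with $R>0$; put $P_x(y)=\operatorname{argmin}_{z\in\mathcal R}\langle y,z-x\rangle+\frac12\|z-x\|^2$. Let $\beta^k_i>0$ and $\gamma_k\in\mathbb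 R$ be step sizes. $W_0$ is a random $d\times d$ matrix whose law is absolutely continuous, and $\theta_0$ is a random vector. The coordinates of the noise vectors $\xi^{k+1}_i\in\mathbb R^d$ ($k\ge 0$, $1\le i\le N_i$) are i.i.d. centred Gaussian variables with positive variance. The data, $(W_0,\theta_0)$ and the noise are independent of one another. For $k=0,1,2,\dots$ set $\bar\theta_1=\theta_k$, $$\bar\theta_{i+1}=P_{\bar\theta_i}\bigl(\beta^k_i(\nabla_\theta f(W_k,\bar\theta_i)+\xi^{k+1}_i)\bigr)\quad(1\le i\le N_i),$$ $$\theta_{k+1}=\Bigl(\sum_{i=1}^{N_i}\beta^k_i\Bigr)^{-1}\sum_{i=1}^{N_i}\beta^k_i\bar\theta_{i+1},\qquad W_{k+1}=W_k-\gamma_k\nabla_Wf(W_k,\theta_{k+1}).$$ A collection $M_1,\dots,M_N$ of $d\times d$ matrices is called *full rank* if the $d^2\times N$ matrix with columns $\mathrm{vect}(M_1),\dots,\mathrm{vect}(M_N)$ has rank $\min\{N,d^2\}$. Let $D(W,\theta)\in\mathbb R^{d^2\times N}$ be the matrix whose $i$-th column stacks the vectors $h'(W[j,:]u^i)\,\theta[j]\,u^i$,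 $j=1,\dots,d$. **Claim.** 1. For every $k\ge 0$, for almost every value of the data, $(W_0,\theta_0)$ and the noise of the earlier outer iterations, the collection $\{h'(W_{k+1}u^i)u^{iT}\}_{i=1}^N$ is full rank with probability 1 over the inner-loop noise $\xi^{k+1}_{1},\dots,\xi^{k+1}_{N_i}$. 2. Consequently, almost surely, for all $k\ge 0$: the collection $\{h'(W_{k+1}u^i)u^{iT}\}_{i=1}^N$ is full rank, and the first-order matrices $D(W_k,\theta_{k+1})$ and $D(W_{k+1},\theta_{k+1})$ have rank $\min\{N,d^2\}$. -/

import Mathlib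

open MeasureTheory ProbabilityTheory
open scoped NNReal Matrix Gradient

noncomputable section

namespace TwoLayer

/-- A collection `M₁, …, M_N` of `n × d` matrices is full rank when the `nd × N` matrix whose
columns are the vectorizations of the `Mᵢ` has rank `min {N, nd}`. -/
def FullRankCollection {N n d : ℕ} (M : Fin N → Matrix (Fin n) (Fin d) ℝ) : Prop :=
  (Matrix.of fun (p : Fin n × Fin d) (i : Fin N) => M i p.1 p.2).rank = min N (n * d)

/-- Condition C1 on a function `g`: there is no set of positive Lebesgue measure on which `g'` is
constant, or on which `(x + c₂) g'(x) + g(x)` is constant for some `c₂`. -/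
def ConditionC1 (g : ℝ → ℝ) : Prop :=
  ∀ S : Set ℝ, 0 < volume S → ¬ ∃ c₁ c₂ c₃ : ℝ,
    (∀ x ∈ S, deriv g x = c₁) ∨ (∀ x ∈ S, (x + c₂) * deriv g x + g x = c₃)

/-- The network `φ_{W,θ}(u) = θᵀ h(W u)`. -/
def network {d : ℕ} (h : ℝ → ℝ) (W : Matrix (Fin d) (Fin d) ℝ)
    (θ : EuclideanSpace ℝ (Fin d)) (u : Fin d → ℝ) : ℝ :=
  ∑ j, θ j * h ((W *ᵥ u) j)

/-- The training objective `f(W, θ) = (1 / 2N) ∑ᵢ (vⁱ - φ_{W,θ}(uⁱ))²`. -/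
def objective {d N : ℕ} (h : ℝ → ℝ) (u : Fin N → Fin d → ℝ) (v : Fin N → ℝ)
    (W : Matrix (Fin d) (Fin d) ℝ) (θ : EuclideanSpace ℝ (Fin d)) : ℝ :=
  1 / (2 * (N : ℝ)) * ∑ i, (v i - network h W θ (u i)) ^ 2

/-- The gradient of the objective in `W`, as the matrix of its partial derivatives. -/
def gradW {d N : ℕ} (h : ℝ → ℝ) (u : Fin N → Fin d → ℝ) (v : Fin N → ℝ)
    (W : Matrix (Fin d) (Fin d) ℝ) (θ : EuclideanSpace ℝ (Fin d)) : Matrix (Fin d) (Fin d) ℝ :=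
  Matrix.of fun j k =>
    deriv (fun t : ℝ => objective h u v (W + t • Matrix.single j k (1 : ℝ)) θ) 0

/-- The stochastic gradient `G_W(θ, ξ) = ∇_θ f(W, θ) + ξ`. -/
def stochGrad {d N : ℕ} (h : ℝ → ℝ) (u : Fin N → Fin d → ℝ) (v : Fin N → ℝ)
    (W : Matrix (Fin d) (Fin d) ℝ) (θ : EuclideanSpace ℝ (Fin d)) (ξ : Fin d → ℝ) :
    EuclideanSpace ℝ (Fin d) :=
  ∇ (fun ϑ => objective h u v W ϑ) θ + WithLp.toLp 2 ξ

/-- The prox-mapping `P_x(y) = argmin_{z ∈ K} ⟨y, z - x⟩ + ½ ‖z - x‖²`. The minimizer exists and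
is unique when `K` is nonempty, closed and convex. -/
def proxMap {d : ℕ} (K : Set (EuclideanSpace ℝ (Fin d))) (x y : EuclideanSpace ℝ (Fin d)) :
    EuclideanSpace ℝ (Fin d) :=
  Classical.epsilon fun z => z ∈ K ∧
    IsMinOn (fun z' => inner ℝ y (z' - x) + 1 / 2 * ‖z' - x‖ ^ 2) K z

/-- The inner SGD iterates: `innerIter … 0` is the starting point, and step `i` (counted from `0`,
for `i < Ni`) uses the step size `β i` and the noise vector `ξ i`. -/
def innerIter {d N Ni : ℕ} (h : ℝ → ℝ) (u : Fin N → Fin d → ℝ) (v : Fin N → ℝ)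
    (K : Set (EuclideanSpace ℝ (Fin d))) (β : Fin Ni → ℝ) (W : Matrix (Fin d) (Fin d) ℝ)
    (θ : EuclideanSpace ℝ (Fin d)) (ξ : Fin Ni → Fin d → ℝ) : ℕ → EuclideanSpace ℝ (Fin d)
  | 0 => θ
  | i + 1 =>
    let θi := innerIter h u v K β W θ ξ i
    if hi : i < Ni then
      proxMap K θi (β ⟨i, hi⟩ • stochGrad h u v W θi (ξ ⟨i, hi⟩))
    else θi

/-- The output of the inner loop: the average of the iterates produced by steps `0, …, Ni - 1`,
with weights proportional to the step sizes. -/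
def innerOutput {d N Ni : ℕ} (h : ℝ → ℝ) (u : Fin N → Fin d → ℝ) (v : Fin N → ℝ)
    (K : Set (EuclideanSpace ℝ (Fin d))) (β : Fin Ni → ℝ) (W : Matrix (Fin d) (Fin d) ℝ)
    (θ : EuclideanSpace ℝ (Fin d)) (ξ : Fin Ni → Fin d → ℝ) : EuclideanSpace ℝ (Fin d) :=
  (∑ i, β i)⁻¹ • ∑ i : Fin Ni, β i • innerIter h u v K β W θ ξ (i + 1)

/-- One outer iteration `(W_k, θ_k) ↦ (W_{k+1}, θ_{k+1})`, with the noise block `ξ`. -/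
def outerStep {d N Ni : ℕ} (h : ℝ → ℝ) (u : Fin N → Fin d → ℝ) (v : Fin N → ℝ)
    (K : Set (EuclideanSpace ℝ (Fin d))) (β : Fin Ni → ℝ) (γ : ℝ)
    (s : Matrix (Fin d) (Fin d) ℝ × EuclideanSpace ℝ (Fin d)) (ξ : Fin Ni → Fin d → ℝ) :
    Matrix (Fin d) (Fin d) ℝ × EuclideanSpace ℝ (Fin d) :=
  let θ' := innerOutput h u v K β s.1 s.2 ξ
  (s.1 - γ • gradW h u v s.1 θ', θ')

/-- The iterates `(W_k, θ_k)` of the SGD-GD algorithm; `ξ k` is the block of noise vectors drawn in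
the outer iteration that produces `(W_{k+1}, θ_{k+1})`. -/
def iterate {d N Ni : ℕ} (h : ℝ → ℝ) (u : Fin N → Fin d → ℝ) (v : Fin N → ℝ)
    (K : Set (EuclideanSpace ℝ (Fin d))) (β : ℕ → Fin Ni → ℝ) (γ : ℕ → ℝ)
    (W₀ : Matrix (Fin d) (Fin d) ℝ) (θ₀ : EuclideanSpace ℝ (Fin d))
    (ξ : ℕ → Fin Ni → Fin d → ℝ) : ℕ → Matrix (Fin d) (Fin d) ℝ × EuclideanSpace ℝ (Fin d)
  | 0 => (W₀, θ₀)
  | k + 1 => outerStep h u v K (β k) (γ k) (iterate h u v K β γ W₀ θ₀ ξ k) (ξ k)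

/-- The matrices `h'(W uⁱ) uⁱᵀ`. -/
def gradCollection {d N : ℕ} (h : ℝ → ℝ) (u : Fin N → Fin d → ℝ)
    (W : Matrix (Fin d) (Fin d) ℝ) : Fin N → Matrix (Fin d) (Fin d) ℝ :=
  fun i => Matrix.vecMulVec (fun j => deriv h ((W *ᵥ u i) j)) (u i)

/-- The first-order matrix `D ∈ ℝ^{dd × N}`: its `i`-th column stacks the vectors
`h'(W[j,:] uⁱ) θ[j] uⁱ`, `j = 1, …, d`. -/
def firstOrderMatrix {d N : ℕ} (h : ℝ → ℝ) (u : Fin N → Fin d → ℝ)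
    (W : Matrix (Fin d) (Fin d) ℝ) (θ : EuclideanSpace ℝ (Fin d)) :
    Matrix (Fin d × Fin d) (Fin N) ℝ :=
  Matrix.of fun p i => deriv h ((W *ᵥ u i) p.1) * θ p.1 * u i p.2

/-- The law of one block of `Ni` independent centred isotropic Gaussian vectors in `ℝ^d`, with
variance `s` in each coordinate. -/
def noiseLaw (d Ni : ℕ) (s : ℝ≥0) : Measure (Fin Ni → Fin d → ℝ) :=
  Measure.pi fun _ => Measure.pi fun _ => gaussianReal 0 s

end TwoLayer

end

/-! The invariant is absolute continuity: for every k the joint law of the data and `W_k` is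
absolutely continuous with respect to (law of the data) ⊗ Lebesgue. The pairs (x, W) for which the
collection is not of full rank are null for this product measure, so full rank holds at every step.
The first-order matrix is the collection matrix multiplied on the left by a diagonal matrix with
entries θ[j], which are almost surely nonzero.

The exceptional set is null. For fixed invertible W the matrix h'(Wu)uᵀ almost surely avoids each
given hyperplane, and independence of the data points then gives maximal rank (`ae_rank_eq_min`).
Indeed a relation ∑ⱼ (aⱼ·u) h'(Wⱼ·u) = 0 holding on a set of positive measure can be differentiated
at almost every point of that set (`ae_lineDeriv_eq_zero_of_eq_zero`). Derivatives along the basis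
dual to the rows of W isolate one or two neurons and contradict one of the clauses of C1
(`ae_sum_mul_comp_dotProduct_ne_zero`).

Propagation. Each prox step is r applied to an unprojected point, with r the identity or a radial
retraction. The family Y of unprojected points is a triangular image of the noise, so null sets of Y
pull back to null sets of noise. It remains to show, for almost every data set, that (W, Y) ↦
W_{k+1} pulls Lebesgue null sets back to null sets (`ae_gdMap_readout_notMem`). By a change of
variables on slices this holds where some Jacobian determinant is nonzero. As h'' exists only almost
everywhere, nothing is analytic in W; but for fixed W and x the Jacobian is polynomial in the
readout θ and its variation, so a single good configuration suffices.

If some point is not moved by r, vary W alone: at θ = 0 the Jacobian is the identity. If all points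
are projected onto the sphere of radius ρ, θ = 0 may be unreachable. The configuration used instead
has all points in the direction of one axis i₀, so that θ = ρ e_{i₀} and only one neuron is active.
There the rows other than i₀ move freely, row i₀ moves through `actBlock`, and tangential variations
of one point add the vectors `actResponse` of the other d - 1 neurons. Generically the block is
nonzero, hence of rank at least 1, and each response raises the rank by one until it reaches d
(`ae_actBlock_actResponse_ker`). This is where d ≥ 2 and C1 enter again. -/

namespace TwoLayer

/-! ### Measure-theoretic tools -/

/-- A measurable property holding after resampling one coordinate holds almost everywhere. -/
theorem ae_pi_of_ae_ae_update {ι : Type*} [Fintype ι] [DecidableEq ι] {X : ι → Type*}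
    [∀ i, MeasurableSpace (X i)] (μ : ∀ i, Measure (X i)) [∀ i, SigmaFinite (μ i)]
    {S : Set (∀ i, X i)} (hS : MeasurableSet S) (i : ι)
    (h : ∀ᵐ x ∂Measure.pi μ, ∀ᵐ t ∂μ i, Function.update x i t ∈ S) :
    ∀ᵐ x ∂Measure.pi μ, x ∈ S := by
  rcases isEmpty_or_nonempty (∀ i, X i) with hE | ⟨⟨x₀⟩⟩
  · exact Filter.Eventually.of_forall fun x => hE.elim x
  set f : (∀ i, X i) → ENNReal := Sᶜ.indicator 1 with hf
  have hfm : Measurable f := measurable_one.indicator hS.compl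
  set g : (∀ i, X i) → ENNReal := fun x => ∫⁻ t, f (Function.update x i t) ∂μ i with hg
  have hgf : g = ∫⋯∫⁻_{i}, f ∂μ := (lmarginal_singleton f i).symm
  have hgm : Measurable g := hgf ▸ hfm.lmarginal μ
  have hg0 : ∫⁻ x, g x ∂Measure.pi μ = 0 := by
    rw [lintegral_eq_zero_iff hgm]
    filter_upwards [h] with x hx
    simp only [hg, Pi.zero_apply]
    refine (lintegral_eq_zero_iff (hfm.comp (measurable_update x))).2 ?_
    filter_upwards [hx] with t ht
    simp [hf, ht]
  have key : ∫⁻ x, f x ∂Measure.pi μ = 0 := by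
    -- Integrate coordinate `i` innermost in both integrals. Since `g` does not depend on it, the
    -- inner integral of `g` only multiplies by the mass of `μ i`; unless this mass is zero, the
    -- vanishing of ∫ g gives that of ∫ f.
    rw [lintegral_eq_lmarginal_univ x₀, lmarginal_erase' f hfm (Finset.mem_univ i)]
    rw [lintegral_eq_lmarginal_univ x₀, lmarginal_erase' g hgm (Finset.mem_univ i)] at hg0
    have hgu : (fun x => ∫⁻ t, g (Function.update x i t) ∂μ i) = fun x => g x * μ i Set.univ := by
      funext x
      have : ∀ t, g (Function.update x i t) = g x := fun t => by simp [hg]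
      simp [this]
    rw [hgu] at hg0
    by_cases hz : μ i Set.univ = 0
    · have : μ i = 0 := Measure.measure_univ_eq_zero.1 hz
      simp [this, lmarginal]
    · simp only [lmarginal] at hg0 ⊢
      rw [lintegral_eq_zero_iff (by
        exact (hgm.comp measurable_updateFinset).mul_const _)] at hg0
      refine (lintegral_eq_zero_iff (hgm.comp measurable_updateFinset)).2 ?_
      filter_upwards [hg0] with y hy
      simpa [hz] using hy
  rw [lintegral_eq_zero_iff hfm] at key
  filter_upwards [key] with x hx
  by_contra hxS
  simp [hf, hxS] at hx

/-- Points of the zero set of `φ` where the derivative does not vanish form a countable set. -/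
theorem countable_zero_deriv_ne_zero (φ : ℝ → ℝ) :
    {t | φ t = 0 ∧ ∃ a : ℝ, a ≠ 0 ∧ HasDerivAt φ a t}.Countable := by
  -- A zero with nonzero derivative has no further zeros immediately to its right, and the
  -- right-isolated points of a real set are countable.
  refine (countable_setOfPred_isolated_right_within (s := {t | φ t = 0})).mono ?_
  rintro t ⟨h0, a, ha, hd⟩
  refine ⟨h0, ?_⟩
  have h1 : ∀ᶠ z in nhdsWithin t (Set.Ioi t), φ z ≠ 0 :=
    (hd.eventually_ne ha).filter_mono (nhdsWithin_mono _ fun z hz => ne_of_gt hz)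
  rw [← Filter.empty_mem_iff_bot]
  have h2 : {z | φ z ≠ 0} ∈ nhdsWithin t ({t | φ t = 0} ∩ Set.Ioi t) :=
    nhdsWithin_mono _ Set.inter_subset_right h1
  filter_upwards [h2, self_mem_nhdsWithin] with z hz hz'
  exact hz hz'.1

/-- A directional derivative vanishes almost everywhere on the zero set. -/
theorem ae_lineDeriv_eq_zero_of_eq_zero {E : Type*} [NormedAddCommGroup E] [NormedSpace ℝ E]
    [FiniteDimensional ℝ E] [MeasurableSpace E] [BorelSpace E] (μ : Measure E)
    [μ.IsAddHaarMeasure] {F F' : E → ℝ} (hF : Measurable F) (hF' : Measurable F') (p : E)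
    (h : ∀ᵐ x ∂μ, HasDerivAt (fun t : ℝ => F (x + t • p)) (F' x) 0) :
    ∀ᵐ x ∂μ, F x = 0 → F' x = 0 := by
  obtain ⟨T, hT, hTm, hT0⟩ : ∃ T : Set E, (∀ x ∈ T, HasDerivAt (fun t : ℝ => F (x + t • p)) (F' x) 0)
      ∧ MeasurableSet T ∧ ∀ᵐ x ∂μ, x ∈ T := by
    refine ⟨(toMeasurable μ {x | ¬ HasDerivAt (fun t : ℝ => F (x + t • p)) (F' x) 0})ᶜ,
      fun x hx => ?_, (measurableSet_toMeasurable _ _).compl, ?_⟩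
    · by_contra hc
      exact hx (subset_toMeasurable μ _ hc)
    · refine measure_eq_zero_iff_ae_notMem.1 ?_
      rw [measure_toMeasurable]
      exact ae_iff.1 h
  let Lp : ℝ →ₗ[ℝ] E := LinearMap.toSpanSingleton ℝ E p
  have hS : MeasurableSet {x | F x = 0 → F' x = 0} := by
    have : {x | F x = 0 → F' x = 0} = {x | F x = 0}ᶜ ∪ {x | F' x = 0} := by
      ext x; simp [imp_iff_not_or]
    rw [this]
    exact (hF (measurableSet_singleton 0)).compl.union (hF' (measurableSet_singleton 0))
  -- Fubini along the direction `p`: on almost every line the derivative exists almost everywhere,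
  -- and the zeros with nonzero derivative are countable.
  refine (ae_ae_add_linearMap_mem_iff Lp (volume : Measure ℝ) μ hS).1 ?_
  filter_upwards [(ae_ae_add_linearMap_mem_iff Lp (volume : Measure ℝ) μ hTm).2 hT0] with y hy
  have hc := (countable_zero_deriv_ne_zero (fun t => F (y + t • p))).ae_notMem (volume : Measure ℝ)
  filter_upwards [hy, hc] with t ht htc h0
  by_contra hne
  refine htc ⟨h0, _, hne, ?_⟩
  have h1 := hT _ ht
  have h2 : HasDerivAt (fun s : ℝ => F (y + Lp t + (s - t) • p)) (F' (y + Lp t)) t := by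
    have h3 := HasDerivAt.comp_sub_const (f := fun r : ℝ => F (y + Lp t + r • p)) t t
      (by simpa using h1)
    simpa using h3
  convert h2 using 2 with s
  congr 1
  simp only [Lp, LinearMap.toSpanSingleton_apply]
  module

/-- The preimage of a null set is null where the derivative is invertible. -/
theorem measure_inter_preimage_eq_zero_of_det_ne_zero {E : Type*} [NormedAddCommGroup E]
    [NormedSpace ℝ E] [FiniteDimensional ℝ E] [MeasurableSpace E] [BorelSpace E] (μ : Measure E)
    [μ.IsAddHaarMeasure] {f : E → E} {f' : E → E →L[ℝ] E} {A Z : Set E}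
    (hf : ∀ x ∈ A, HasFDerivAt f (f' x) x) (hdet : ∀ x ∈ A, (f' x).det ≠ 0) (hZ : μ Z = 0) :
    μ (A ∩ f ⁻¹' Z) = 0 := by
  rcases A.eq_empty_or_nonempty with rfl | hA
  · simp
  -- A map close enough to an invertible linear `B` shrinks measure by at most a positive factor
  -- `m`. On countably many such pieces covering `A`, the image of the part over `Z` lies in `Z`, so
  -- that part is null; neither injectivity of `f` nor measurability of `Z` is needed.
  have hδ : ∀ B : E →L[ℝ] E, ∃ δ : ℝ≥0, δ ≠ 0 ∧ (B.det ≠ 0 → ∃ m : ℝ≥0, m ≠ 0 ∧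
      ∀ (s : Set E) (g : E → E), ApproximatesLinearOn g B s δ → (m : ENNReal) * μ s ≤ μ (g '' s)) := by
    intro B
    by_cases hB : B.det = 0
    · exact ⟨1, one_ne_zero, fun h => (h hB).elim⟩
    · obtain ⟨m, hm0, hm⟩ : ∃ m : ℝ≥0, 0 < m ∧ (m : ENNReal) < ENNReal.ofReal |B.det| := by
        have : 0 < ENNReal.ofReal |B.det| := by simpa using hB
        obtain ⟨m, h1, h2⟩ := ENNReal.lt_iff_exists_nnreal_btwn.1 this
        exact ⟨m, by exact_mod_cast h1, h2⟩
      have h1 := mul_le_addHaar_image_of_lt_det μ B hm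
      obtain ⟨δ, h2, h3⟩ := (h1.and self_mem_nhdsWithin).exists
      exact ⟨δ, ne_of_gt h3, fun _ => ⟨m, hm0.ne', h2⟩⟩
  choose r hr hr' using hδ
  obtain ⟨t, B, -, -, hcov, happ, hB⟩ := exists_partition_approximatesLinearOn_of_hasFDerivWithinAt
    f A f' (fun x hx => (hf x hx).hasFDerivWithinAt) r hr
  have hsub : A ∩ f ⁻¹' Z ⊆ ⋃ n, (A ∩ t n) ∩ f ⁻¹' Z := by
    rintro x ⟨hxA, hxZ⟩
    obtain ⟨n, hn⟩ := Set.mem_iUnion.1 (hcov hxA)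
    exact Set.mem_iUnion.2 ⟨n, ⟨hxA, hn⟩, hxZ⟩
  refine measure_mono_null hsub (measure_iUnion_null fun n => ?_)
  obtain ⟨y, hy, hyB⟩ := hB hA n
  obtain ⟨m, hm, hm'⟩ := hr' (B n) (hyB ▸ hdet y hy)
  have h1 := hm' _ f ((happ n).mono_set (Set.inter_subset_left (t := f ⁻¹' Z)))
  have h2 : μ (f '' (A ∩ t n ∩ f ⁻¹' Z)) = 0 := measure_mono_null (by
    rintro _ ⟨x, hx, rfl⟩; exact hx.2) hZ
  rw [h2] at h1
  simpa [hm] using h1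

/-- A map from a product-like space is null-preserving where its restriction to the translates of
a linear slice has invertible derivative. -/
theorem ae_notMem_of_slice_det_ne_zero {E F : Type*} [NormedAddCommGroup E] [NormedSpace ℝ E]
    [FiniteDimensional ℝ E] [MeasurableSpace E] [BorelSpace E] (μ : Measure E)
    [μ.IsAddHaarMeasure] [NormedAddCommGroup F] [NormedSpace ℝ F]
    [FiniteDimensional ℝ F] [MeasurableSpace F] [BorelSpace F] (ν : Measure F)
    [ν.IsAddHaarMeasure] {Φ : E → F} (hΦ : Measurable Φ) (L : F →ₗ[ℝ] E) {G : Set E}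
    (hG : MeasurableSet G)
    (hd : ∀ x ∈ G, ∃ f' : F →L[ℝ] F, f'.det ≠ 0 ∧ HasFDerivAt (fun δ => Φ (x + L δ)) f' 0)
    {Z : Set F} (hZm : MeasurableSet Z) (hZ : ν Z = 0) :
    ∀ᵐ x ∂μ, x ∈ G → Φ x ∉ Z := by
  have hS : MeasurableSet {x | x ∈ G → Φ x ∉ Z} := by
    have : {x | x ∈ G → Φ x ∉ Z} = Gᶜ ∪ Φ ⁻¹' Zᶜ := by ext x; simp [imp_iff_not_or]
    rw [this]
    exact hG.compl.union (hΦ hZm.compl)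
  choose! f' hf' hfd using hd
  -- Fubini over translates of the slice: it suffices to treat δ ↦ `Φ (y + L δ)` for each `y`, where
  -- the derivative at δ is the one given at the base point `y + L δ`.
  refine ae_mem_of_ae_add_linearMap_mem L ν μ hS fun y => ?_
  have := measure_inter_preimage_eq_zero_of_det_ne_zero ν (f := fun δ => Φ (y + L δ))
    (f' := fun δ => f' (y + L δ)) (A := {δ | y + L δ ∈ G}) (Z := Z) (fun δ hδ => by
      have h1 := hfd _ hδ
      have h2 : HasFDerivAt (fun ε => Φ (y + L δ + L (ε - δ))) (f' (y + L δ)) δ := by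
        have h0 : HasFDerivAt (fun ε : F => ε - δ) (ContinuousLinearMap.id ℝ F) δ :=
          (hasFDerivAt_id δ).sub_const δ
        have := HasFDerivAt.comp (g := fun ε => Φ (y + L δ + L ε)) δ (by simpa using h1) h0
        simpa [Function.comp_def] using this
      convert h2 using 2 with ε
      simp) (fun δ hδ => hf' _ hδ) hZ
  rw [ae_iff]
  refine measure_mono_null ?_ this
  intro δ hδ
  have hδ' : ¬ (y + L δ ∈ G → Φ (y + L δ) ∉ Z) := hδ
  simpa using hδ'

/-- Smoothness order `⊤` means analytic here, so the zeros of a function that is not identically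
zero are discrete, hence null. -/
theorem ae_ne_zero_of_analytic {f : ℝ → ℝ} (hf : ContDiff ℝ ⊤ f) {t₀ : ℝ} (h : f t₀ ≠ 0) :
    ∀ᵐ t, f t ≠ 0 := by
  have h1 := hf.analyticOnNhd (s := Set.univ) |>.preimage_zero_mem_codiscrete h
  have h2 := ae_restrict_le_codiscreteWithin (μ := (volume : Measure ℝ)) MeasurableSet.univ h1
  rw [Measure.restrict_univ] at h2
  filter_upwards [h2] with t ht
  simpa using ht

open Pointwise in
/-- An analytic function which does not vanish at the origin is almost everywhere nonzero. -/
theorem ae_ne_zero_of_analytic_of_zero {E : Type*} [NormedAddCommGroup E] [NormedSpace ℝ E]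
    [FiniteDimensional ℝ E] [MeasurableSpace E] [BorelSpace E] (μ : Measure E)
    [μ.IsAddHaarMeasure] {F : E → ℝ} (hF : ContDiff ℝ ⊤ F) (h : F 0 ≠ 0) :
    ∀ᵐ x ∂μ, F x ≠ 0 := by
  have hc : Continuous fun q : E × ℝ => F (q.2 • q.1) := hF.continuous.comp (by fun_prop)
  -- On every line through the origin `F` is nonzero at s = 0, hence at almost every s. Exchanging
  -- the quantifiers yields one dilation s ≠ 0 that works for almost every x, and dilations preserve
  -- null sets.
  have h1 : ∀ᵐ x ∂μ, ∀ᵐ s : ℝ, F (s • x) ≠ 0 := Filter.Eventually.of_forall fun x =>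
    ae_ne_zero_of_analytic (f := fun s : ℝ => F (s • x)) (hF.comp (by fun_prop)) (t₀ := 0)
      (by simpa using h)
  rw [Measure.ae_ae_comm (p := fun x (s : ℝ) => F (s • x) ≠ 0) (isOpen_ne_fun hc continuous_const).measurableSet] at h1
  have h2 : ∀ᵐ s : ℝ, s ≠ 0 := (Set.countable_singleton (0 : ℝ)).ae_notMem volume
  obtain ⟨s, hs, hs0⟩ := (h1.and h2).exists
  rw [ae_iff] at hs ⊢
  have h3 : {x | ¬ F x ≠ 0} = s • {x : E | ¬ F (s • x) ≠ 0} := by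
    ext x
    rw [Set.mem_smul_set_iff_inv_smul_mem₀ hs0]
    simp [smul_smul, hs0]
  rw [h3, Measure.addHaar_smul, hs, mul_zero]

/-- Replacing one coordinate by an invertible affine function of it, with coefficients depending
on the other coordinates, preserves null sets. -/
theorem quasiMeasurePreserving_update_affine {ι κ : Type*} [Fintype ι] [DecidableEq ι] [Fintype κ]
    (i : ι) {a : ℝ} (ha : a ≠ 0) {G : (ι → κ → ℝ) → κ → ℝ} (hG : Measurable G)
    (hGi : ∀ x t, G (Function.update x i t) = G x) :
    Measure.QuasiMeasurePreserving (fun x : ι → κ → ℝ => Function.update x i (a • x i + G x))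
      volume volume := by
  have hm : Measurable fun x : ι → κ → ℝ => Function.update x i (a • x i + G x) := by
    refine measurable_pi_lambda _ fun j => ?_
    by_cases hj : j = i
    · subst hj
      simp only [Function.update_self]
      exact ((measurable_pi_apply j).const_smul a).add hG
    · simp only [Function.update_of_ne hj]
      exact measurable_pi_apply j
  refine ⟨hm, Measure.AbsolutelyContinuous.mk fun Z hZm hZ => ?_⟩
  rw [Measure.map_apply hm hZm]
  have hZ' : ∀ᵐ x : ι → κ → ℝ, x ∉ Z := measure_eq_zero_iff_ae_notMem.1 hZ
  rw [measure_eq_zero_iff_ae_notMem]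
  have key := ae_pi_of_ae_ae_update (fun _ : ι => (volume : Measure (κ → ℝ)))
    (S := (fun x : ι → κ → ℝ => Function.update x i (a • x i + G x)) ⁻¹' Zᶜ) (hm hZm.compl) i ?_
  · exact key
  · have h1 : ∀ᵐ x : ι → κ → ℝ, ∀ᵐ t : κ → ℝ, Function.update x i t ∉ Z := by
      let Li : (κ → ℝ) →ₗ[ℝ] (ι → κ → ℝ) := LinearMap.single ℝ (fun _ : ι => κ → ℝ) i
      have h2 := (ae_ae_add_linearMap_mem_iff Li (volume : Measure (κ → ℝ)) volume hZm.compl).2 hZ'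
      filter_upwards [h2] with x hx
      have h3 : Measure.QuasiMeasurePreserving (fun t : κ → ℝ => t - x i) volume volume :=
        (measurePreserving_sub_right volume (x i)).quasiMeasurePreserving
      filter_upwards [h3.ae hx] with t ht
      convert ht using 2
      ext j k
      by_cases hj : j = i
      · subst hj; simp [Li]
      · simp [Li, hj]
    filter_upwards [h1] with x hx
    have h4 : Measure.QuasiMeasurePreserving (fun t : κ → ℝ => a • t + G x) volume volume := by
      refine ((measurePreserving_add_right volume (G x)).quasiMeasurePreserving).comp
        ⟨by fun_prop, ?_⟩
      rw [Measure.map_addHaar_smul _ ha]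
      exact Measure.smul_absolutelyContinuous
    filter_upwards [h4.ae hx] with t ht
    simpa [hGi] using ht


/-! ### Rank -/

/-- The rank is lower semicontinuous: the matrices of rank at least k form an open set. -/
theorem measurable_rank {X : Type*} [MeasurableSpace X] {m n : Type*} [Fintype m] [Fintype n]
    [DecidableEq n] {A : X → Matrix m n ℝ} (hA : ∀ i j, Measurable fun x => A x i j) :
    Measurable fun x => (A x).rank := by
  refine measurable_of_Ici fun k => ?_
  let T : (m → n → ℝ) → ((n → ℝ) →L[ℝ] (m → ℝ)) := fun B =>
    LinearMap.toContinuousLinearMap (Matrix.toLin' (Matrix.of B))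
  have hT : Continuous T := by
    have : T = ⇑((LinearMap.toContinuousLinearMap : ((n → ℝ) →ₗ[ℝ] (m → ℝ)) ≃ₗ[ℝ] _).toLinearMap ∘ₗ
        (Matrix.toLin' : Matrix m n ℝ ≃ₗ[ℝ] _).toLinearMap ∘ₗ
        (Matrix.ofLinearEquiv ℝ : (m → n → ℝ) ≃ₗ[ℝ] _).toLinearMap) := rfl
    rw [this]
    exact LinearMap.continuous_of_finiteDimensional _
  have h1 : IsOpen (T ⁻¹' {f | (k : Cardinal) ≤ (f : (n → ℝ) →ₗ[ℝ] (m → ℝ)).rank}) :=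
    (isOpen_setOfPred_nat_le_rank k).preimage hT
  have h2 : Measurable (β := m → n → ℝ) fun x => A x :=
    measurable_pi_lambda _ fun i => measurable_pi_lambda _ fun j => hA i j
  convert h2 h1.measurableSet using 1
  ext x
  change k ≤ (A x).rank ↔ (k : Cardinal) ≤ LinearMap.rank (Matrix.toLin' (A x))
  rw [Matrix.rank, LinearMap.rank, ← Module.finrank_eq_rank, Nat.cast_le]
  rfl

theorem exists_ne_zero_dotProduct_eq_zero {m : Type*} [Fintype m] (V : Submodule ℝ (m → ℝ))
    (hV : Module.finrank ℝ V < Fintype.card m) :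
    ∃ a : m → ℝ, a ≠ 0 ∧ ∀ x ∈ V, a ⬝ᵥ x = 0 := by
  classical
  have hV' : V < ⊤ := by
    rw [lt_top_iff_ne_top]
    rintro rfl
    simp at hV
  obtain ⟨f, hf, hfV⟩ := V.exists_dual_map_eq_bot_of_lt_top hV' inferInstance
  refine ⟨fun i => f (Pi.single i 1), ?_, ?_⟩
  · intro h0
    apply hf
    refine LinearMap.pi_ext' fun i => LinearMap.ext_ring ?_
    simpa using congrFun h0 i
  · intro x hx
    have h1 : f x = 0 := by
      have : f x ∈ V.map f := ⟨x, hx, rfl⟩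
      rw [hfV] at this
      simpa using this
    rw [← h1]
    conv_rhs => rw [pi_eq_sum_univ' x]
    simp [dotProduct, mul_comm, map_sum]

theorem span_updateCol_zero_le {m n : Type*} [DecidableEq n] (A : Matrix m n ℝ) (k : n) :
    Submodule.span ℝ (Set.range (A.updateCol k 0).col) ≤ Submodule.span ℝ (Set.range A.col) := by
  refine Submodule.span_le.2 ?_
  rintro _ ⟨i, rfl⟩
  by_cases hi : i = k
  · have : (A.updateCol k 0).col i = 0 := by ext p; simp [hi]
    rw [this]
    exact Submodule.zero_mem _
  · have : (A.updateCol k 0).col i = A.col i := by ext p; simp [hi]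
    rw [this]
    exact Submodule.subset_span (Set.mem_range_self i)

/-- Independent random vectors that avoid every fixed hyperplane are almost surely of maximal
rank. -/
theorem ae_rank_eq_min {X m : Type*} [MeasurableSpace X] [Fintype m] {N : ℕ}
    (μ : Fin N → Measure X) [∀ i, IsProbabilityMeasure (μ i)] {M : X → m → ℝ} (hM : Measurable M)
    (h : ∀ i, ∀ a : m → ℝ, a ≠ 0 → ∀ᵐ x ∂μ i, a ⬝ᵥ M x ≠ 0) :
    ∀ᵐ x ∂Measure.pi μ, (Matrix.of fun p (i : Fin N) => M (x i) p).rank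
      = min N (Fintype.card m) := by
  classical
  set A : (Fin N → X) → Matrix m (Fin N) ℝ := fun x => Matrix.of fun p i => M (x i) p with hA
  have hMp : ∀ p, Measurable fun x => M x p := fun p => (measurable_pi_apply p).comp hM
  have hAm : ∀ p i, Measurable fun x => A x p i := fun p i =>
    (hMp p).comp (measurable_pi_apply i)
  have hAim : ∀ k p i, Measurable fun x => (A x).updateCol k 0 p i := by
    intro k p i
    by_cases hi : i = k
    · subst hi; simp
    · simpa [Matrix.updateCol_apply, hi] using hAm p i
  have hlt : ∀ x k (a : m → ℝ), a ⬝ᵥ M (x k) ≠ 0 →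
      (∀ y ∈ Submodule.span ℝ (Set.range ((A x).updateCol k 0).col), a ⬝ᵥ y = 0) →
      ((A x).updateCol k 0).rank < (A x).rank := by
    intro x k a ha hk
    rw [Matrix.rank_eq_finrank_span_cols, Matrix.rank_eq_finrank_span_cols]
    apply Submodule.finrank_lt_finrank_of_lt
    refine lt_of_le_of_ne (span_updateCol_zero_le _ _) fun heq => ha (hk _ ?_)
    rw [heq]
    exact Submodule.subset_span ⟨k, rfl⟩
  -- Zeroing column `k` removes it without changing the index type. If the other columns do not
  -- span, they lie in a fixed hyperplane, which the resampled column `k` almost surely leaves.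
  have key : ∀ k, ∀ᵐ x ∂Measure.pi μ, ((A x).updateCol k 0).rank = Fintype.card m ∨
      ((A x).updateCol k 0).rank < (A x).rank := by
    intro k
    have hm1 := measurable_rank (hAim k)
    have hm2 := measurable_rank hAm
    refine ae_pi_of_ae_ae_update μ (S := {x | ((A x).updateCol k 0).rank = Fintype.card m ∨
      ((A x).updateCol k 0).rank < (A x).rank}) ?_ k (Filter.Eventually.of_forall fun x => ?_)
    · exact (hm1 (measurableSet_singleton _)).union (measurableSet_lt hm1 hm2)
    · have hup : ∀ t, (A (Function.update x k t)).updateCol k 0 = (A x).updateCol k 0 := by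
        intro t
        ext p i
        by_cases hi : i = k
        · subst hi; simp
        · simp [hi, hA]
      rcases lt_or_ge ((A x).updateCol k 0).rank (Fintype.card m) with hr | hr
      · have hr' := hr
        rw [Matrix.rank_eq_finrank_span_cols] at hr'
        obtain ⟨a, ha, hax⟩ := exists_ne_zero_dotProduct_eq_zero _ hr'
        filter_upwards [h k a ha] with t ht
        right
        exact hlt _ k a (by simpa using ht) (by rw [hup]; exact hax)
      · refine Filter.Eventually.of_forall fun t => Or.inl ?_
        rw [hup]
        exact le_antisymm (Matrix.rank_le_card_height _) hr
  filter_upwards [ae_all_iff.2 key] with x hx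
  have hle : (A x).rank ≤ min N (Fintype.card m) :=
    le_min (by simpa using Matrix.rank_le_card_width (A x)) (Matrix.rank_le_card_height _)
  refine le_antisymm hle ?_
  -- Either the columns other than some `k` already span, or no column lies in the span of the
  -- others and all N are independent.
  by_cases hex : ∃ k, ((A x).updateCol k 0).rank = Fintype.card m
  · obtain ⟨k, hk⟩ := hex
    refine (min_le_right _ _).trans ?_
    rw [← hk, Matrix.rank_eq_finrank_span_cols, Matrix.rank_eq_finrank_span_cols]
    exact Submodule.finrank_mono (span_updateCol_zero_le _ _)
  · push Not at hex
    have hli : LinearIndependent ℝ (A x).col := by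
      rw [linearIndependent_iff_notMem_span]
      intro k hk
      have h1 := (hx k).resolve_left (hex k)
      refine absurd h1 (not_lt.2 ?_)
      rw [Matrix.rank_eq_finrank_span_cols, Matrix.rank_eq_finrank_span_cols]
      refine Submodule.finrank_mono (Submodule.span_le.2 ?_)
      have h2 : Submodule.span ℝ ((A x).col '' (Set.univ \ {k})) ≤
          Submodule.span ℝ (Set.range ((A x).updateCol k 0).col) := by
        refine Submodule.span_mono ?_
        rintro _ ⟨i, hi, rfl⟩
        refine ⟨i, ?_⟩
        have hi' : i ≠ k := by simpa using hi
        ext p; simp [Matrix.col, hi']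
      rintro _ ⟨i, rfl⟩
      by_cases hi : i = k
      · subst hi; exact h2 hk
      · exact h2 (Submodule.subset_span ⟨i, by simpa using hi, rfl⟩)
    rw [Matrix.rank_eq_finrank_span_cols, finrank_span_eq_card hli, Fintype.card_fin]
    exact min_le_left _ _

/-! ### Consequences of condition C1 -/

section C1

variable {g : ℝ → ℝ}

theorem ConditionC1.ae_deriv_ne (hC : ConditionC1 g) (c : ℝ) : ∀ᵐ x, deriv g x ≠ c := by
  by_contra hne
  refine hC {x | deriv g x = c} ?_ ⟨c, 0, 0, Or.inl fun x hx => hx⟩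
  rw [pos_iff_ne_zero]
  intro h0
  exact hne (by rw [ae_iff]; simpa using h0)

theorem ConditionC1.ae_mul_deriv_add_ne (hC : ConditionC1 g) (c₂ c₃ : ℝ) :
    ∀ᵐ x, (x + c₂) * deriv g x + g x ≠ c₃ := by
  by_contra hne
  refine hC {x | (x + c₂) * deriv g x + g x = c₃} ?_ ⟨0, c₂, c₃, Or.inr fun x hx => hx⟩
  rw [pos_iff_ne_zero]
  intro h0
  exact hne (by rw [ae_iff]; simpa using h0)

/-- On a level set of `g` the derivative vanishes almost everywhere, and C1 with c₁ = 0 forbids that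
on positive measure. -/
theorem ConditionC1.ae_ne (hC : ConditionC1 g) (hg : Measurable g)
    (hd : ∀ᵐ x, DifferentiableAt ℝ g x) (c : ℝ) : ∀ᵐ x, g x ≠ c := by
  have h1 := ae_lineDeriv_eq_zero_of_eq_zero (volume : Measure ℝ) (F := fun x => g x - c)
    (F' := deriv g) (hg.sub_const c) (measurable_deriv g) 1 (by
      filter_upwards [hd] with x hx
      have h2 : HasDerivAt (fun t : ℝ => x + t) 1 0 := (hasDerivAt_id (0 : ℝ)).const_add x
      have h3 : HasDerivAt g (deriv g x) (x + 0) := by simpa using hx.hasDerivAt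
      simpa using (HasDerivAt.comp (0 : ℝ) h3 h2).sub_const c)
  filter_upwards [h1, hC.ae_deriv_ne 0] with x hx hx' h0
  exact hx' (hx (sub_eq_zero.2 h0))

end C1

/-! ### Linear forms -/

theorem quasiMeasurePreserving_dotProduct {d : ℕ} {w : Fin d → ℝ} (hw : w ≠ 0) :
    Measure.QuasiMeasurePreserving (fun u : Fin d → ℝ => w ⬝ᵥ u) volume volume := by
  let Lw : (Fin d → ℝ) →ₗ[ℝ] ℝ := dotProductBilin ℝ ℝ w
  have hL : Function.Surjective Lw := by
    refine LinearMap.surjective fun h0 => hw ?_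
    ext i
    have := LinearMap.congr_fun h0 (Pi.single i 1)
    simpa [Lw] using this
  have hm : Measurable Lw := Lw.continuous_of_finiteDimensional.measurable
  refine ⟨hm, Measure.AbsolutelyContinuous.mk fun Z hZ h0 => ?_⟩
  have h1 := (ae_comp_linearMap_mem_iff Lw (volume : Measure (Fin d → ℝ)) (volume : Measure ℝ) hL
    hZ.compl).2 (measure_eq_zero_iff_ae_notMem.1 h0)
  change Measure.map Lw volume Z = 0
  rw [Measure.map_apply hm hZ, measure_eq_zero_iff_ae_notMem]
  exact h1

theorem hasDerivAt_comp_dotProduct {d : ℕ} {f : ℝ → ℝ} {f' : ℝ} (w u p : Fin d → ℝ)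
    (hf : HasDerivAt f f' (w ⬝ᵥ u)) :
    HasDerivAt (fun t : ℝ => f (w ⬝ᵥ (u + t • p))) (f' * (w ⬝ᵥ p)) 0 := by
  have h2 : HasDerivAt (fun t : ℝ => w ⬝ᵥ (u + t • p)) (w ⬝ᵥ p) 0 := by
    have : (fun t : ℝ => w ⬝ᵥ (u + t • p)) = fun t => w ⬝ᵥ u + t * (w ⬝ᵥ p) := by
      funext t; simp [dotProduct_add]
    rw [this]
    simpa using ((hasDerivAt_id (0 : ℝ)).mul_const (w ⬝ᵥ p)).const_add (w ⬝ᵥ u)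
  exact HasDerivAt.comp (0 : ℝ) (by simpa using hf) h2

theorem hasDerivAt_dotProduct {d : ℕ} (w u p : Fin d → ℝ) :
    HasDerivAt (fun t : ℝ => w ⬝ᵥ (u + t • p)) (w ⬝ᵥ p) 0 := by
  simpa using hasDerivAt_comp_dotProduct (f := id) w u p (hasDerivAt_id _)

@[fun_prop]
theorem measurable_dotProduct_comp {X : Type*} [MeasurableSpace X] {d : ℕ} {f g : X → Fin d → ℝ}
    (hf : Measurable f) (hg : Measurable g) : Measurable fun x => f x ⬝ᵥ g x := by
  simp only [dotProduct]
  fun_prop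

/-! ### Generic full rank for weights independent of the data -/

/-- Let p be the basis dual to the rows of W and write a = bW. On the zero set the derivative along
p m, then along p l with l ≠ m, gives b l m g'(W l·u) + b m l g'(W m·u) = 0 almost everywhere. If b
l m ≠ 0 this prescribes g' along lines parallel to p l, against the first clause of C1. If b is
diagonal, the first derivative alone reads b m m (s g'(s) + g(s)) = 0 with s = W m·u, against the
second clause. -/
theorem ae_sum_mul_comp_dotProduct_ne_zero {d : ℕ} {g : ℝ → ℝ} (hC : ConditionC1 g)
    (hg : Measurable g) (hd : ∀ᵐ x, DifferentiableAt ℝ g x) {W : Matrix (Fin d) (Fin d) ℝ}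
    (hW : IsUnit W.det) {a : Matrix (Fin d) (Fin d) ℝ} (ha : a ≠ 0) :
    ∀ᵐ u : Fin d → ℝ, ∑ j, (a j ⬝ᵥ u) * g (W j ⬝ᵥ u) ≠ 0 := by
  set p : Fin d → Fin d → ℝ := fun m k => W⁻¹ k m with hp
  have hWp : ∀ j m, W j ⬝ᵥ p m = if j = m then 1 else 0 := by
    intro j m
    have : (W * W⁻¹) j m = (1 : Matrix (Fin d) (Fin d) ℝ) j m := by rw [Matrix.mul_nonsing_inv _ hW]
    simpa [Matrix.mul_apply', Matrix.one_apply, hp] using this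
  have hW0 : ∀ j, W j ≠ 0 := by
    intro j h0
    have := hWp j j
    simp [h0] at this
  set b : Matrix (Fin d) (Fin d) ℝ := fun j m => a j ⬝ᵥ p m with hb
  have hba : b = a * W⁻¹ := by ext j m; simp [Matrix.mul_apply', hb, hp]
  have hab : a = b * W := by rw [hba, Matrix.mul_assoc, Matrix.nonsing_inv_mul _ hW, mul_one]
  have hb0 : b ≠ 0 := by rintro h0; apply ha; rw [hab, h0, zero_mul]
  have hD : ∀ᵐ u : Fin d → ℝ, ∀ j, DifferentiableAt ℝ g (W j ⬝ᵥ u) :=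
    ae_all_iff.2 fun j => (quasiMeasurePreserving_dotProduct (hW0 j)).ae hd
  have hgd := measurable_deriv g
  have first : ∀ m, ∀ᵐ u : Fin d → ℝ, ∑ j, (a j ⬝ᵥ u) * g (W j ⬝ᵥ u) = 0 →
      ∑ j, b j m * g (W j ⬝ᵥ u) + (a m ⬝ᵥ u) * deriv g (W m ⬝ᵥ u) = 0 := by
    intro m
    refine ae_lineDeriv_eq_zero_of_eq_zero volume (by fun_prop) (by fun_prop) (p m) ?_
    filter_upwards [hD] with u hu
    have h1 : HasDerivAt (fun t : ℝ => ∑ j, (a j ⬝ᵥ (u + t • p m)) * g (W j ⬝ᵥ (u + t • p m)))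
        (∑ j, (b j m * g (W j ⬝ᵥ u) + (a j ⬝ᵥ u) * (deriv g (W j ⬝ᵥ u) * (W j ⬝ᵥ p m)))) 0 := by
      refine HasDerivAt.fun_sum fun j _ => ?_
      have := (hasDerivAt_dotProduct (a j) u (p m)).mul
        (hasDerivAt_comp_dotProduct (W j) u (p m) (hu j).hasDerivAt)
      exact this.congr_deriv (by simp [hb])
    convert h1 using 1
    rw [Finset.sum_add_distrib]
    simp [hWp]
  have second : ∀ m l, l ≠ m → ∀ᵐ u : Fin d → ℝ,
      ∑ j, b j m * g (W j ⬝ᵥ u) + (a m ⬝ᵥ u) * deriv g (W m ⬝ᵥ u) = 0 →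
      b l m * deriv g (W l ⬝ᵥ u) + b m l * deriv g (W m ⬝ᵥ u) = 0 := by
    intro m l hlm
    refine ae_lineDeriv_eq_zero_of_eq_zero volume (by fun_prop) (by fun_prop) (p l) ?_
    filter_upwards [hD] with u hu
    have h1 : HasDerivAt (fun t : ℝ => ∑ j, b j m * g (W j ⬝ᵥ (u + t • p l)))
        (∑ j, b j m * (deriv g (W j ⬝ᵥ u) * (W j ⬝ᵥ p l))) 0 :=
      HasDerivAt.fun_sum fun j _ =>
        (hasDerivAt_comp_dotProduct (W j) u (p l) (hu j).hasDerivAt).const_mul (b j m)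
    have h2 : HasDerivAt (fun t : ℝ => (a m ⬝ᵥ (u + t • p l)) * deriv g (W m ⬝ᵥ (u + t • p l)))
        (b m l * deriv g (W m ⬝ᵥ u)) 0 := by
      -- The argument of `deriv g` is constant along `p l`, so `deriv g` itself, which need not be
      -- differentiable, is never differentiated.
      have : ∀ t : ℝ, W m ⬝ᵥ (u + t • p l) = W m ⬝ᵥ u := by
        intro t; simp [dotProduct_add, hWp, hlm.symm]
      have h3 := (hasDerivAt_dotProduct (a m) u (p l)).mul_const (deriv g (W m ⬝ᵥ u))
      have e : (fun t : ℝ => (a m ⬝ᵥ (u + t • p l)) * deriv g (W m ⬝ᵥ (u + t • p l))) =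
          fun t => (a m ⬝ᵥ (u + t • p l)) * deriv g (W m ⬝ᵥ u) := by
        funext t; rw [this]
      rw [e]
      exact h3
    exact (h1.add h2).congr_deriv (by simp [hWp])
  by_cases hoff : ∃ l m, l ≠ m ∧ b l m ≠ 0
  · obtain ⟨l, m, hlm, hblm⟩ := hoff
    have third : ∀ᵐ u : Fin d → ℝ, u ∈ {u : Fin d → ℝ |
        b l m * deriv g (W l ⬝ᵥ u) + b m l * deriv g (W m ⬝ᵥ u) ≠ 0} := by
      refine ae_mem_of_ae_add_linearMap_mem (LinearMap.toSpanSingleton ℝ _ (p l))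
        (volume : Measure ℝ) volume ?_ fun u => ?_
      · exact (measurableSet_singleton (0 : ℝ)).compl.preimage (by fun_prop)
      · have h1 := hC.ae_deriv_ne (-(b m l * deriv g (W m ⬝ᵥ u)) / b l m)
        have h2 := (measurePreserving_add_left volume (W l ⬝ᵥ u)).quasiMeasurePreserving.ae h1
        filter_upwards [h2] with t ht
        change b l m * deriv g (W l ⬝ᵥ (u + _)) + b m l * deriv g (W m ⬝ᵥ (u + _)) ≠ 0
        simp only [LinearMap.toSpanSingleton_apply, dotProduct_add,
          dotProduct_smul, hWp, if_neg hlm.symm, if_true, smul_eq_mul, mul_one, mul_zero, add_zero]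
        intro h0
        apply ht
        rw [eq_div_iff hblm]
        linarith
    filter_upwards [first m, second m l hlm, third] with u h1 h2 h3 h0
    exact h3 (h2 (h1 h0))
  · push Not at hoff
    obtain ⟨m, hm⟩ : ∃ m, b m m ≠ 0 := by
      by_contra hc
      push Not at hc
      apply hb0
      ext l m
      by_cases hlm : l = m
      · subst hlm; exact hc l
      · exact hoff l m hlm
    have h4 := (quasiMeasurePreserving_dotProduct (hW0 m)).ae (hC.ae_mul_deriv_add_ne 0 0)
    filter_upwards [first m, h4] with u h1 h4 h0
    have h5 := h1 h0
    have h6 : a m ⬝ᵥ u = b m m * (W m ⬝ᵥ u) := by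
      have : a m ⬝ᵥ u = ∑ k, b m k * (W k ⬝ᵥ u) := by
        have h7 : a *ᵥ u = b *ᵥ (W *ᵥ u) := by rw [Matrix.mulVec_mulVec, ← hab]
        simpa [Matrix.mulVec, dotProduct] using congrFun h7 m
      rw [this, Finset.sum_eq_single m]
      · intro k _ hk; rw [hoff m k hk.symm, zero_mul]
      · simp
    rw [h6, Finset.sum_eq_single m] at h5
    · apply h4
      have : b m m * ((W m ⬝ᵥ u + 0) * deriv g (W m ⬝ᵥ u) + g (W m ⬝ᵥ u)) = 0 := by linarith
      exact (mul_eq_zero.1 this).resolve_left hm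
    · intro k _ hk; rw [hoff k m hk, zero_mul]
    · simp


/-! ### Kernels and ranks of matrices depending on a parameter -/

theorem rank_le_of_ker_le {m m' : Type*} [Fintype m] [Fintype m'] {d : ℕ}
    {A : Matrix m (Fin d) ℝ} {B : Matrix m' (Fin d) ℝ} (hAB : ∀ y, B *ᵥ y = 0 → A *ᵥ y = 0) :
    A.rank ≤ B.rank := by
  have h1 := LinearMap.finrank_range_add_finrank_ker A.mulVecLin
  have h2 := LinearMap.finrank_range_add_finrank_ker B.mulVecLin
  have h3 : Module.finrank ℝ (LinearMap.ker B.mulVecLin) ≤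
      Module.finrank ℝ (LinearMap.ker A.mulVecLin) :=
    Submodule.finrank_mono fun y hy => hAB y hy
  simp only [Matrix.rank]
  omega

theorem rank_lt_of_ker_lt {m m' : Type*} [Fintype m] [Fintype m'] {d : ℕ}
    {A : Matrix m (Fin d) ℝ} {B : Matrix m' (Fin d) ℝ} (hAB : ∀ y, B *ᵥ y = 0 → A *ᵥ y = 0)
    {y : Fin d → ℝ} (hy : A *ᵥ y = 0) (hy' : B *ᵥ y ≠ 0) : A.rank < B.rank := by
  have h1 := LinearMap.finrank_range_add_finrank_ker A.mulVecLin
  have h2 := LinearMap.finrank_range_add_finrank_ker B.mulVecLin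
  have h3 : Module.finrank ℝ (LinearMap.ker B.mulVecLin) <
      Module.finrank ℝ (LinearMap.ker A.mulVecLin) :=
    Submodule.finrank_lt_finrank_of_lt (SetLike.lt_iff_le_and_exists.2
      ⟨fun y hy => hAB y hy, y, hy, hy'⟩)
  simp only [Matrix.rank]
  omega

theorem exists_mulVec_eq_zero_of_rank_lt {m : Type*} [Fintype m] {d : ℕ}
    {A : Matrix m (Fin d) ℝ} (h : A.rank < d) : ∃ y ≠ 0, A *ᵥ y = 0 := by
  by_contra! hc
  have h1 := LinearMap.finrank_range_add_finrank_ker A.mulVecLin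
  have h2 : LinearMap.ker A.mulVecLin = ⊥ := by
    refine LinearMap.ker_eq_bot'.2 fun y hy => ?_
    by_contra hy0
    exact hc y hy0 hy
  rw [h2] at h1
  simp only [Matrix.rank] at h
  simp at h1
  omega

theorem eq_zero_of_mulVec_eq_zero_of_rank {m : Type*} [Fintype m] {d : ℕ}
    {A : Matrix m (Fin d) ℝ} (h : d ≤ A.rank) {y : Fin d → ℝ} (hy : A *ᵥ y = 0) : y = 0 := by
  by_contra hy0
  have h1 := rank_lt_of_ker_lt (A := A) (B := (1 : Matrix (Fin d) (Fin d) ℝ))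
    (fun z hz => by rw [Matrix.one_mulVec] at hz; simp [hz]) hy (by simpa using hy0)
  simp at h1
  omega

/-- The condition says that appending the row `w x` to `A x` does not raise the rank, a comparison
of two measurable functions. -/
theorem measurableSet_ker_le {X : Type*} [MeasurableSpace X] {m : Type*} [Fintype m] {d : ℕ}
    {A : X → Matrix m (Fin d) ℝ} (hA : ∀ i j, Measurable fun x => A x i j)
    {w : X → Fin d → ℝ} (hw : Measurable w) :
    MeasurableSet {x | ∀ y, A x *ᵥ y = 0 → w x ⬝ᵥ y = 0} := by
  let B : X → Matrix (m ⊕ Unit) (Fin d) ℝ := fun x =>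
    Matrix.fromRows (A x) (Matrix.of fun _ => w x)
  have hB : ∀ i j, Measurable fun x => B x i j := by
    rintro (i | i) j
    · exact hA i j
    · exact (measurable_pi_apply j).comp hw
  have hBA : ∀ x y, B x *ᵥ y = 0 ↔ A x *ᵥ y = 0 ∧ w x ⬝ᵥ y = 0 := by
    intro x y
    simp only [B, Matrix.fromRows_mulVec]
    constructor
    · intro h
      exact ⟨funext fun i => congrFun h (Sum.inl i), congrFun h (Sum.inr ())⟩
    · rintro ⟨h1, h2⟩
      funext i
      rcases i with i | i
      · exact congrFun h1 i
      · exact h2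
  convert measurableSet_le (measurable_rank hB) (measurable_rank hA) using 1
  ext x
  constructor
  · intro h
    exact rank_le_of_ker_le fun y hy => (hBA x y).2 ⟨hy, h y hy⟩
  · intro h y hy
    by_contra hne
    have := rank_lt_of_ker_lt (A := A x) (B := B x) (fun y hy => ((hBA x y).1 hy).1) hy
      (fun h0 => hne ((hBA x y).1 h0).2)
    exact absurd h (not_le.2 this)

/-! ### The Jacobian of the outer step at a one-neuron readout -/

section OneNeuron

variable {d N : ℕ} (h : ℝ → ℝ)

/-- Diagonal coefficient of the Jacobian block of the active neuron. -/
noncomputable def actCoef (ρ : ℝ) (w : Fin d → ℝ) (x : (Fin d → ℝ) × ℝ) : ℝ :=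
  ρ * ((x.2 - ρ * h (w ⬝ᵥ x.1)) * deriv (deriv h) (w ⬝ᵥ x.1) - ρ * deriv h (w ⬝ᵥ x.1) ^ 2)

/-- Jacobian block of the active neuron. -/
noncomputable def actBlock (c ρ : ℝ) (x : Fin N → (Fin d → ℝ) × ℝ) (w : Fin d → ℝ) : Matrix (Fin d) (Fin d) ℝ :=
  1 + ∑ i, (c * actCoef h ρ w (x i)) • Matrix.vecMulVec (x i).1 (x i).1

/-- Response of the active neuron to a variation of the readout of a neuron with weights `w'`. -/
noncomputable def actResponse (x : Fin N → (Fin d → ℝ) × ℝ) (w w' : Fin d → ℝ) : Fin d → ℝ :=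
  ∑ i, (h (w' ⬝ᵥ (x i).1) * deriv h (w ⬝ᵥ (x i).1)) • (x i).1

/-- A family of `d + 1` linearly independent quadratic forms. -/
noncomputable def quadForms (i₀ i₁ : Fin d) (u : Fin d → ℝ) : Option (Fin d) → ℝ
  | none => u i₁ ^ 2
  | some k => u i₀ * u k

/-- Second derivatives of the response, contracted against `quadForms`. -/
noncomputable def responseHess (i₀ i₁ : Fin d) (x : Fin N → (Fin d → ℝ) × ℝ) (w w' : Fin d → ℝ) :
    Matrix (Option (Fin d)) (Fin d) ℝ :=
  Matrix.of fun k l => ∑ i, (deriv h (w ⬝ᵥ (x i).1) * deriv (deriv h) (w' ⬝ᵥ (x i).1)) *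
    quadForms i₀ i₁ (x i).1 k * (x i).1 l

variable {h}

theorem ae_quadForms_ne_zero {i₀ i₁ : Fin d} (h01 : i₀ ≠ i₁) {a : Option (Fin d) → ℝ}
    (ha : a ≠ 0) : ∀ᵐ u : Fin d → ℝ, a ⬝ᵥ quadForms i₀ i₁ u ≠ 0 := by
  set b : Fin d → ℝ := fun k => a (some k) with hb
  have hq : ∀ u, a ⬝ᵥ quadForms i₀ i₁ u = a none * u i₁ ^ 2 + u i₀ * (b ⬝ᵥ u) := by
    intro u
    simp only [dotProduct, Fintype.sum_option, quadForms, hb, Finset.mul_sum]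
    congr 1
    refine Finset.sum_congr rfl fun k _ => by ring
  simp only [hq]
  -- Without the square term the form is a product of two nonzero linear forms. With it, the second
  -- derivative along the axis `i₁` is the nonzero constant `2 * a none`, because `i₀ ≠ i₁`.
  by_cases h0 : a none = 0
  · have hb0 : b ≠ 0 := by
      intro hb0
      apply ha
      ext k
      rcases k with _ | k
      · exact h0
      · exact congrFun hb0 k
    have hs : (Pi.single i₀ 1 : Fin d → ℝ) ≠ 0 := by simp
    have hnz : ∀ᵐ x : ℝ, x ≠ 0 := (Set.countable_singleton (0 : ℝ)).ae_notMem volume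
    filter_upwards [(quasiMeasurePreserving_dotProduct hb0).ae hnz,
      (quasiMeasurePreserving_dotProduct hs).ae hnz] with u h1 h2
    rw [single_one_dotProduct] at h2
    simp [h0, h1, h2]
  · have hp : ∀ (u : Fin d → ℝ) (t : ℝ), (u + t • (Pi.single i₁ 1 : Fin d → ℝ)) i₁ = u i₁ + t := by
      intro u t; simp
    have hp0 : ∀ (u : Fin d → ℝ) (t : ℝ), (u + t • (Pi.single i₁ 1 : Fin d → ℝ)) i₀ = u i₀ := by
      intro u t; simp [h01]
    have hid : ∀ x : ℝ, HasDerivAt (fun t : ℝ => x + t) 1 0 := fun x =>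
      (hasDerivAt_id (0 : ℝ)).const_add x
    have first := ae_lineDeriv_eq_zero_of_eq_zero volume
      (F := fun u : Fin d → ℝ => a none * u i₁ ^ 2 + u i₀ * (b ⬝ᵥ u))
      (F' := fun u => a none * (2 * u i₁) + u i₀ * b i₁) (by fun_prop) (by fun_prop)
      (Pi.single i₁ 1) (Filter.Eventually.of_forall fun u => by
        simp only [hp, hp0]
        have h1 := (((hid (u i₁)).pow 2).const_mul (a none)).add
          ((hasDerivAt_dotProduct b u (Pi.single i₁ 1)).const_mul (u i₀))
        exact h1.congr_deriv (by simp))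
    have second := ae_lineDeriv_eq_zero_of_eq_zero volume
      (F := fun u : Fin d → ℝ => a none * (2 * u i₁) + u i₀ * b i₁)
      (F' := fun _ => a none * 2) (by fun_prop) (by fun_prop)
      (Pi.single i₁ 1) (Filter.Eventually.of_forall fun u => by
        simp only [hp, hp0]
        have h1 := (((hid (u i₁)).const_mul 2).const_mul (a none)).add_const (u i₀ * b i₁)
        exact h1.congr_deriv (by simp))
    filter_upwards [first, second] with u h1 h2 h3
    exact h0 (by simpa using h2 (h1 h3))

theorem ae_fst_of_map_fst_absolutelyContinuous {μ : Measure ((Fin d → ℝ) × ℝ)}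
    (hμ : μ.map Prod.fst ≪ volume) {p : (Fin d → ℝ) → Prop} (hp : ∀ᵐ u, p u) :
    ∀ᵐ t ∂μ, p t.1 :=
  ae_of_ae_map measurable_fst.aemeasurable (hμ.ae_le hp)

theorem ae_dotProduct_of_map_fst_absolutelyContinuous {μ : Measure ((Fin d → ℝ) × ℝ)}
    (hμ : μ.map Prod.fst ≪ volume) {w : Fin d → ℝ} (hw : w ≠ 0) {p : ℝ → Prop}
    (hp : ∀ᵐ x, p x) : ∀ᵐ t ∂μ, p (w ⬝ᵥ t.1) :=
  ae_fst_of_map_fst_absolutelyContinuous hμ ((quasiMeasurePreserving_dotProduct hw).ae hp)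

@[fun_prop]
theorem measurable_actBlock (hh : Measurable h) (c ρ : ℝ) (p q : Fin d) {X : Type*}
    [MeasurableSpace X] {x : X → Fin N → (Fin d → ℝ) × ℝ} {w : X → Fin d → ℝ}
    (hx : Measurable x) (hw : Measurable w) :
    Measurable fun z => actBlock h c ρ (x z) (w z) p q := by
  have h1 := measurable_deriv h
  have h2 := measurable_deriv (deriv h)
  have hx1 : ∀ i, Measurable fun z => (x z i).1 := fun i => by fun_prop
  have hx2 : ∀ i, Measurable fun z => (x z i).2 := fun i => by fun_prop
  simp only [actBlock, actCoef, Matrix.add_apply, Matrix.sum_apply, Matrix.smul_apply,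
    Matrix.vecMulVec_apply, smul_eq_mul]
  fun_prop

theorem measurable_responseHess (i₀ i₁ : Fin d) (k : Option (Fin d)) (l : Fin d) {X : Type*}
    [MeasurableSpace X] {x : X → Fin N → (Fin d → ℝ) × ℝ} {w w' : X → Fin d → ℝ}
    (hx : Measurable x) (hw : Measurable w) (hw' : Measurable w') :
    Measurable fun z => responseHess h i₀ i₁ (x z) (w z) (w' z) k l := by
  have h1 := measurable_deriv h
  have h2 := measurable_deriv (deriv h)
  have hx1 : ∀ i, Measurable fun z => (x z i).1 := fun i => by fun_prop
  cases k
  all_goals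
    simp only [responseHess, Matrix.of_apply, quadForms]
    fun_prop

theorem measurable_actResponse (hh : Measurable h) {X : Type*}
    [MeasurableSpace X] {x : X → Fin N → (Fin d → ℝ) × ℝ} {w w' : X → Fin d → ℝ}
    (hx : Measurable x) (hw : Measurable w) (hw' : Measurable w') :
    Measurable fun z => actResponse h (x z) (w z) (w' z) := by
  have h1 := measurable_deriv h
  have hx1 : ∀ i, Measurable fun z => (x z i).1 := fun i => by fun_prop
  unfold actResponse
  fun_prop

theorem measurableSet_eq_zero_matrix {X : Type*} [MeasurableSpace X]
    {A : X → Matrix (Fin d) (Fin d) ℝ} (hA : ∀ i j, Measurable fun x => A x i j) :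
    MeasurableSet {x | A x = 0} := by
  have : {x | A x = 0} = ⋂ i, ⋂ j, (fun x => A x i j) ⁻¹' {0} := by
    ext x
    simp only [Set.mem_iInter, Set.mem_preimage, Set.mem_singleton_iff]
    exact ⟨fun h i j => by rw [show A x = 0 from h]; rfl, fun h => Matrix.ext h⟩
  rw [this]
  exact MeasurableSet.iInter fun i => MeasurableSet.iInter fun j => hA i j (measurableSet_singleton 0)

/-- For fixed weights, the Jacobian block of the active neuron is almost surely nonzero. -/
theorem ae_actBlock_ne_zero {i₀ i₁ : Fin d} (h01 : i₀ ≠ i₁) (hh : Measurable h)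
    (μ : Fin N → Measure ((Fin d → ℝ) × ℝ)) [∀ i, IsProbabilityMeasure (μ i)]
    (hμ : ∀ i, (μ i).map Prod.fst ≪ volume) (c ρ : ℝ) (w : Fin d → ℝ) :
    ∀ᵐ x ∂Measure.pi μ, actBlock h c ρ x w ≠ 0 := by
  classical
  have hterm : ∀ i p q, Measurable fun x : Fin N → (Fin d → ℝ) × ℝ =>
      ((c * actCoef h ρ w (x i)) • Matrix.vecMulVec (x i).1 (x i).1) p q := by
    intro i p q
    have h1 := measurable_deriv h
    have h2 := measurable_deriv (deriv h)
    have hx1 : Measurable fun z : Fin N → (Fin d → ℝ) × ℝ => (z i).1 := by fun_prop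
    simp only [actCoef, Matrix.smul_apply, Matrix.vecMulVec_apply, smul_eq_mul]
    fun_prop
  -- If the block vanished, every rank-one summand would vanish too, leaving the identity matrix. To
  -- see this for summand `i`, resample point `i` and let `K` be the rest of the block: a nonzero
  -- `K` can be cancelled only if the new input is proportional to a nonzero row of `K`, which
  -- confines it to a hyperplane; here two coordinates are needed.
  have key : ∀ i, ∀ᵐ x ∂Measure.pi μ, actBlock h c ρ x w = 0 →
      (c * actCoef h ρ w (x i)) • Matrix.vecMulVec (x i).1 (x i).1 = 0 := by
    intro i
    refine ae_pi_of_ae_ae_update μ (S := {x | actBlock h c ρ x w = 0 →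
      (c * actCoef h ρ w (x i)) • Matrix.vecMulVec (x i).1 (x i).1 = 0}) ?_ i
      (Filter.Eventually.of_forall fun x => ?_)
    · have h1 := measurableSet_eq_zero_matrix (A := fun x : Fin N → (Fin d → ℝ) × ℝ =>
        actBlock h c ρ x w) fun p q => measurable_actBlock hh c ρ p q measurable_id measurable_const
      convert h1.compl.union (measurableSet_eq_zero_matrix (hterm i)) using 1
      ext x
      exact imp_iff_not_or
    · set K : Matrix (Fin d) (Fin d) ℝ := 1 + ∑ l ∈ Finset.univ.erase i,
        (c * actCoef h ρ w (x l)) • Matrix.vecMulVec (x l).1 (x l).1 with hK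
      have hup : ∀ t, actBlock h c ρ (Function.update x i t) w =
          K + (c * actCoef h ρ w t) • Matrix.vecMulVec t.1 t.1 := by
        intro t
        rw [actBlock, ← Finset.sum_erase_add _ _ (Finset.mem_univ i), ← add_assoc, hK,
          Function.update_self]
        congr 2
        refine Finset.sum_congr rfl fun l hl => ?_
        rw [Function.update_of_ne (Finset.ne_of_mem_erase hl)]
      by_cases hK0 : K = 0
      · refine Filter.Eventually.of_forall fun t ht => ?_
        rw [hup, hK0, zero_add] at ht
        simpa using ht
      · obtain ⟨p, q, hpq⟩ : ∃ p q, K p q ≠ 0 := by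
          by_contra! hc
          exact hK0 (Matrix.ext hc)
        obtain ⟨r, hr⟩ : ∃ r : Fin d, r ≠ q := by
          by_cases hq : i₀ = q
          · exact ⟨i₁, fun h1 => h01 (hq.trans h1.symm)⟩
          · exact ⟨i₀, hq⟩
        have hs : (Pi.single r (K p q) - Pi.single q (K p r) : Fin d → ℝ) ≠ 0 := by
          intro h0
          apply hpq
          simpa [hr] using congrFun h0 r
        have hnz : ∀ᵐ x : ℝ, x ≠ 0 := (Set.countable_singleton (0 : ℝ)).ae_notMem volume
        filter_upwards [ae_dotProduct_of_map_fst_absolutelyContinuous (hμ i) hs hnz] with t ht ht0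
        exfalso
        apply ht
        rw [hup] at ht0
        have e1 : K p q + (c * actCoef h ρ w t) * (t.1 p * t.1 q) = 0 := by
          simpa [Matrix.vecMulVec_apply] using congrFun (congrFun ht0 p) q
        have e2 : K p r + (c * actCoef h ρ w t) * (t.1 p * t.1 r) = 0 := by
          simpa [Matrix.vecMulVec_apply] using congrFun (congrFun ht0 p) r
        rw [sub_dotProduct, single_dotProduct, single_dotProduct]
        linear_combination t.1 r * e1 - t.1 q * e2
  filter_upwards [ae_all_iff.2 key] with x hx h0
  have h1 := h0
  rw [actBlock, Finset.sum_eq_zero fun i _ => hx i h0, add_zero] at h1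
  have := congrFun (congrFun h1 i₀) i₀
  simp at this

/-- For fixed weights, almost surely every vector in the kernel of `responseHess` is orthogonal to
the data. -/
theorem ae_responseHess_ker {i₀ i₁ : Fin d} (h01 : i₀ ≠ i₁) (hh : Measurable (deriv h))
    (hd : ∀ᵐ x, DifferentiableAt ℝ (deriv h) x) (hC : ConditionC1 (deriv h))
    (μ : Fin N → Measure ((Fin d → ℝ) × ℝ)) [∀ i, IsProbabilityMeasure (μ i)]
    (hμ : ∀ i, (μ i).map Prod.fst ≪ volume) {w w' : Fin d → ℝ} (hw : w ≠ 0) (hw' : w' ≠ 0) :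
    ∀ᵐ x ∂Measure.pi μ, ∀ i, ∀ y, responseHess h i₀ i₁ x w w' *ᵥ y = 0 → (x i).1 ⬝ᵥ y = 0 := by
  classical
  refine ae_all_iff.2 fun i => ?_
  refine ae_pi_of_ae_ae_update μ (S := {x | ∀ y, responseHess h i₀ i₁ x w w' *ᵥ y = 0 →
    (x i).1 ⬝ᵥ y = 0}) ?_ i (Filter.Eventually.of_forall fun x => ?_)
  · exact measurableSet_ker_le (fun k l => measurable_responseHess i₀ i₁ k l measurable_id
      measurable_const measurable_const) (by fun_prop)
  · set B₀ : Matrix (Option (Fin d)) (Fin d) ℝ := Matrix.of fun k l =>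
      ∑ j ∈ Finset.univ.erase i, (deriv h (w ⬝ᵥ (x j).1) * deriv (deriv h) (w' ⬝ᵥ (x j).1)) *
        quadForms i₀ i₁ (x j).1 k * (x j).1 l with hB₀
    -- There are d + 1 quadratic forms and only d columns, so some `a ≠ 0` annihilates the
    -- contribution of all other data points. Contracting the kernel equation with `a` leaves point
    -- `i` alone, multiplied by h', h'' and `a ⬝ᵥ quadForms`, each almost surely nonzero.
    have hrank : Module.finrank ℝ (Submodule.span ℝ (Set.range B₀.col)) <
        Fintype.card (Option (Fin d)) := by
      rw [← Matrix.rank_eq_finrank_span_cols]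
      have := Matrix.rank_le_card_width B₀
      simp only [Fintype.card_option, Fintype.card_fin] at this ⊢
      omega
    obtain ⟨a, ha, haB⟩ := exists_ne_zero_dotProduct_eq_zero _ hrank
    have haB' : ∀ l, ∑ k, a k * B₀ k l = 0 := fun l =>
      haB (B₀.col l) (Submodule.subset_span ⟨l, rfl⟩)
    filter_upwards [ae_fst_of_map_fst_absolutelyContinuous (hμ i) (ae_quadForms_ne_zero h01 ha),
      ae_dotProduct_of_map_fst_absolutelyContinuous (hμ i) hw (hC.ae_ne hh hd 0),
      ae_dotProduct_of_map_fst_absolutelyContinuous (hμ i) hw' (hC.ae_deriv_ne 0)] with t h1 h2 h3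
    intro y hy
    rw [Function.update_self]
    have hent : ∀ k l, responseHess h i₀ i₁ (Function.update x i t) w w' k l = B₀ k l +
        (deriv h (w ⬝ᵥ t.1) * deriv (deriv h) (w' ⬝ᵥ t.1)) * quadForms i₀ i₁ t.1 k * t.1 l := by
      intro k l
      simp only [responseHess, hB₀, Matrix.of_apply]
      rw [← Finset.sum_erase_add _ _ (Finset.mem_univ i), Function.update_self]
      congr 1
      refine Finset.sum_congr rfl fun j hj => ?_
      rw [Function.update_of_ne (Finset.ne_of_mem_erase hj)]
    have hsum : ∑ k, a k * (responseHess h i₀ i₁ (Function.update x i t) w w' *ᵥ y) k =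
        (deriv h (w ⬝ᵥ t.1) * deriv (deriv h) (w' ⬝ᵥ t.1)) * (a ⬝ᵥ quadForms i₀ i₁ t.1) *
          (t.1 ⬝ᵥ y) := by
      have e1 : ∑ k, a k * (responseHess h i₀ i₁ (Function.update x i t) w w' *ᵥ y) k =
          ∑ l, (∑ k, a k * B₀ k l) * y l +
          ∑ k, ∑ l, a k * ((deriv h (w ⬝ᵥ t.1) * deriv (deriv h) (w' ⬝ᵥ t.1)) *
            quadForms i₀ i₁ t.1 k * t.1 l) * y l := by
        simp only [Matrix.mulVec, dotProduct, hent, Finset.mul_sum, Finset.sum_mul]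
        rw [Finset.sum_comm (s := (Finset.univ : Finset (Fin d))), ← Finset.sum_add_distrib]
        refine Finset.sum_congr rfl fun k _ => ?_
        rw [← Finset.sum_add_distrib]
        refine Finset.sum_congr rfl fun l _ => by ring
      rw [e1]
      simp only [haB', zero_mul, Finset.sum_const_zero, zero_add, dotProduct, Finset.mul_sum,
        Finset.sum_mul]
      rw [Finset.sum_comm]
      refine Finset.sum_congr rfl fun l _ => Finset.sum_congr rfl fun k _ => by ring
    rw [hy] at hsum
    simp only [Pi.zero_apply, mul_zero, Finset.sum_const_zero] at hsum
    have := hsum.symm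
    simpa [h1, h2, h3] using this

end OneNeuron


/-! ### Rank of the active block together with the responses -/

section OneNeuron

variable {d N : ℕ} {h : ℝ → ℝ}

theorem hasDerivAt_comp_dotProduct_left {f : ℝ → ℝ} {f' : ℝ} (w u p : Fin d → ℝ)
    (hf : HasDerivAt f f' (w ⬝ᵥ u)) :
    HasDerivAt (fun t : ℝ => f ((w + t • p) ⬝ᵥ u)) (f' * (p ⬝ᵥ u)) 0 := by
  simp_rw [dotProduct_comm _ u]
  exact hasDerivAt_comp_dotProduct u w p (by rwa [dotProduct_comm])

/-- As a function of w' the pairing is ∑ᵢ βᵢ h(w'·xᵢ). On its zero set all second partial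
derivatives vanish almost everywhere. The partials (i₁, i₁) and (k, i₀) say exactly that `y` lies in
the kernel of `responseHess`, which makes `y` orthogonal to all the data. -/
theorem ae_actResponse_dotProduct_ne_zero {i₀ i₁ : Fin d} (hh : Differentiable ℝ h)
    (hd : ∀ᵐ x, DifferentiableAt ℝ (deriv h) x) {x : Fin N → (Fin d → ℝ) × ℝ}
    (hx : ∀ i, (x i).1 ≠ 0) {w : Fin d → ℝ}
    (hK : ∀ᵐ w', ∀ i, ∀ y, responseHess h i₀ i₁ x w w' *ᵥ y = 0 → (x i).1 ⬝ᵥ y = 0)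
    {y : Fin d → ℝ} (hy : ∃ i, (x i).1 ⬝ᵥ y ≠ 0) :
    ∀ᵐ w', actResponse h x w w' ⬝ᵥ y ≠ 0 := by
  have hhm := hh.continuous.measurable
  have hg := measurable_deriv h
  have hg' := measurable_deriv (deriv h)
  set β : Fin N → ℝ := fun i => deriv h (w ⬝ᵥ (x i).1) * ((x i).1 ⬝ᵥ y) with hβ
  have hF : ∀ w', actResponse h x w w' ⬝ᵥ y = ∑ i, β i * h (w' ⬝ᵥ (x i).1) := by
    intro w'
    rw [actResponse, sum_dotProduct]
    refine Finset.sum_congr rfl fun i _ => ?_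
    rw [smul_dotProduct, smul_eq_mul, hβ]; ring
  simp only [hF]
  have hD : ∀ᵐ w' : Fin d → ℝ, ∀ i, DifferentiableAt ℝ (deriv h) (w' ⬝ᵥ (x i).1) := by
    refine ae_all_iff.2 fun i => ?_
    filter_upwards [(quasiMeasurePreserving_dotProduct (hx i)).ae hd] with w' hw'
    rwa [dotProduct_comm]
  have first : ∀ᵐ w' : Fin d → ℝ, ∀ k, ∑ i, β i * h (w' ⬝ᵥ (x i).1) = 0 →
      ∑ i, β i * (deriv h (w' ⬝ᵥ (x i).1) * (x i).1 k) = 0 := by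
    refine ae_all_iff.2 fun k => ?_
    refine ae_lineDeriv_eq_zero_of_eq_zero volume (by fun_prop) (by fun_prop) (Pi.single k 1)
      (Filter.Eventually.of_forall fun w' => ?_)
    refine HasDerivAt.fun_sum fun i _ => HasDerivAt.const_mul _ ?_
    have := hasDerivAt_comp_dotProduct_left w' (x i).1 (Pi.single k 1)
      (hh (w' ⬝ᵥ (x i).1)).hasDerivAt
    simpa only [single_one_dotProduct] using this
  have second : ∀ᵐ w' : Fin d → ℝ, ∀ k m, ∑ i, β i * (deriv h (w' ⬝ᵥ (x i).1) * (x i).1 k) = 0 →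
      ∑ i, β i * (deriv (deriv h) (w' ⬝ᵥ (x i).1) * (x i).1 m * (x i).1 k) = 0 := by
    refine ae_all_iff.2 fun k => ae_all_iff.2 fun m => ?_
    refine ae_lineDeriv_eq_zero_of_eq_zero volume (by fun_prop) (by fun_prop) (Pi.single m 1) ?_
    filter_upwards [hD] with w' hw'
    refine HasDerivAt.fun_sum fun i _ => HasDerivAt.const_mul _ (HasDerivAt.mul_const ?_ _)
    have := hasDerivAt_comp_dotProduct_left w' (x i).1 (Pi.single m 1) (hw' i).hasDerivAt
    simpa only [single_one_dotProduct] using this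
  filter_upwards [first, second, hK] with w' h1 h2 h3 h0
  obtain ⟨i, hi⟩ := hy
  refine hi (h3 i y ?_)
  have h4 : ∀ k m, ∑ i, β i * (deriv (deriv h) (w' ⬝ᵥ (x i).1) * (x i).1 m * (x i).1 k) = 0 :=
    fun k m => h2 k m (h1 k h0)
  ext q
  have hq : (responseHess h i₀ i₁ x w w' *ᵥ y) q =
      ∑ i, β i * (deriv (deriv h) (w' ⬝ᵥ (x i).1) * quadForms i₀ i₁ (x i).1 q) := by
    simp only [Matrix.mulVec, dotProduct, responseHess, Matrix.of_apply, Finset.sum_mul, hβ,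
      Finset.mul_sum]
    rw [Finset.sum_comm]
    refine Finset.sum_congr rfl fun i _ => Finset.sum_congr rfl fun l _ => by ring
  rw [hq]
  rcases q with _ | k
  · simpa [quadForms, sq, mul_assoc] using h4 i₁ i₁
  · simpa [quadForms, mul_assoc] using h4 k i₀

/-- For generic hidden weights, the Jacobian block of the active neuron together with the readout
responses of the other neurons has trivial cokernel. -/
theorem ae_actBlock_actResponse_ker {i₀ i₁ : Fin d} (hh : Differentiable ℝ h)
    (hd : ∀ᵐ x, DifferentiableAt ℝ (deriv h) x) {x : Fin N → (Fin d → ℝ) × ℝ}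
    (hx : ∀ i, (x i).1 ≠ 0) (c ρ : ℝ) (hA : ∀ᵐ w, actBlock h c ρ x w ≠ 0)
    (hK : ∀ᵐ w, ∀ᵐ w', ∀ i, ∀ y, responseHess h i₀ i₁ x w w' *ᵥ y = 0 → (x i).1 ⬝ᵥ y = 0) :
    ∀ᵐ W : Fin d → Fin d → ℝ, ∀ y, actBlock h c ρ x (W i₀) *ᵥ y = 0 →
      (∀ l ≠ i₀, actResponse h x (W i₀) (W l) ⬝ᵥ y = 0) → y = 0 := by
  classical
  have hhm := hh.continuous.measurable
  let A : Finset (Fin d) → (Fin d → Fin d → ℝ) → Matrix (Fin d ⊕ Fin d) (Fin d) ℝ := fun s W =>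
    Matrix.fromRows (actBlock h c ρ x (W i₀))
      (Matrix.of fun l => if l ∈ s then actResponse h x (W i₀) (W l) else 0)
  have hAm : ∀ s i j, Measurable fun W => A s W i j := by
    intro s i j
    rcases i with p | l
    · exact measurable_actBlock hhm c ρ p j measurable_const (by fun_prop)
    · by_cases hl : l ∈ s
      · simp only [A, Matrix.fromRows_apply_inr, Matrix.of_apply, if_pos hl]
        exact (measurable_pi_apply j).comp
          (measurable_actResponse hhm measurable_const (by fun_prop) (by fun_prop))
      · simp [A, hl]
  have hAker : ∀ s W y, A s W *ᵥ y = 0 ↔ actBlock h c ρ x (W i₀) *ᵥ y = 0 ∧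
      ∀ l ∈ s, actResponse h x (W i₀) (W l) ⬝ᵥ y = 0 := by
    intro s W y
    simp only [A, Matrix.fromRows_mulVec]
    constructor
    · intro h0
      refine ⟨funext fun p => congrFun h0 (Sum.inl p), fun l hl => ?_⟩
      have := congrFun h0 (Sum.inr l)
      simpa [Matrix.mulVec, hl] using this
    · rintro ⟨h1, h2⟩
      funext q
      rcases q with p | l
      · exact congrFun h1 p
      · by_cases hl : l ∈ s
        · simpa [Matrix.mulVec, hl] using h2 l hl
        · simp [Matrix.mulVec, hl]
  have hgood : ∀ {p : (Fin d → ℝ) → Prop}, (∀ᵐ w, p w) → ∀ᵐ W : Fin d → Fin d → ℝ, p (W i₀) :=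
    fun hp => (Measure.quasiMeasurePreserving_eval
      (fun _ : Fin d => (volume : Measure (Fin d → ℝ))) i₀).ae hp
  -- `A s W` stacks the active block and the responses of the neurons in `s`. The block contributes
  -- rank at least one. While the rank is below d, a kernel vector `y` survives, and resampling the
  -- weights of a new neuron `l` almost surely gives a response not orthogonal to `y`.
  have key : ∀ s : Finset (Fin d), i₀ ∉ s → ∀ᵐ W, min d (1 + s.card) ≤ (A s W).rank := by
    intro s
    induction s using Finset.induction_on with
    | empty =>
      intro _
      filter_upwards [hgood hA] with W hW
      rw [Finset.card_empty, add_zero]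
      refine (min_le_right _ _).trans (Nat.one_le_iff_ne_zero.2 fun h0 => hW ?_)
      ext p q
      have h1 : (A ∅ W) *ᵥ (Pi.single q 1) = 0 := by
        by_contra hne
        have := rank_lt_of_ker_lt (A := (0 : Matrix (Fin d) (Fin d) ℝ)) (B := A ∅ W)
          (fun y _ => by simp) (y := Pi.single q 1) (Matrix.zero_mulVec _) hne
        omega
      have h2 := congrFun ((hAker ∅ W _).1 h1).1 p
      simpa using h2
    | insert l s hl ih =>
      intro hi₀
      rw [Finset.mem_insert, not_or] at hi₀
      have hm1 := measurable_rank (hAm s)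
      have hm2 := measurable_rank (hAm (insert l s))
      have step : ∀ᵐ W : Fin d → Fin d → ℝ, d ≤ (A s W).rank ∨
          (A s W).rank < (A (insert l s) W).rank := by
        refine ae_pi_of_ae_ae_update (fun _ : Fin d => (volume : Measure (Fin d → ℝ)))
          (S := {W | d ≤ (A s W).rank ∨ (A s W).rank < (A (insert l s) W).rank})
          ((measurableSet_le measurable_const hm1).union (measurableSet_lt hm1 hm2)) l ?_
        have := hgood hK
        rw [volume_pi] at this
        filter_upwards [this] with W hW
        have hup : ∀ t, A s (Function.update W l t) = A s W := by
          intro t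
          have hne : ∀ j ∈ s, j ≠ l := fun j hj hjl => hl (hjl ▸ hj)
          ext q k
          rcases q with p | j
          · simp [A, hi₀.1]
          · by_cases hj : j ∈ s
            · simp [A, hj, hi₀.1, hne j hj]
            · simp [A, hj]
        rcases le_or_gt d (A s W).rank with hr | hr
        · exact Filter.Eventually.of_forall fun t => Or.inl (by rw [hup]; exact hr)
        · obtain ⟨y, hy0, hy⟩ := exists_mulVec_eq_zero_of_rank_lt hr
          have hy' := (hAker s W y).1 hy
          -- On a vector orthogonal to all inputs the block acts as the identity, so it cannot kill
          -- a nonzero one.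
          have hex : ∃ i, (x i).1 ⬝ᵥ y ≠ 0 := by
            by_contra! hc
            apply hy0
            have h1 := hy'.1
            rw [actBlock, Matrix.add_mulVec, Matrix.one_mulVec, Matrix.sum_mulVec,
              Finset.sum_eq_zero, add_zero] at h1
            · exact h1
            · intro i _
              rw [Matrix.smul_mulVec, Matrix.vecMulVec_mulVec, hc i]
              simp
          filter_upwards [ae_actResponse_dotProduct_ne_zero hh hd hx hW hex] with t ht
          right
          refine rank_lt_of_ker_lt (y := y) (fun z hz => ?_) (by rw [hup]; exact hy) fun h0 => ?_
          · rw [hAker] at hz ⊢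
            exact ⟨hz.1, fun j hj => hz.2 j (Finset.mem_insert_of_mem hj)⟩
          · have := ((hAker _ _ _).1 h0).2 l (Finset.mem_insert_self l s)
            rw [Function.update_self, Function.update_of_ne hi₀.1] at this
            exact ht this
      filter_upwards [ih hi₀.2, step] with W h1 h2
      have h3 : (A s W).rank ≤ (A (insert l s) W).rank := by
        refine rank_le_of_ker_le fun z hz => ?_
        rw [hAker] at hz ⊢
        exact ⟨hz.1, fun j hj => hz.2 j (Finset.mem_insert_of_mem hj)⟩
      rw [Finset.card_insert_of_notMem hl]
      omega
  filter_upwards [key (Finset.univ.erase i₀) (Finset.notMem_erase _ _)] with W hW y h1 h2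
  refine eq_zero_of_mulVec_eq_zero_of_rank (A := A (Finset.univ.erase i₀) W) ?_
    ((hAker _ _ _).2 ⟨h1, fun l hl => h2 l (Finset.ne_of_mem_erase hl)⟩)
  have hd0 := i₀.pos
  rw [Finset.card_erase_of_mem (Finset.mem_univ _), Finset.card_univ, Fintype.card_fin] at hW
  omega

/-- For generic data, the hypotheses of `ae_actBlock_actResponse_ker` hold. -/
theorem ae_data_actBlock_actResponse_ker {i₀ i₁ : Fin d} (h01 : i₀ ≠ i₁) (hh : Differentiable ℝ h)
    (hd : ∀ᵐ x, DifferentiableAt ℝ (deriv h) x) (hC : ConditionC1 (deriv h))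
    (μ : Fin N → Measure ((Fin d → ℝ) × ℝ)) [∀ i, IsProbabilityMeasure (μ i)]
    (hμ : ∀ i, (μ i).map Prod.fst ≪ volume) (c ρ : ℝ) :
    ∀ᵐ x ∂Measure.pi μ, ∀ᵐ W : Fin d → Fin d → ℝ, ∀ y, actBlock h c ρ x (W i₀) *ᵥ y = 0 →
      (∀ l ≠ i₀, actResponse h x (W i₀) (W l) ⬝ᵥ y = 0) → y = 0 := by
  have : Nonempty (Fin d) := ⟨i₀⟩
  have hhm := hh.continuous.measurable
  have hx : ∀ᵐ x ∂Measure.pi μ, ∀ i, (x i).1 ≠ 0 := by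
    refine ae_all_iff.2 fun i => ?_
    have h1 : ∀ᵐ t ∂μ i, t.1 ≠ 0 := ae_fst_of_map_fst_absolutelyContinuous (hμ i)
      ((Set.countable_singleton (0 : Fin d → ℝ)).ae_notMem volume)
    exact (Measure.quasiMeasurePreserving_eval μ i).ae h1
  -- The generic statements are proved for fixed weights and almost every data set; exchanging the
  -- quantifiers gives them for fixed data and almost every weights.
  have hA : ∀ᵐ x ∂Measure.pi μ, ∀ᵐ w : Fin d → ℝ, actBlock h c ρ x w ≠ 0 := by
    rw [Measure.ae_ae_comm]
    · exact Filter.Eventually.of_forall (ae_actBlock_ne_zero h01 hhm μ hμ c ρ)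
    · exact (measurableSet_eq_zero_matrix (A := fun z : (Fin N → (Fin d → ℝ) × ℝ) × (Fin d → ℝ) =>
        actBlock h c ρ z.1 z.2) fun p q => measurable_actBlock hhm c ρ p q measurable_fst
          measurable_snd).compl
  have hK : ∀ᵐ x ∂Measure.pi μ, ∀ᵐ z : (Fin d → ℝ) × (Fin d → ℝ),
      ∀ i, ∀ y, responseHess h i₀ i₁ x z.1 z.2 *ᵥ y = 0 → (x i).1 ⬝ᵥ y = 0 := by
    rw [Measure.ae_ae_comm]
    · have hne : ∀ᵐ w : Fin d → ℝ, w ≠ 0 :=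
        (Set.countable_singleton (0 : Fin d → ℝ)).ae_notMem volume
      filter_upwards [Measure.quasiMeasurePreserving_fst.ae hne,
        Measure.quasiMeasurePreserving_snd.ae hne] with z hz1 hz2
      exact ae_responseHess_ker h01 (measurable_deriv h) hd hC μ hμ hz1 hz2
    · have : {q : (Fin N → (Fin d → ℝ) × ℝ) × ((Fin d → ℝ) × (Fin d → ℝ)) | ∀ i, ∀ y,
          responseHess h i₀ i₁ q.1 q.2.1 q.2.2 *ᵥ y = 0 → (q.1 i).1 ⬝ᵥ y = 0} =
          ⋂ i, {q | ∀ y, responseHess h i₀ i₁ q.1 q.2.1 q.2.2 *ᵥ y = 0 → (q.1 i).1 ⬝ᵥ y = 0} := by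
        ext q; simp
      rw [this]
      exact MeasurableSet.iInter fun i => measurableSet_ker_le (fun k l =>
        measurable_responseHess i₀ i₁ k l measurable_fst (by fun_prop) (by fun_prop)) (by fun_prop)
  filter_upwards [hx, hA, hK] with x hx hA hK
  exact ae_actBlock_actResponse_ker hh hd hx c ρ hA (Measure.ae_ae_of_ae_prod hK)

end OneNeuron


/-! ### Determinants of endomorphisms of `Fin d → Fin d → ℝ` -/

section PairDet

variable {d : ℕ}

/-- Determinant of the matrix of `f` in the standard basis of `Fin d → Fin d → ℝ`. -/
def pairDet (f : (Fin d → Fin d → ℝ) → Fin d → Fin d → ℝ) : ℝ :=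
  Matrix.det (Matrix.of fun p q : Fin d × Fin d => f (Pi.single q.1 (Pi.single q.2 1)) p.1 p.2)

theorem linearMap_apply_eq_sum (f : (Fin d → Fin d → ℝ) →ₗ[ℝ] Fin d → Fin d → ℝ)
    (V : Fin d → Fin d → ℝ) (j k : Fin d) :
    f V j k = ∑ q : Fin d × Fin d, f (Pi.single q.1 (Pi.single q.2 1)) j k * V q.1 q.2 := by
  have hV : V = ∑ q : Fin d × Fin d, V q.1 q.2 • Pi.single q.1 (Pi.single q.2 1) := by
    ext a b
    rw [Fintype.sum_prod_type, Finset.sum_apply, Finset.sum_apply, Finset.sum_eq_single a]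
    · rw [Finset.sum_apply, Finset.sum_apply, Finset.sum_eq_single b]
      · simp
      · intro b' _ hb'; simp [hb'.symm]
      · simp
    · intro a' _ ha'
      rw [Finset.sum_apply, Finset.sum_apply]
      refine Finset.sum_eq_zero fun b' _ => ?_
      simp [ha'.symm]
    · simp
  conv_lhs => rw [hV]
  simp [map_sum, Finset.sum_apply, mul_comm]

/-- `pairDet` accepts arbitrary functions so that its measurability and analyticity in parameters
can be read off the entries; linearity is needed only here, to turn nonvanishing into injectivity.
-/
theorem pairDet_ne_zero_iff (f : (Fin d → Fin d → ℝ) →ₗ[ℝ] Fin d → Fin d → ℝ) :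
    pairDet f ≠ 0 ↔ Function.Injective f := by
  rw [pairDet, ← not_iff_not, not_ne_iff, ← Matrix.exists_mulVec_eq_zero_iff]
  constructor
  · rintro ⟨v, hv, h0⟩ hf
    apply hv
    have h1 : f (fun j k => v (j, k)) = f 0 := by
      ext j k
      rw [linearMap_apply_eq_sum, map_zero]
      exact congrFun h0 (j, k)
    have h2 := hf h1
    ext p
    exact congrFun (congrFun h2 p.1) p.2
  · intro hf
    rw [← LinearMap.ker_eq_bot, Submodule.eq_bot_iff] at hf
    push Not at hf
    obtain ⟨V, hV, hV0⟩ := hf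
    refine ⟨fun p => V p.1 p.2, fun h0 => hV0 ?_, ?_⟩
    · ext j k
      exact congrFun h0 (j, k)
    · ext p
      have h1 : f V p.1 p.2 = 0 := by rw [LinearMap.mem_ker.1 hV]; rfl
      rw [linearMap_apply_eq_sum] at h1
      exact h1

theorem measurable_pairDet {X : Type*} [MeasurableSpace X]
    {f : X → (Fin d → Fin d → ℝ) → Fin d → Fin d → ℝ}
    (hf : ∀ V j k, Measurable fun x => f x V j k) : Measurable fun x => pairDet (f x) := by
  simp only [pairDet, Matrix.det_apply, Matrix.of_apply]
  refine Finset.measurable_fun_sum _ fun σ _ => Measurable.const_smul ?_ _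
  exact Finset.measurable_fun_prod _ fun i _ => hf _ _ _

theorem contDiff_pairDet {X : Type*} [NormedAddCommGroup X] [NormedSpace ℝ X]
    {f : X → (Fin d → Fin d → ℝ) → Fin d → Fin d → ℝ}
    (hf : ∀ V j k, ContDiff ℝ ⊤ fun x => f x V j k) : ContDiff ℝ ⊤ fun x => pairDet (f x) := by
  simp only [pairDet, Matrix.det_apply, Matrix.of_apply]
  refine ContDiff.sum fun σ _ => ContDiff.const_smul _ ?_
  exact contDiff_prod fun i _ => hf _ _ _

theorem pairDet_id : pairDet (fun V : Fin d → Fin d → ℝ => V) = 1 := by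
  rw [pairDet, ← Matrix.det_one (n := Fin d × Fin d)]
  congr 1
  ext p q
  simp only [Matrix.of_apply, Matrix.one_apply, Pi.single_apply, Prod.ext_iff]
  by_cases h1 : p.1 = q.1
  · simp [h1, Pi.single_apply]
  · simp [h1]

theorem linearMap_det_ne_zero_of_injective {F : Type*} [NormedAddCommGroup F] [NormedSpace ℝ F]
    [FiniteDimensional ℝ F] (f : F →L[ℝ] F) (hf : Function.Injective f) : f.det ≠ 0 := by
  intro h0
  have := LinearMap.bot_lt_ker_of_det_eq_zero (f := (f : F →ₗ[ℝ] F)) h0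
  rw [LinearMap.ker_eq_bot.2 hf] at this
  exact lt_irrefl _ this

/-- If `A` and `B` together are onto, then `A + B ∘ η` is injective for some `η`. -/
theorem exists_injective_add_comp {F H : Type*} [AddCommGroup F] [Module ℝ F]
    [FiniteDimensional ℝ F] [AddCommGroup H] [Module ℝ H] (A : F →ₗ[ℝ] F) (B : H →ₗ[ℝ] F)
    (hAB : LinearMap.range A ⊔ LinearMap.range B = ⊤) :
    ∃ η : F →ₗ[ℝ] H, Function.Injective (A + B ∘ₗ η) := by
  obtain ⟨C, hC⟩ := (LinearMap.ker A).exists_isCompl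
  let π := (LinearMap.range A).mkQ
  have hπB : Function.Surjective (π ∘ₗ B) := by
    intro z
    obtain ⟨y, rfl⟩ := (LinearMap.range A).mkQ_surjective z
    have hy : y ∈ LinearMap.range A ⊔ LinearMap.range B := hAB ▸ Submodule.mem_top
    obtain ⟨_, ⟨a, rfl⟩, _, ⟨b, rfl⟩, rfl⟩ := Submodule.mem_sup.1 hy
    refine ⟨b, ?_⟩
    have h1 : π (A a) = 0 := (Submodule.Quotient.mk_eq_zero _).2 ⟨a, rfl⟩
    change π (B b) = π (A a + B b)
    rw [map_add, h1, zero_add]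
  obtain ⟨σ, hσ⟩ := (π ∘ₗ B).exists_rightInverse_of_surjective (LinearMap.range_eq_top.2 hπB)
  -- Kernel and cokernel of `A` have equal dimension. η projects onto the kernel, identifies it with
  -- the cokernel and lifts through `B`; modulo the range of `A`, a null vector of the sum then has
  -- zero kernel component, hence lies in the kernel of `A`, hence is zero.
  have hdim : Module.finrank ℝ (LinearMap.ker A) = Module.finrank ℝ (F ⧸ LinearMap.range A) := by
    have h1 := LinearMap.finrank_range_add_finrank_ker A
    have h2 := (LinearMap.range A).finrank_quotient_add_finrank
    omega
  let e := LinearEquiv.ofFinrankEq _ _ hdim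
  let pr := (LinearMap.ker A).projectionOnto C hC
  refine ⟨σ ∘ₗ e.toLinearMap ∘ₗ pr, ?_⟩
  rw [← LinearMap.ker_eq_bot, Submodule.eq_bot_iff]
  intro x hx
  have hx' : A x + B (σ (e (pr x))) = 0 := hx
  have h1 : π (A x) = 0 := (Submodule.Quotient.mk_eq_zero _).2 ⟨x, rfl⟩
  have h2 : π (B (σ (e (pr x)))) = e (pr x) := LinearMap.congr_fun hσ _
  have h3 : e (pr x) = 0 := by
    have h7 := congrArg π hx'
    rw [map_add, h1, zero_add, map_zero] at h7
    rw [← h2, h7]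
  have h4 : pr x = 0 := by simpa using h3
  have h5 : A x = 0 := by
    rw [h4] at hx'
    simpa using hx'
  have h6 : pr x = ⟨x, h5⟩ := Submodule.projectionOnto_apply_left hC ⟨x, h5⟩
  rw [h4] at h6
  exact (congrArg Subtype.val h6).symm

end PairDet

/-! ### The gradient step in the hidden layer -/

section GradStep

variable {d N : ℕ} (h : ℝ → ℝ)

/-- Residual at a data point. -/
def residual (W : Fin d → Fin d → ℝ) (θ : Fin d → ℝ) (z : (Fin d → ℝ) × ℝ) : ℝ :=
  z.2 - ∑ l, θ l * h (W l ⬝ᵥ z.1)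

/-- The gradient step in the hidden layer. -/
noncomputable def gdMap (c : ℝ) (x : Fin N → (Fin d → ℝ) × ℝ) (W : Fin d → Fin d → ℝ)
    (θ : Fin d → ℝ) (j k : Fin d) : ℝ :=
  W j k + c * ∑ i, residual h W θ (x i) * θ j * deriv h (W j ⬝ᵥ (x i).1) * (x i).1 k

/-- The derivative of `gdMap` at `(W, θ)` in the direction `(V, τ)`. -/
noncomputable def gdJac (c : ℝ) (x : Fin N → (Fin d → ℝ) × ℝ) (W : Fin d → Fin d → ℝ)
    (θ : Fin d → ℝ) (V : Fin d → Fin d → ℝ) (τ : Fin d → ℝ) (j k : Fin d) : ℝ :=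
  V j k + c * ∑ i, (-(∑ l, (τ l * h (W l ⬝ᵥ (x i).1) +
      θ l * deriv h (W l ⬝ᵥ (x i).1) * (V l ⬝ᵥ (x i).1))) * θ j * deriv h (W j ⬝ᵥ (x i).1) +
    residual h W θ (x i) * (τ j * deriv h (W j ⬝ᵥ (x i).1) +
      θ j * deriv (deriv h) (W j ⬝ᵥ (x i).1) * (V j ⬝ᵥ (x i).1))) * (x i).1 k

theorem gdJac_add (c : ℝ) (x : Fin N → (Fin d → ℝ) × ℝ) (W : Fin d → Fin d → ℝ) (θ : Fin d → ℝ)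
    (V V' : Fin d → Fin d → ℝ) (τ τ' : Fin d → ℝ) :
    gdJac h c x W θ (V + V') (τ + τ') = gdJac h c x W θ V τ + gdJac h c x W θ V' τ' := by
  ext j k
  have : ∀ a b e f : ℝ, a + c * b + (e + c * f) = a + e + c * (b + f) := by intros; ring
  simp only [gdJac, Pi.add_apply, add_dotProduct]
  refine Eq.trans ?_ (this _ _ _ _).symm
  rw [← Finset.sum_add_distrib]
  congr 2
  refine Finset.sum_congr rfl fun i _ => ?_
  have h1 : ∑ l, ((τ l + τ' l) * h (W l ⬝ᵥ (x i).1) + θ l * deriv h (W l ⬝ᵥ (x i).1) *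
      (V l ⬝ᵥ (x i).1 + V' l ⬝ᵥ (x i).1)) =
      ∑ l, (τ l * h (W l ⬝ᵥ (x i).1) + θ l * deriv h (W l ⬝ᵥ (x i).1) * (V l ⬝ᵥ (x i).1)) +
      ∑ l, (τ' l * h (W l ⬝ᵥ (x i).1) + θ l * deriv h (W l ⬝ᵥ (x i).1) * (V' l ⬝ᵥ (x i).1)) := by
    rw [← Finset.sum_add_distrib]
    refine Finset.sum_congr rfl fun l _ => by ring
  rw [h1]
  ring

theorem gdJac_smul (c : ℝ) (x : Fin N → (Fin d → ℝ) × ℝ) (W : Fin d → Fin d → ℝ) (θ : Fin d → ℝ)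
    (a : ℝ) (V : Fin d → Fin d → ℝ) (τ : Fin d → ℝ) :
    gdJac h c x W θ (a • V) (a • τ) = a • gdJac h c x W θ V τ := by
  ext j k
  have : ∀ b e : ℝ, a * (b + c * e) = a * b + c * (a * e) := by intros; ring
  simp only [gdJac, Pi.smul_apply, smul_dotProduct, smul_eq_mul]
  refine Eq.trans ?_ (this _ _).symm
  congr 2
  rw [Finset.mul_sum]
  refine Finset.sum_congr rfl fun i _ => ?_
  have h1 : ∑ l, (a * τ l * h (W l ⬝ᵥ (x i).1) + θ l * deriv h (W l ⬝ᵥ (x i).1) *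
      (a * (V l ⬝ᵥ (x i).1))) =
      a * ∑ l, (τ l * h (W l ⬝ᵥ (x i).1) +
        θ l * deriv h (W l ⬝ᵥ (x i).1) * (V l ⬝ᵥ (x i).1)) := by
    rw [Finset.mul_sum]
    refine Finset.sum_congr rfl fun l _ => by ring
  rw [h1]
  ring

/-- `gdJac` as a linear map in the direction `(V, T V)`. -/
noncomputable def gdJacL (c : ℝ) (x : Fin N → (Fin d → ℝ) × ℝ) (W : Fin d → Fin d → ℝ)
    (θ : Fin d → ℝ) (T : (Fin d → Fin d → ℝ) →ₗ[ℝ] Fin d → ℝ) :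
    (Fin d → Fin d → ℝ) →ₗ[ℝ] Fin d → Fin d → ℝ where
  toFun V := gdJac h c x W θ V (T V)
  map_add' V V' := by rw [map_add, gdJac_add]
  map_smul' a V := by rw [map_smul, gdJac_smul]; rfl

variable {h}

/-- The readout is allowed to move with the hidden weights, since on the sphere both must be varied.
Second derivatives of `h` enter only at the arguments W j·xᵢ. -/
theorem hasFDerivAt_gdMap (hh : Differentiable ℝ h) (c : ℝ) (x : Fin N → (Fin d → ℝ) × ℝ)
    (W : Fin d → Fin d → ℝ) (hW : ∀ j i, DifferentiableAt ℝ (deriv h) (W j ⬝ᵥ (x i).1))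
    {θ : (Fin d → Fin d → ℝ) → Fin d → ℝ} {T : (Fin d → Fin d → ℝ) →ₗ[ℝ] Fin d → ℝ}
    (hθ : HasFDerivAt θ (LinearMap.toContinuousLinearMap T) 0) :
    HasFDerivAt (fun δ => gdMap h c x (W + δ) (θ δ))
      (LinearMap.toContinuousLinearMap (gdJacL h c x W (θ 0) T)) 0 := by
  refine hasFDerivAt_pi'' fun j => hasFDerivAt_pi'' fun k => ?_
  let D : (Fin d → ℝ) → Fin d → (Fin d → Fin d → ℝ) →L[ℝ] ℝ := fun u l =>
    LinearMap.toContinuousLinearMap ((dotProductBilin ℝ ℝ).flip u ∘ₗ LinearMap.proj l)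
  have hDa : ∀ u l V, D u l V = V l ⬝ᵥ u := fun u l V => rfl
  have hdot : ∀ u l, HasFDerivAt (fun δ : Fin d → Fin d → ℝ => (W + δ) l ⬝ᵥ u) (D u l) 0 := by
    intro u l
    have : (fun δ : Fin d → Fin d → ℝ => (W + δ) l ⬝ᵥ u) = fun δ => W l ⬝ᵥ u + D u l δ := by
      funext δ; simp [hDa, add_dotProduct]
    rw [this]
    exact (D u l).hasFDerivAt.const_add _
  have hc1 : ∀ i l, HasFDerivAt (fun δ : Fin d → Fin d → ℝ => h ((W + δ) l ⬝ᵥ (x i).1))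
      (deriv h (W l ⬝ᵥ (x i).1) • D (x i).1 l) 0 := by
    intro i l
    refine HasDerivAt.comp_hasFDerivAt (h₂ := h) 0 ?_ (hdot (x i).1 l)
    simpa using (hh (W l ⬝ᵥ (x i).1)).hasDerivAt
  have hc2 : ∀ i l, HasFDerivAt (fun δ : Fin d → Fin d → ℝ => deriv h ((W + δ) l ⬝ᵥ (x i).1))
      (deriv (deriv h) (W l ⬝ᵥ (x i).1) • D (x i).1 l) 0 := by
    intro i l
    refine HasDerivAt.comp_hasFDerivAt (h₂ := deriv h) 0 ?_ (hdot (x i).1 l)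
    simpa using (hW l i).hasDerivAt
  let Tl : Fin d → (Fin d → Fin d → ℝ) →L[ℝ] ℝ := fun l =>
    (ContinuousLinearMap.proj l).comp (LinearMap.toContinuousLinearMap T)
  have hθl : ∀ l, HasFDerivAt (fun δ => θ δ l) (Tl l) 0 := fun l => hasFDerivAt_pi'.1 hθ l
  have hent : HasFDerivAt (fun δ : Fin d → Fin d → ℝ => (W + δ) j k)
      ((ContinuousLinearMap.proj k).comp
        (ContinuousLinearMap.proj (R := ℝ) (φ := fun _ : Fin d => Fin d → ℝ) j)) 0 := by
    have h1 := ((ContinuousLinearMap.proj k).comp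
        (ContinuousLinearMap.proj (R := ℝ) (φ := fun _ : Fin d => Fin d → ℝ) j)).hasFDerivAt
        (x := (0 : Fin d → Fin d → ℝ))
    exact h1.const_add (W j k)
  have hres : ∀ i, HasFDerivAt (fun δ => residual h (W + δ) (θ δ) (x i))
      (-(∑ l, (θ 0 l • (deriv h (W l ⬝ᵥ (x i).1) • D (x i).1 l) +
        h (W l ⬝ᵥ (x i).1) • Tl l))) 0 := by
    intro i
    have h1 : HasFDerivAt (fun δ => ∑ l, θ δ l * h ((W + δ) l ⬝ᵥ (x i).1))
        (∑ l, (θ 0 l • (deriv h (W l ⬝ᵥ (x i).1) • D (x i).1 l) +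
        h (W l ⬝ᵥ (x i).1) • Tl l)) 0 := by
      refine HasFDerivAt.fun_sum fun l _ => ?_
      have := (hθl l).mul (hc1 i l)
      exact this.congr_fderiv (by simp)
    exact h1.const_sub _
  have hall := hent.add ((HasFDerivAt.fun_sum (u := Finset.univ) fun i _ =>
    ((((hres i).mul (hθl j)).mul (hc2 i j)).mul_const ((x i).1 k))).const_mul c)
  refine HasFDerivAt.congr_fderiv (f := fun δ => gdMap h c x (W + δ) (θ δ) j k) hall ?_
  refine ContinuousLinearMap.ext fun V => ?_
  change _ = gdJac h c x W (θ 0) V (T V) j k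
  have hTl : ∀ l, Tl l V = T V l := fun l => rfl
  simp only [gdJac, _root_.add_apply, _root_.smul_apply,
    _root_.sum_apply, _root_.neg_apply, smul_eq_mul, add_zero, hDa, hTl, Pi.mul_apply,
    ContinuousLinearMap.comp_apply, ContinuousLinearMap.proj_apply]
  congr 2
  refine Finset.sum_congr rfl fun i _ => ?_
  have h2 : ∑ l, (θ 0 l * (deriv h (W l ⬝ᵥ (x i).1) * (V l ⬝ᵥ (x i).1)) +
      h (W l ⬝ᵥ (x i).1) * T V l) = ∑ l, (T V l * h (W l ⬝ᵥ (x i).1) +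
      θ 0 l * deriv h (W l ⬝ᵥ (x i).1) * (V l ⬝ᵥ (x i).1)) :=
    Finset.sum_congr rfl fun l _ => by ring
  rw [h2]
  ring

/-- The base point of the analyticity argument when the readout is free: a vanishing readout
switches the hidden gradient off. -/
theorem gdJac_zero_zero (c : ℝ) (x : Fin N → (Fin d → ℝ) × ℝ) (W V : Fin d → Fin d → ℝ) :
    gdJac h c x W 0 V 0 = V := by
  ext j k
  simp [gdJac]

/-- With data and weights fixed, h, h' and h'' enter only as constants and the expression is
polynomial in the readout and its variation; this needs no regularity of `h`. -/
theorem contDiff_gdJac (c : ℝ) (x : Fin N → (Fin d → ℝ) × ℝ) (W V : Fin d → Fin d → ℝ)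
    (j k : Fin d) {X : Type*} [NormedAddCommGroup X] [NormedSpace ℝ X] {θ τ : X → Fin d → ℝ}
    (hθ : ContDiff ℝ ⊤ θ) (hτ : ContDiff ℝ ⊤ τ) :
    ContDiff ℝ ⊤ fun z => gdJac h c x W (θ z) V (τ z) j k := by
  have h1 : ∀ l, ContDiff ℝ ⊤ fun z => θ z l := fun l => contDiff_pi.1 hθ l
  have h2 : ∀ l, ContDiff ℝ ⊤ fun z => τ z l := fun l => contDiff_pi.1 hτ l
  have h3 : ∀ i, ContDiff ℝ ⊤ fun z => residual h W (θ z) (x i) := fun i =>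
    contDiff_const.sub (ContDiff.sum fun l _ => (h1 l).mul contDiff_const)
  have h4 : ∀ i, ContDiff ℝ ⊤ fun z => ∑ l, (τ z l * h (W l ⬝ᵥ (x i).1) +
      θ z l * deriv h (W l ⬝ᵥ (x i).1) * (V l ⬝ᵥ (x i).1)) := fun i =>
    ContDiff.sum fun l _ => by fun_prop
  unfold gdJac
  refine contDiff_const.add (contDiff_const.mul (ContDiff.sum fun i _ => ?_))
  have h3i := h3 i
  have h4i := h4 i
  fun_prop

theorem measurable_gdJac (hh : Measurable h) (c : ℝ) (x : Fin N → (Fin d → ℝ) × ℝ)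
    (V : Fin d → Fin d → ℝ) (j k : Fin d) {X : Type*} [MeasurableSpace X]
    {W : X → Fin d → Fin d → ℝ} {θ τ : X → Fin d → ℝ}
    (hW : Measurable W) (hθ : Measurable θ) (hτ : Measurable τ) :
    Measurable fun z => gdJac h c x (W z) (θ z) V (τ z) j k := by
  have h1 := measurable_deriv h
  have h2 := measurable_deriv (deriv h)
  unfold gdJac residual
  fun_prop

theorem measurable_gdMap (hh : Measurable h) (c : ℝ) {X : Type*} [MeasurableSpace X]
    {x : X → Fin N → (Fin d → ℝ) × ℝ} {W : X → Fin d → Fin d → ℝ} {θ : X → Fin d → ℝ}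
    (hx : Measurable x) (hW : Measurable W) (hθ : Measurable θ) :
    Measurable fun z => gdMap h c (x z) (W z) (θ z) := by
  have h1 := measurable_deriv h
  have hx1 : ∀ i, Measurable fun z => (x z i).1 := fun i => by fun_prop
  have hx2 : ∀ i, Measurable fun z => (x z i).2 := fun i => by fun_prop
  have hW1 : ∀ i, Measurable fun z => W z i := fun i => by fun_prop
  refine measurable_pi_lambda _ fun j => measurable_pi_lambda _ fun k => ?_
  unfold gdMap residual
  fun_prop

end GradStep


/-! ### Radial retraction onto a ball and its derivative -/

section Retraction

variable {d : ℕ}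

/-- Normalization of a vector. -/
noncomputable def unitVec (y : Fin d → ℝ) : Fin d → ℝ := (√(y ⬝ᵥ y))⁻¹ • y

/-- Radial retraction onto the Euclidean ball of radius `ρ`. -/
noncomputable def retr (ρ : ℝ) (y : Fin d → ℝ) : Fin d → ℝ :=
  if y ⬝ᵥ y ≤ ρ ^ 2 then y else ρ • unitVec y

/-- The component of `τ` orthogonal to the unit vector `y`. -/
def tangentPart (y τ : Fin d → ℝ) : Fin d → ℝ := τ - (y ⬝ᵥ τ) • y

@[fun_prop]
theorem measurable_unitVec : Measurable (unitVec (d := d)) := by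
  unfold unitVec
  fun_prop

@[fun_prop]
theorem measurable_retr (ρ : ℝ) : Measurable (retr (d := d) ρ) := by
  unfold retr
  exact Measurable.ite (measurableSet_le (by fun_prop) measurable_const) (by fun_prop)
    (by fun_prop)

theorem contDiff_dotProduct {X : Type*} [NormedAddCommGroup X] [NormedSpace ℝ X]
    {f g : X → Fin d → ℝ} (hf : ContDiff ℝ ⊤ f) (hg : ContDiff ℝ ⊤ g) :
    ContDiff ℝ ⊤ fun x => f x ⬝ᵥ g x :=
  ContDiff.sum fun l _ => (contDiff_pi.1 hf l).mul (contDiff_pi.1 hg l)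

theorem contDiff_tangentPart {X : Type*} [NormedAddCommGroup X] [NormedSpace ℝ X]
    {f g : X → Fin d → ℝ} (hf : ContDiff ℝ ⊤ f) (hg : ContDiff ℝ ⊤ g) :
    ContDiff ℝ ⊤ fun x => tangentPart (f x) (g x) :=
  hg.sub ((contDiff_dotProduct hf hg).smul hf)

theorem dotProduct_self_nonneg_real (y : Fin d → ℝ) : 0 ≤ y ⬝ᵥ y :=
  Finset.sum_nonneg fun i _ => mul_self_nonneg (y i)

theorem contDiff_unitVec {X : Type*} [NormedAddCommGroup X] [NormedSpace ℝ X]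
    {f : X → Fin d → ℝ} (hf : ContDiff ℝ ⊤ f) (h0 : ∀ x, f x ≠ 0) :
    ContDiff ℝ ⊤ fun x => unitVec (f x) := by
  have h1 : ∀ x, f x ⬝ᵥ f x ≠ 0 := fun x => by simpa using h0 x
  have h2 : ∀ x, √(f x ⬝ᵥ f x) ≠ 0 := fun x =>
    (Real.sqrt_pos.2 (lt_of_le_of_ne (dotProduct_self_nonneg_real _) (h1 x).symm)).ne'
  exact (((contDiff_dotProduct hf hf).sqrt h1).inv h2).smul hf

theorem tangentPart_smul (y τ : Fin d → ℝ) (a : ℝ) :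
    tangentPart y (a • τ) = a • tangentPart y τ := by
  simp only [tangentPart, dotProduct_smul, smul_sub, smul_assoc]

theorem tangentPart_add (y τ τ' : Fin d → ℝ) :
    tangentPart y (τ + τ') = tangentPart y τ + tangentPart y τ' := by
  simp only [tangentPart, dotProduct_add, add_smul]
  abel

/-- `tangentPart` as a linear map. -/
def tangentPartL (y : Fin d → ℝ) : (Fin d → ℝ) →ₗ[ℝ] Fin d → ℝ where
  toFun := tangentPart y
  map_add' := tangentPart_add y
  map_smul' a τ := tangentPart_smul y τ a

/-- Strictly outside the ball the retraction is locally ρ y/|y|, whose derivative is ρ/|y| times the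
orthogonal projection onto the complement of y. -/
theorem hasFDerivAt_retr {F : Type*} [NormedAddCommGroup F] [NormedSpace ℝ F]
    [FiniteDimensional ℝ F] {ρ : ℝ} {y : Fin d → ℝ} (hy : ρ ^ 2 < y ⬝ᵥ y)
    (η : F →ₗ[ℝ] Fin d → ℝ) :
    HasFDerivAt (fun δ => retr ρ (y + η δ))
      (LinearMap.toContinuousLinearMap
        ((ρ * (√(y ⬝ᵥ y))⁻¹) • tangentPartL (unitVec y) ∘ₗ η)) 0 := by
  have hq0 : 0 < y ⬝ᵥ y := (sq_nonneg ρ).trans_lt hy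
  have hs0 : 0 < √(y ⬝ᵥ y) := Real.sqrt_pos.2 hq0
  let ηc : F →L[ℝ] Fin d → ℝ := LinearMap.toContinuousLinearMap η
  let D : F →L[ℝ] ℝ := LinearMap.toContinuousLinearMap ((2 : ℝ) • (dotProductBilin ℝ ℝ y) ∘ₗ η)
  have hη : HasFDerivAt (fun δ => y + η δ) ηc 0 := ηc.hasFDerivAt.const_add y
  have hηl : ∀ l, HasFDerivAt (fun δ => (y + η δ) l) ((ContinuousLinearMap.proj l).comp ηc) 0 :=
    fun l => hasFDerivAt_pi'.1 hη l
  have hq : HasFDerivAt (fun δ => (y + η δ) ⬝ᵥ (y + η δ)) D 0 := by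
    have h1 : HasFDerivAt (fun δ => (y + η δ) ⬝ᵥ (y + η δ))
        (∑ l, (((y + η 0) l) • ((ContinuousLinearMap.proj l).comp ηc) +
          ((y + η 0) l) • ((ContinuousLinearMap.proj l).comp ηc))) 0 :=
      HasFDerivAt.fun_sum fun l _ => (hηl l).mul (hηl l)
    refine h1.congr_fderiv (ContinuousLinearMap.ext fun V => ?_)
    have : D V = 2 * ∑ l, y l * η V l := rfl
    rw [this, Finset.mul_sum]
    simp only [map_zero, add_zero, _root_.sum_apply, _root_.add_apply, _root_.smul_apply,
      smul_eq_mul]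
    refine Finset.sum_congr rfl fun l _ => ?_
    change y l * η V l + y l * η V l = _
    ring
  have hr : HasDerivAt (fun s : ℝ => (√s)⁻¹) (-(1 / (2 * √(y ⬝ᵥ y))) / √(y ⬝ᵥ y) ^ 2)
      ((y + η 0) ⬝ᵥ (y + η 0)) := by
    rw [map_zero, add_zero]
    exact (Real.hasDerivAt_sqrt hq0.ne').inv hs0.ne'
  have hrq := HasDerivAt.comp_hasFDerivAt (0 : F) hr hq
  have hall := (hrq.smul hη).const_smul ρ
  have hev : (fun δ => retr ρ (y + η δ)) =ᶠ[nhds 0]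
      fun δ => ρ • ((√((y + η δ) ⬝ᵥ (y + η δ)))⁻¹ • (y + η δ)) := by
    have h1 : ∀ᶠ δ in nhds (0 : F), ρ ^ 2 < (y + η δ) ⬝ᵥ (y + η δ) := by
      refine hq.continuousAt.eventually_const_lt ?_
      simpa using hy
    filter_upwards [h1] with δ hδ
    rw [retr, if_neg (not_le.2 hδ), unitVec]
  refine (HasFDerivAt.congr_of_eventuallyEq (f := fun δ =>
    ρ • ((√((y + η δ) ⬝ᵥ (y + η δ)))⁻¹ • (y + η δ))) hall hev).congr_fderiv
    (ContinuousLinearMap.ext fun V => ?_)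
  ext l
  have hD : D V = 2 * (y ⬝ᵥ η V) := rfl
  have hηV : ηc V = η V := rfl
  have e1 : (LinearMap.toContinuousLinearMap
        ((ρ * (√(y ⬝ᵥ y))⁻¹) • tangentPartL (unitVec y) ∘ₗ η) : F →L[ℝ] Fin d → ℝ) V =
      (ρ * (√(y ⬝ᵥ y))⁻¹) • tangentPart (unitVec y) (η V) := rfl
  rw [e1]
  simp only [tangentPart, unitVec, _root_.smul_apply, _root_.add_apply, Function.comp_apply,
    map_zero, add_zero, ContinuousLinearMap.smulRight_apply, hD, hηV, Pi.smul_apply, Pi.add_apply,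
    Pi.sub_apply, smul_eq_mul, smul_dotProduct]
  field_simp
  ring

end Retraction

/-! ### The Jacobian at a one-neuron readout -/

section Limit

variable {d N : ℕ} {h : ℝ → ℝ}

/-- Sensitivity of the gradient step to the readout of a single active neuron: row of the active
neuron. -/
theorem gdJac_single_self (c ρ : ℝ) (x : Fin N → (Fin d → ℝ) × ℝ) (W V : Fin d → Fin d → ℝ)
    (i₀ : Fin d) {τ : Fin d → ℝ} (hτ : τ i₀ = 0) :
    gdJac h c x W (Pi.single i₀ ρ) V τ i₀ = actBlock h c ρ x (W i₀) *ᵥ V i₀ -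
      (c * ρ) • ∑ l, τ l • actResponse h x (W i₀) (W l) := by
  ext k
  have hres : ∀ z : (Fin d → ℝ) × ℝ, residual h W (Pi.single i₀ ρ) z =
      z.2 - ρ * h (W i₀ ⬝ᵥ z.1) := by
    intro z
    simp [residual, Pi.single_apply]
  have hsum : ∀ z : (Fin d → ℝ) × ℝ, ∑ l, (τ l * h (W l ⬝ᵥ z.1) +
      (Pi.single i₀ ρ : Fin d → ℝ) l * deriv h (W l ⬝ᵥ z.1) * (V l ⬝ᵥ z.1)) =
      ∑ l, τ l * h (W l ⬝ᵥ z.1) + ρ * deriv h (W i₀ ⬝ᵥ z.1) * (V i₀ ⬝ᵥ z.1) := by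
    intro z
    rw [Finset.sum_add_distrib]
    simp [Pi.single_apply]
  simp only [gdJac, hres, hsum, hτ, Pi.single_eq_same, Pi.sub_apply, Pi.smul_apply,
    Finset.sum_apply, actBlock, actResponse, actCoef, Matrix.add_mulVec, Matrix.one_mulVec,
    Matrix.sum_mulVec, Matrix.smul_mulVec, Matrix.vecMulVec_mulVec, Pi.add_apply, smul_eq_mul,
    op_smul_eq_smul, Finset.mul_sum]
  rw [add_sub_assoc]
  congr 1
  rw [Finset.sum_comm, ← Finset.sum_sub_distrib]
  refine Finset.sum_congr rfl fun i _ => ?_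
  have h1 : ∑ l, c * ρ * (τ l * (h (W l ⬝ᵥ (x i).1) * deriv h (W i₀ ⬝ᵥ (x i).1) * (x i).1 k)) =
      c * ρ * deriv h (W i₀ ⬝ᵥ (x i).1) * (x i).1 k * ∑ l, τ l * h (W l ⬝ᵥ (x i).1) := by
    rw [Finset.mul_sum]
    refine Finset.sum_congr rfl fun l _ => by ring
  rw [h1, dotProduct_comm (x i).1]
  ring

theorem gdJac_single_of_ne (c ρ : ℝ) (x : Fin N → (Fin d → ℝ) × ℝ) (W V : Fin d → Fin d → ℝ)
    {i₀ j : Fin d} (hj : j ≠ i₀) : gdJac h c x W (Pi.single i₀ ρ) V 0 j = V j := by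
  ext k
  simp [gdJac, hj]

/-- At a one-neuron readout the hidden weights together with the tangential readout variations
span all directions. -/
theorem exists_pairDet_ne_zero_of_ker {i₀ : Fin d} (c : ℝ) {ρ : ℝ} (hρ : ρ ≠ 0)
    {x : Fin N → (Fin d → ℝ) × ℝ} {W : Fin d → Fin d → ℝ}
    (hker : ∀ y, actBlock h c ρ x (W i₀) *ᵥ y = 0 →
      (∀ l ≠ i₀, actResponse h x (W i₀) (W l) ⬝ᵥ y = 0) → y = 0) :
    ∃ η : (Fin d → Fin d → ℝ) →ₗ[ℝ] Fin d → ℝ,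
      pairDet (fun V => gdJac h c x W (Pi.single i₀ ρ) V
        (tangentPart (Pi.single i₀ 1) (η V))) ≠ 0 := by
  let A := gdJacL h c x W (Pi.single i₀ ρ) 0
  let B : (Fin d → ℝ) →ₗ[ℝ] Fin d → Fin d → ℝ :=
    { toFun := fun τ => gdJac h c x W (Pi.single i₀ ρ) 0 (tangentPart (Pi.single i₀ 1) τ)
      map_add' := fun τ τ' => by rw [tangentPart_add, ← gdJac_add, add_zero]
      map_smul' := fun a τ => by
        rw [tangentPart_smul, RingHom.id_apply, ← gdJac_smul, smul_zero] }
  have hA : ∀ V, A V = gdJac h c x W (Pi.single i₀ ρ) V 0 := fun V => rfl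
  have hB : ∀ τ, B τ = gdJac h c x W (Pi.single i₀ ρ) 0 (tangentPart (Pi.single i₀ 1) τ) :=
    fun τ => rfl
  -- By duality: a functional killing both ranges kills every row except `i₀`, since `A` fixes
  -- matrices supported off that row. It is therefore pairing of row `i₀` with some `y`; the
  -- symmetric active block kills `y` and the responses are orthogonal to it, so `hker` applies.
  have hrange : LinearMap.range A ⊔ LinearMap.range B = ⊤ := by
    by_contra hne
    obtain ⟨f, hf, hf0⟩ := Submodule.exists_dual_map_eq_bot_of_lt_top (lt_top_iff_ne_top.2 hne)
      inferInstance
    have hfA : ∀ V, f (A V) = 0 := fun V => by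
      have : f (A V) ∈ (LinearMap.range A ⊔ LinearMap.range B).map f :=
        ⟨_, Submodule.mem_sup_left ⟨V, rfl⟩, rfl⟩
      rw [hf0] at this
      simpa using this
    have hfB : ∀ τ, f (B τ) = 0 := fun τ => by
      have : f (B τ) ∈ (LinearMap.range A ⊔ LinearMap.range B).map f :=
        ⟨_, Submodule.mem_sup_right ⟨τ, rfl⟩, rfl⟩
      rw [hf0] at this
      simpa using this
    have hrow : ∀ V, A V i₀ = actBlock h c ρ x (W i₀) *ᵥ V i₀ := fun V => by
      rw [hA, gdJac_single_self c ρ x W V i₀ (by simp)]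
      simp
    have hoff : ∀ j, j ≠ i₀ → ∀ v, f (Pi.single j v) = 0 := by
      intro j hj v
      have h1 : A (Pi.single j v) = Pi.single j v := by
        funext j'
        by_cases hj' : j' = i₀
        · subst hj'
          rw [hrow, Pi.single_eq_of_ne hj.symm, Matrix.mulVec_zero]
        · rw [hA, gdJac_single_of_ne c ρ x W _ hj']
      rw [← h1, hfA]
    have hfi : ∀ Z, f Z = f (Pi.single i₀ (Z i₀)) := by
      intro Z
      have hZ : Z = ∑ j, Pi.single j (Z j) := (Finset.univ_sum_single Z).symm
      conv_lhs => rw [hZ]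
      rw [map_sum, Finset.sum_eq_single i₀]
      · intro j _ hj; exact hoff j hj _
      · simp
    set y : Fin d → ℝ := fun k => f (Pi.single i₀ (Pi.single k 1)) with hy
    have hfy : ∀ Z, f Z = Z i₀ ⬝ᵥ y := by
      intro Z
      rw [hfi]
      have h1 : (Pi.single i₀ (Z i₀) : Fin d → Fin d → ℝ) =
          ∑ k, Z i₀ k • Pi.single i₀ (Pi.single k 1) := by
        have h2 : Z i₀ = ∑ k, Z i₀ k • (Pi.single k 1 : Fin d → ℝ) := by
          conv_lhs => rw [pi_eq_sum_univ' (Z i₀)]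
        conv_lhs => rw [h2]
        change LinearMap.single ℝ (fun _ : Fin d => Fin d → ℝ) i₀ _ = _
        rw [map_sum]
        simp only [map_smul]
        rfl
      rw [h1, map_sum]
      simp [dotProduct, hy]
    have hAy : actBlock h c ρ x (W i₀) *ᵥ y = 0 := by
      have hT : (actBlock h c ρ x (W i₀))ᵀ = actBlock h c ρ x (W i₀) := by
        simp [actBlock, Matrix.transpose_sum, Matrix.transpose_vecMulVec]
      rw [← hT, Matrix.mulVec_transpose]
      ext k
      have h1 := hfA (Pi.single i₀ (Pi.single k 1))
      rw [hfy, hrow, Pi.single_eq_same, dotProduct_comm, Matrix.dotProduct_mulVec] at h1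
      simpa using h1
    have hy0 : y = 0 := by
      -- The responses carry the factor cρ, so they give no information when c = 0; but then the
      -- block is the identity.
      by_cases hc : c = 0
      · simpa [actBlock, hc] using hAy
      refine hker y hAy fun l hl => ?_
      have h1 := hfB (Pi.single l 1)
      have h2 : tangentPart (Pi.single i₀ 1) (Pi.single l 1 : Fin d → ℝ) = Pi.single l 1 := by
        simp [tangentPart, hl.symm]
      rw [hfy, hB, h2, gdJac_single_self c ρ x W 0 i₀ (by simp [hl.symm])] at h1
      rw [Finset.sum_eq_single l (fun m _ hm => by simp [hm]) (by simp)] at h1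
      simpa [hc, hρ] using h1
    apply hf
    refine LinearMap.ext fun Z => ?_
    rw [hfy, hy0]
    simp
  obtain ⟨η, hη⟩ := exists_injective_add_comp A B hrange
  refine ⟨η, ?_⟩
  have h1 := (pairDet_ne_zero_iff (A + B ∘ₗ η)).2 hη
  convert h1 using 2
  funext V
  change _ = A V + B (η V)
  rw [hA, hB, ← gdJac_add, add_zero, zero_add]

end Limit


/-! ### Null sets under the gradient step: free and projected points -/

instance isAddHaarMeasure_volume_pi_pi {ι κ : Type*} [Fintype ι] [Fintype κ] :
    (volume : Measure (ι → κ → ℝ)).IsAddHaarMeasure :=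
  @Measure.pi.isAddHaarMeasure _ _ _ _ _ _ _ _ _ _

section Core

variable {d N Ni : ℕ} {h : ℝ → ℝ}

theorem continuousAt_unitVec {y : Fin d → ℝ} (hy : y ≠ 0) : ContinuousAt unitVec y := by
  unfold unitVec
  have h1 : √(y ⬝ᵥ y) ≠ 0 := by
    have : y ⬝ᵥ y ≠ 0 := by simpa using hy
    exact (Real.sqrt_pos.2 (lt_of_le_of_ne (dotProduct_self_nonneg_real _) this.symm)).ne'
  have h2 : Continuous fun y : Fin d → ℝ => √(y ⬝ᵥ y) := by
    simp only [dotProduct]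
    fun_prop
  exact (h2.continuousAt.inv₀ h1).smul continuousAt_id

theorem unitVec_smul {a : ℝ} (ha : 0 < a) (y : Fin d → ℝ) : unitVec (a • y) = unitVec y := by
  rw [unitVec, unitVec, smul_dotProduct, dotProduct_smul, smul_smul, smul_eq_mul, smul_eq_mul,
    ← mul_assoc, Real.sqrt_mul (by positivity), Real.sqrt_mul_self ha.le]
  congr 1
  rw [mul_inv]
  field_simp

theorem unitVec_single (i₀ : Fin d) : unitVec (Pi.single i₀ 1 : Fin d → ℝ) = Pi.single i₀ 1 := by
  simp [unitVec]

/-- An analytic function of unit vectors which does not vanish when all of them point in the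
direction of one coordinate axis is almost everywhere nonzero. -/
theorem ae_comp_unitVec_ne_zero {i₀ i₁ : Fin d} (h01 : i₀ ≠ i₁)
    {P : (Fin Ni → Fin d → ℝ) → ℝ} (hP : ContDiff ℝ ⊤ P) (h0 : P (fun _ => Pi.single i₀ 1) ≠ 0) :
    ∀ᵐ Y : Fin Ni → Fin d → ℝ, P (fun i => unitVec (Y i)) ≠ 0 := by
  let e : Fin Ni → Fin d → ℝ := fun _ => Pi.single i₀ 1
  have hm : Measurable fun Y : Fin Ni → Fin d → ℝ => P (fun i => unitVec (Y i)) :=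
    hP.continuous.measurable.comp (measurable_pi_lambda _ fun i => by fun_prop)
  -- A nonzero coordinate `i₁` keeps the line `Y i + t e_{i₀}` away from the origin, so
  -- normalization is analytic along all of it.
  have hgen : ∀ᵐ Y : Fin Ni → Fin d → ℝ, ∀ i, Y i i₁ ≠ 0 := by
    refine ae_all_iff.2 fun i => ?_
    have h1 : ∀ᵐ t : ℝ, t ≠ 0 := (Set.countable_singleton (0 : ℝ)).ae_notMem volume
    have h2 := (Measure.quasiMeasurePreserving_eval
      (fun _ : Fin d => (volume : Measure ℝ)) i₁).ae h1
    exact (Measure.quasiMeasurePreserving_eval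
      (fun _ : Fin Ni => (volume : Measure (Fin d → ℝ))) i).ae h2
  refine (ae_ae_add_linearMap_mem_iff (LinearMap.toSpanSingleton ℝ _ e) (volume : Measure ℝ)
    volume (s := {Y | P (fun i => unitVec (Y i)) ≠ 0})
    (hm (measurableSet_singleton (0 : ℝ)).compl)).1 ?_
  filter_upwards [hgen] with Y hY
  have hne : ∀ i (t : ℝ), Y i + t • (Pi.single i₀ 1 : Fin d → ℝ) ≠ 0 := by
    intro i t h1
    apply hY i
    simpa [h01.symm] using congrFun h1 i₁
  have hcd : ContDiff ℝ ⊤ fun t : ℝ => P (fun i => unitVec (Y i + t • Pi.single i₀ 1)) :=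
    hP.comp (contDiff_pi.2 fun i => contDiff_unitVec (by fun_prop) (hne i))
  -- As t → ∞ along the line all the unit vectors tend to e_{i₀}. With t = 1/s, normalization being
  -- scale invariant, this becomes continuity at s = 0.
  obtain ⟨s, hs, hs'⟩ : ∃ s : ℝ, 0 < s ∧
      P (fun i => unitVec (s • Y i + Pi.single i₀ 1)) ≠ 0 := by
    have hc : ContinuousAt (fun s : ℝ => P (fun i => unitVec (s • Y i + Pi.single i₀ 1))) 0 := by
      refine ContinuousAt.comp (g := P) hP.continuous.continuousAt
        (continuousAt_pi.2 fun i => ?_)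
      refine ContinuousAt.comp (g := unitVec) ?_ (by fun_prop)
      refine continuousAt_unitVec ?_
      simp
    have h1 : ∀ᶠ s in nhds (0 : ℝ), P (fun i => unitVec (s • Y i + Pi.single i₀ 1)) ≠ 0 := by
      refine hc.eventually_ne ?_
      simpa [unitVec_single] using h0
    have h2 : ∀ᶠ s in nhdsWithin (0 : ℝ) (Set.Ioi 0),
        P (fun i => unitVec (s • Y i + Pi.single i₀ 1)) ≠ 0 := h1.filter_mono nhdsWithin_le_nhds
    obtain ⟨s, h3, h4⟩ := (h2.and self_mem_nhdsWithin).exists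
    exact ⟨s, h4, h3⟩
  have hat : P (fun i => unitVec (Y i + s⁻¹ • Pi.single i₀ 1)) ≠ 0 := by
    have hi : ∀ i, unitVec (Y i + s⁻¹ • Pi.single i₀ 1) = unitVec (s • Y i + Pi.single i₀ 1) := by
      intro i
      rw [← unitVec_smul hs, smul_add, smul_smul, mul_inv_cancel₀ hs.ne', one_smul]
    simpa only [hi] using hs'
  filter_upwards [ae_ne_zero_of_analytic hcd hat] with t ht
  exact ht

/-- The readout produced by the inner loop, as a function of the unprojected points. -/
def readout (b : Fin Ni → ℝ) (r : (Fin d → ℝ) → Fin d → ℝ) (Y : Fin Ni → Fin d → ℝ) : Fin d → ℝ :=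
  ∑ i, b i • r (Y i)

theorem measurable_readout (b : Fin Ni → ℝ) {r : (Fin d → ℝ) → Fin d → ℝ} (hr : Measurable r) :
    Measurable (readout b r) := by
  unfold readout
  fun_prop

theorem measurableSet_differentiableAt_weights (x : Fin N → (Fin d → ℝ) × ℝ) :
    MeasurableSet {W : Fin d → Fin d → ℝ |
      ∀ j i, DifferentiableAt ℝ (deriv h) (W j ⬝ᵥ (x i).1)} := by
  have : {W : Fin d → Fin d → ℝ | ∀ j i, DifferentiableAt ℝ (deriv h) (W j ⬝ᵥ (x i).1)} =
      ⋂ j, ⋂ i, (fun W : Fin d → Fin d → ℝ => W j ⬝ᵥ (x i).1) ⁻¹'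
        {t | DifferentiableAt ℝ (deriv h) t} := by
    ext W; simp
  rw [this]
  exact MeasurableSet.iInter fun j => MeasurableSet.iInter fun i =>
    (measurableSet_of_differentiableAt ℝ (deriv h)).preimage (by fun_prop)

theorem ae_differentiableAt_weights (hd : ∀ᵐ t, DifferentiableAt ℝ (deriv h) t)
    {x : Fin N → (Fin d → ℝ) × ℝ} (hx : 0 < d → ∀ i, (x i).1 ≠ 0) :
    ∀ᵐ W : Fin d → Fin d → ℝ, ∀ j i, DifferentiableAt ℝ (deriv h) (W j ⬝ᵥ (x i).1) := by
  refine ae_all_iff.2 fun j => ae_all_iff.2 fun i => ?_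
  have h1 := (quasiMeasurePreserving_dotProduct (hx j.pos i)).ae hd
  have h2 := (Measure.quasiMeasurePreserving_eval
      (fun _ : Fin d => (volume : Measure (Fin d → ℝ))) j).ae h1
  filter_upwards [h2] with W hW
  rw [dotProduct_comm]
  exact hW

/-- The slice is the graph of η: the hidden weights move by δ while the unprojected points move by η
δ. It has the dimension of the target, and the derivative along it is `gdJac` in the direction (V, T
V). -/
theorem ae_gdMap_notMem_of_slice (hh : Differentiable ℝ h) (c : ℝ) (x : Fin N → (Fin d → ℝ) × ℝ)
    {θ : (Fin Ni → Fin d → ℝ) → Fin d → ℝ} (hθ : Measurable θ)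
    (η : (Fin d → Fin d → ℝ) →ₗ[ℝ] Fin Ni → Fin d → ℝ)
    {G : Set ((Fin d → Fin d → ℝ) × (Fin Ni → Fin d → ℝ))} (hG : MeasurableSet G)
    (hdiff : ∀ z ∈ G, ∀ j i, DifferentiableAt ℝ (deriv h) (z.1 j ⬝ᵥ (x i).1))
    (hdet : ∀ z ∈ G, ∃ T : (Fin d → Fin d → ℝ) →ₗ[ℝ] Fin d → ℝ,
      HasFDerivAt (fun δ => θ (z.2 + η δ)) (LinearMap.toContinuousLinearMap T) 0 ∧
      pairDet (fun V => gdJac h c x z.1 (θ z.2) V (T V)) ≠ 0)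
    {Z : Set (Fin d → Fin d → ℝ)} (hZm : MeasurableSet Z) (hZ : volume Z = 0) :
    ∀ᵐ z : (Fin d → Fin d → ℝ) × (Fin Ni → Fin d → ℝ), z ∈ G → gdMap h c x z.1 (θ z.2) ∉ Z := by
  have : (volume : Measure ((Fin d → Fin d → ℝ) × (Fin Ni → Fin d → ℝ))).IsAddHaarMeasure := by
    rw [Measure.volume_eq_prod]
    infer_instance
  refine ae_notMem_of_slice_det_ne_zero volume volume
    (Φ := fun z : (Fin d → Fin d → ℝ) × (Fin Ni → Fin d → ℝ) => gdMap h c x z.1 (θ z.2))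
    (measurable_gdMap hh.continuous.measurable c measurable_const measurable_fst
      (hθ.comp measurable_snd)) (LinearMap.prod LinearMap.id η) hG (fun z hz => ?_) hZm hZ
  obtain ⟨T, hT, hTdet⟩ := hdet z hz
  have h1 := hasFDerivAt_gdMap hh c x z.1 (hdiff z hz) hT
  refine ⟨_, linearMap_det_ne_zero_of_injective _ ?_, h1⟩
  have h2 : (fun V => gdJac h c x z.1 (θ z.2) V (T V)) =
      gdJacL h c x z.1 ((fun δ => θ (z.2 + η δ)) 0) T := by
    funext V
    simp only [map_zero, add_zero]
    rfl
  rw [h2] at hTdet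
  exact (pairDet_ne_zero_iff _).1 hTdet

/-- Where one of the points is not moved by the projection, the gradient step preserves null
sets. -/
theorem ae_gdMap_notMem_of_free (hh : Differentiable ℝ h)
    (hd : ∀ᵐ t, DifferentiableAt ℝ (deriv h) t) (c : ℝ) {x : Fin N → (Fin d → ℝ) × ℝ}
    (hx : 0 < d → ∀ i, (x i).1 ≠ 0) (b : Fin Ni → ℝ) {r : (Fin d → ℝ) → Fin d → ℝ}
    (hr : Measurable r) {i : Fin Ni} (hb : b i ≠ 0)
    {Z : Set (Fin d → Fin d → ℝ)} (hZm : MeasurableSet Z) (hZ : volume Z = 0) :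
    ∀ᵐ z : (Fin d → Fin d → ℝ) × (Fin Ni → Fin d → ℝ), r (z.2 i) = z.2 i →
      gdMap h c x z.1 (readout b r z.2) ∉ Z := by
  have hθm := measurable_readout b hr
  -- Putting `Y i` in place of `r (Y i)` changes nothing where point `i` is unmoved and makes the
  -- readout affine in `Y i` everywhere. Only `W` varies along the slice below (η = 0), so `r` is
  -- never differentiated.
  set θ' : (Fin Ni → Fin d → ℝ) → Fin d → ℝ := fun Y =>
    ∑ l ∈ Finset.univ.erase i, b l • r (Y l) + b i • Y i with hθ'
  have hθ'm : Measurable θ' := by fun_prop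
  have hdetm : Measurable fun z : (Fin d → Fin d → ℝ) × (Fin Ni → Fin d → ℝ) =>
      pairDet (fun V => gdJac h c x z.1 (θ' z.2) V 0) :=
    measurable_pairDet fun V j k => measurable_gdJac hh.continuous.measurable c x V j k
      measurable_fst (hθ'm.comp measurable_snd) measurable_const
  have hW : ∀ W : Fin d → Fin d → ℝ, ∀ᵐ Y : Fin Ni → Fin d → ℝ,
      pairDet (fun V => gdJac h c x W (θ' Y) V 0) ≠ 0 := by
    intro W
    refine ae_pi_of_ae_ae_update (fun _ : Fin Ni => (volume : Measure (Fin d → ℝ)))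
      (S := {Y | pairDet (fun V => gdJac h c x W (θ' Y) V 0) ≠ 0}) ?_ i
      (Filter.Eventually.of_forall fun Y => ?_)
    · exact (hdetm.comp (measurable_const.prodMk measurable_id))
        (measurableSet_singleton (0 : ℝ)).compl
    · have h1 : ∀ᵐ t : Fin d → ℝ, pairDet (fun V => gdJac h c x W t V 0) ≠ 0 := by
        refine ae_ne_zero_of_analytic_of_zero volume
          (contDiff_pairDet fun V j k => contDiff_gdJac c x W V j k contDiff_id contDiff_const) ?_
        simp only [gdJac_zero_zero, pairDet_id]
        exact one_ne_zero
      have h2 : Measure.QuasiMeasurePreserving (fun t : Fin d → ℝ =>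
          b i • t + ∑ l ∈ Finset.univ.erase i, b l • r (Y l)) volume volume := by
        refine ((measurePreserving_add_right volume _).quasiMeasurePreserving).comp
          ⟨by fun_prop, ?_⟩
        rw [Measure.map_addHaar_smul _ hb]
        exact Measure.smul_absolutelyContinuous
      filter_upwards [h2.ae h1] with t ht
      have h3 : θ' (Function.update Y i t) =
          b i • t + ∑ l ∈ Finset.univ.erase i, b l • r (Y l) := by
        simp only [hθ', Function.update_self]
        rw [add_comm]
        congr 1
        refine Finset.sum_congr rfl fun l hl => ?_
        rw [Function.update_of_ne (Finset.ne_of_mem_erase hl)]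
      change pairDet (fun V => gdJac h c x W (θ' (Function.update Y i t)) V 0) ≠ 0
      rw [h3]
      exact ht
  have hdetae : ∀ᵐ z : (Fin d → Fin d → ℝ) × (Fin Ni → Fin d → ℝ),
      pairDet (fun V => gdJac h c x z.1 (θ' z.2) V 0) ≠ 0 := by
    rw [Measure.volume_eq_prod, Measure.ae_prod_iff_ae_ae
      (p := fun z : (Fin d → Fin d → ℝ) × (Fin Ni → Fin d → ℝ) =>
        pairDet (fun V => gdJac h c x z.1 (θ' z.2) V 0) ≠ 0)
      (hdetm (measurableSet_singleton (0 : ℝ)).compl)]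
    exact Filter.Eventually.of_forall hW
  have hdiffae : ∀ᵐ z : (Fin d → Fin d → ℝ) × (Fin Ni → Fin d → ℝ),
      ∀ j i, DifferentiableAt ℝ (deriv h) (z.1 j ⬝ᵥ (x i).1) :=
    Measure.quasiMeasurePreserving_fst.ae (ae_differentiableAt_weights hd hx)
  have main := ae_gdMap_notMem_of_slice (Ni := Ni) hh c x hθ'm 0
    (G := (Prod.fst ⁻¹' {W | ∀ j i, DifferentiableAt ℝ (deriv h) (W j ⬝ᵥ (x i).1)}) ∩
      {z | pairDet (fun V => gdJac h c x z.1 (θ' z.2) V 0) ≠ 0})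
    ((measurable_fst (measurableSet_differentiableAt_weights x)).inter
      (hdetm (measurableSet_singleton (0 : ℝ)).compl)) (fun z hz => hz.1) (fun z hz => by
      refine ⟨0, ?_, hz.2⟩
      simp only [LinearMap.zero_apply, add_zero, map_zero]
      exact hasFDerivAt_const _ _) hZm hZ
  filter_upwards [main, hdetae, hdiffae] with z h1 h2 h3 hfree
  have h4 : readout b r z.2 = θ' z.2 := by
    rw [readout, ← Finset.sum_erase_add _ _ (Finset.mem_univ i), hfree]
  rw [h4]
  exact h1 ⟨h3, h2⟩

theorem readout_retr_eq_of_lt (b : Fin Ni → ℝ) {ρ : ℝ} {Y : Fin Ni → Fin d → ℝ}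
    (hY : ∀ i, ρ ^ 2 < Y i ⬝ᵥ Y i) : readout b (retr ρ) Y = ∑ i, b i • ρ • unitVec (Y i) :=
  Finset.sum_congr rfl fun i _ => by rw [retr, if_neg (not_le.2 (hY i))]

/-- Where all the points are projected onto the sphere, the joint variation of the hidden weights
and of one of the points spans all directions. -/
theorem ae_exists_pairDet_ne_zero {i₀ i₁ : Fin d} (h01 : i₀ ≠ i₁) (c : ℝ) {ρ : ℝ} (hρ : 0 < ρ)
    {x : Fin N → (Fin d → ℝ) × ℝ} {b : Fin Ni → ℝ} (hb1 : ∑ i, b i = 1) {i : Fin Ni}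
    {W : Fin d → Fin d → ℝ}
    (hker : ∀ y, actBlock h c ρ x (W i₀) *ᵥ y = 0 →
      (∀ l ≠ i₀, actResponse h x (W i₀) (W l) ⬝ᵥ y = 0) → y = 0) :
    ∀ᵐ Y : Fin Ni → Fin d → ℝ, ∃ η : (Fin d → Fin d → ℝ) →ₗ[ℝ] Fin d → ℝ,
      pairDet (fun V => gdJac h c x W (∑ l, b l • ρ • unitVec (Y l)) V
        (tangentPart (unitVec (Y i)) (η V))) ≠ 0 := by
  obtain ⟨η, hη⟩ := exists_pairDet_ne_zero_of_ker c hρ.ne' hker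
  have := ae_comp_unitVec_ne_zero h01 (P := fun U : Fin Ni → Fin d → ℝ =>
    pairDet (fun V => gdJac h c x W (∑ l, b l • ρ • U l) V (tangentPart (U i) (η V))))
    (contDiff_pairDet fun V j k => contDiff_gdJac c x W V j k
      (ContDiff.sum fun l _ => by fun_prop)
      (contDiff_tangentPart (by fun_prop) contDiff_const)) (by
      have h1 : ∑ l : Fin Ni, b l • ρ • (Pi.single i₀ 1 : Fin d → ℝ) = Pi.single i₀ ρ := by
        rw [← Finset.sum_smul, hb1, one_smul, ← Pi.single_smul, smul_eq_mul, mul_one]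
      simp only [h1]
      exact hη)
  filter_upwards [this] with Y hY
  exact ⟨η, hY⟩

/-- Where all the points are projected onto the sphere, the gradient step preserves null sets. -/
theorem ae_gdMap_notMem_of_sphere (hh : Differentiable ℝ h)
    (hd : ∀ᵐ t, DifferentiableAt ℝ (deriv h) t) {i₀ i₁ : Fin d} (h01 : i₀ ≠ i₁) (c : ℝ) {ρ : ℝ}
    (hρ : 0 < ρ) {x : Fin N → (Fin d → ℝ) × ℝ}
    (hx : ∀ i, (x i).1 ≠ 0) {b : Fin Ni → ℝ} (hb1 : ∑ i, b i = 1) {i : Fin Ni} (hb : b i ≠ 0)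
    (hker : ∀ᵐ W : Fin d → Fin d → ℝ, ∀ y, actBlock h c ρ x (W i₀) *ᵥ y = 0 →
      (∀ l ≠ i₀, actResponse h x (W i₀) (W l) ⬝ᵥ y = 0) → y = 0)
    {Z : Set (Fin d → Fin d → ℝ)} (hZm : MeasurableSet Z) (hZ : volume Z = 0) :
    ∀ᵐ z : (Fin d → Fin d → ℝ) × (Fin Ni → Fin d → ℝ), (∀ i, ρ ^ 2 < z.2 i ⬝ᵥ z.2 i) →
      gdMap h c x z.1 (readout b (retr ρ) z.2) ∉ Z := by
  have hhm := hh.continuous.measurable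
  have hθm := measurable_readout b (measurable_retr (d := d) ρ)
  let coef : (Fin d → ℝ) → ℝ := fun y => b i * (ρ * (√(y ⬝ᵥ y))⁻¹)
  have hcoefm : Measurable coef := by fun_prop
  let det : ((Fin d → Fin d → ℝ) →L[ℝ] Fin d → ℝ) →
      (Fin d → Fin d → ℝ) × (Fin Ni → Fin d → ℝ) → ℝ := fun η z =>
    pairDet (fun V => gdJac h c x z.1 (readout b (retr ρ) z.2) V
      (coef (z.2 i) • tangentPart (unitVec (z.2 i)) (η V)))
  have hdetm : ∀ η, Measurable (det η) := fun η =>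
    measurable_pairDet fun V j k => measurable_gdJac hhm c x V j k measurable_fst
      (hθm.comp measurable_snd) (by unfold tangentPart; fun_prop)
  have hdetc : ∀ z, Continuous fun η => det η z := fun z =>
    (contDiff_pairDet (X := (Fin d → Fin d → ℝ) →L[ℝ] Fin d → ℝ) fun V j k =>
      contDiff_gdJac c x z.1 V j k contDiff_const
        ((contDiff_tangentPart contDiff_const (contDiff_id.clm_apply contDiff_const)).const_smul
          _)).continuous
  have : SecondCountableTopology ((Fin d → Fin d → ℝ) →L[ℝ] Fin d → ℝ) :=
    secondCountable_of_proper
  -- A good η depends on (W, Y), whereas a slice needs a fixed direction. The determinant is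
  -- continuous in η, so a countable dense sequence of directions suffices; `G n` is where the n-th
  -- one works.
  let G : ℕ → Set ((Fin d → Fin d → ℝ) × (Fin Ni → Fin d → ℝ)) := fun n =>
    ((Prod.fst ⁻¹' {W | ∀ j i, DifferentiableAt ℝ (deriv h) (W j ⬝ᵥ (x i).1)}) ∩
      {z | ∀ l, ρ ^ 2 < z.2 l ⬝ᵥ z.2 l}) ∩ {z | det (TopologicalSpace.denseSeq _ n) z ≠ 0}
  have hGm : ∀ n, MeasurableSet (G n) := fun n => by
    refine ((measurable_fst (measurableSet_differentiableAt_weights x)).inter ?_).inter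
      (hdetm _ (measurableSet_singleton (0 : ℝ)).compl)
    have : {z : (Fin d → Fin d → ℝ) × (Fin Ni → Fin d → ℝ) | ∀ l, ρ ^ 2 < z.2 l ⬝ᵥ z.2 l} =
        ⋂ l, {z | ρ ^ 2 < z.2 l ⬝ᵥ z.2 l} := by ext z; simp
    rw [this]
    exact MeasurableSet.iInter fun l => measurableSet_lt measurable_const (by fun_prop)
  have main : ∀ n, ∀ᵐ z : (Fin d → Fin d → ℝ) × (Fin Ni → Fin d → ℝ), z ∈ G n →
      gdMap h c x z.1 (readout b (retr ρ) z.2) ∉ Z := by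
    intro n
    set η := TopologicalSpace.denseSeq ((Fin d → Fin d → ℝ) →L[ℝ] Fin d → ℝ) n with hη
    refine ae_gdMap_notMem_of_slice hh c x hθm
      (LinearMap.single ℝ (fun _ : Fin Ni => Fin d → ℝ) i ∘ₗ (η : (Fin d → Fin d → ℝ) →ₗ[ℝ] _))
      (hGm n) (fun z hz => hz.1.1) (fun z hz => ?_) hZm hZ
    refine ⟨b i • ((ρ * (√(z.2 i ⬝ᵥ z.2 i))⁻¹) • tangentPartL (unitVec (z.2 i)) ∘ₗ
      (η : (Fin d → Fin d → ℝ) →ₗ[ℝ] _)), ?_, ?_⟩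
    · have h1 := (hasFDerivAt_retr (hz.1.2 i) (η : (Fin d → Fin d → ℝ) →ₗ[ℝ] _)).const_smul (b i)
      have h2 : (fun δ => readout b (retr ρ) (z.2 + (LinearMap.single ℝ
          (fun _ : Fin Ni => Fin d → ℝ) i ∘ₗ (η : (Fin d → Fin d → ℝ) →ₗ[ℝ] _)) δ)) =
          fun δ => ∑ l ∈ Finset.univ.erase i, b l • retr ρ (z.2 l) +
            b i • retr ρ (z.2 i + (η : (Fin d → Fin d → ℝ) →ₗ[ℝ] _) δ) := by
        funext δ
        rw [readout, ← Finset.sum_erase_add _ _ (Finset.mem_univ i)]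
        congr 1
        · refine Finset.sum_congr rfl fun l hl => ?_
          simp [Finset.ne_of_mem_erase hl]
        · simp
      rw [h2]
      exact h1.const_add _
    · have h3 := hz.2
      have h4 : ∀ V, (b i • ((ρ * (√(z.2 i ⬝ᵥ z.2 i))⁻¹) • tangentPartL (unitVec (z.2 i)) ∘ₗ
          (η : (Fin d → Fin d → ℝ) →ₗ[ℝ] Fin d → ℝ))) V =
          coef (z.2 i) • tangentPart (unitVec (z.2 i)) (η V) := fun V => by
        change b i • ((ρ * (√(z.2 i ⬝ᵥ z.2 i))⁻¹) • tangentPart (unitVec (z.2 i)) (η V)) = _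
        rw [smul_smul]
      simp only [h4]
      exact h3
  have hdiffae : ∀ᵐ z : (Fin d → Fin d → ℝ) × (Fin Ni → Fin d → ℝ),
      ∀ j i, DifferentiableAt ℝ (deriv h) (z.1 j ⬝ᵥ (x i).1) :=
    Measure.quasiMeasurePreserving_fst.ae (ae_differentiableAt_weights hd fun _ => hx)
  have hGae : ∀ᵐ z : (Fin d → Fin d → ℝ) × (Fin Ni → Fin d → ℝ),
      (∀ l, ρ ^ 2 < z.2 l ⬝ᵥ z.2 l) → z ∈ ⋃ n, G n := by
    have hset : MeasurableSet {z : (Fin d → Fin d → ℝ) × (Fin Ni → Fin d → ℝ) |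
        (z ∈ {z : (Fin d → Fin d → ℝ) × (Fin Ni → Fin d → ℝ) | ∀ l, ρ ^ 2 < z.2 l ⬝ᵥ z.2 l} ∩
          Prod.fst ⁻¹' {W | ∀ j i, DifferentiableAt ℝ (deriv h) (W j ⬝ᵥ (x i).1)}) →
            z ∈ ⋃ n, G n} := by
      refine MeasurableSet.imp (p := fun z => z ∈ _) (q := fun z => z ∈ _) ?_
        (MeasurableSet.iUnion hGm)
      refine MeasurableSet.inter ?_
        (measurable_fst (measurableSet_differentiableAt_weights x))
      have : {z : (Fin d → Fin d → ℝ) × (Fin Ni → Fin d → ℝ) | ∀ l, ρ ^ 2 < z.2 l ⬝ᵥ z.2 l} =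
          ⋂ l, {z | ρ ^ 2 < z.2 l ⬝ᵥ z.2 l} := by ext z; simp
      rw [this]
      exact MeasurableSet.iInter fun l => measurableSet_lt measurable_const (by fun_prop)
    have hae := (Measure.ae_prod_iff_ae_ae (μ := (volume : Measure (Fin d → Fin d → ℝ)))
      (ν := (volume : Measure (Fin Ni → Fin d → ℝ))) hset).2 (by
      filter_upwards [hker] with W hW
      filter_upwards [ae_exists_pairDet_ne_zero h01 c hρ hb1 (i := i) hW] with Y hY
      rintro ⟨hout, hdif⟩
      obtain ⟨η, hη⟩ := hY
      have hq0 : 0 < Y i ⬝ᵥ Y i := (sq_nonneg ρ).trans_lt (hout i)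
      have hc0 : coef (Y i) ≠ 0 :=
        mul_ne_zero hb (mul_ne_zero hρ.ne' (inv_ne_zero (Real.sqrt_pos.2 hq0).ne'))
      -- The true variation of the readout carries the factor `b i` ρ/|Y i|, absent from the
      -- limiting computation; rescaling η compensates for it.
      have h1 : det ((coef (Y i))⁻¹ • LinearMap.toContinuousLinearMap η) (W, Y) ≠ 0 := by
        have h2 : ∀ V, coef (Y i) • tangentPart (unitVec (Y i))
            (((coef (Y i))⁻¹ • LinearMap.toContinuousLinearMap η) V) =
            tangentPart (unitVec (Y i)) (η V) := fun V => by
          change coef (Y i) • tangentPart (unitVec (Y i)) ((coef (Y i))⁻¹ • η V) = _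
          rw [tangentPart_smul, smul_smul, mul_inv_cancel₀ hc0, one_smul]
        simp only [det, h2, readout_retr_eq_of_lt b hout]
        exact hη
      obtain ⟨_, hn, ⟨n, rfl⟩⟩ := (TopologicalSpace.denseRange_denseSeq
        ((Fin d → Fin d → ℝ) →L[ℝ] Fin d → ℝ)).exists_mem_open
          (isOpen_ne_fun (hdetc (W, Y)) continuous_const) ⟨_, h1⟩ |> fun ⟨n, hn⟩ =>
            (⟨_, hn, ⟨n, rfl⟩⟩ : ∃ η, η ∈ {η | det η (W, Y) ≠ 0} ∧
              ∃ n, TopologicalSpace.denseSeq _ n = η)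
      exact Set.mem_iUnion.2 ⟨n, ⟨hdif, hout⟩, hn⟩)
    filter_upwards [hae, hdiffae] with z h1 h2 h3
    exact h1 ⟨h3, h2⟩
  filter_upwards [ae_all_iff.2 main, hGae] with z h1 h2 h3
  obtain ⟨n, hn⟩ := Set.mem_iUnion.1 (h2 h3)
  exact h1 n hn

end Core


/-! ### Generic properties of the readout, the gradient step and the collection -/

section Generic

variable {d N Ni : ℕ} {h : ℝ → ℝ}

theorem ae_ne_zero_of_analytic_of_ne_zero {E : Type*} [NormedAddCommGroup E] [NormedSpace ℝ E]
    [FiniteDimensional ℝ E] [MeasurableSpace E] [BorelSpace E] (μ : Measure E) [μ.IsAddHaarMeasure]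
    {F : E → ℝ} (hF : ContDiff ℝ ⊤ F) {p : E} (h : F p ≠ 0) : ∀ᵐ x ∂μ, F x ≠ 0 := by
  have h1 : ∀ᵐ x ∂μ, F (x + p) ≠ 0 :=
    ae_ne_zero_of_analytic_of_zero μ (hF.comp (contDiff_id.add contDiff_const)) (by simpa using h)
  have h2 := (measurePreserving_add_right μ (-p)).quasiMeasurePreserving.ae h1
  simpa using h2

theorem ae_eval_ne (j : Fin d) (a : ℝ) : ∀ᵐ t : Fin d → ℝ, t j ≠ a :=
  (Measure.quasiMeasurePreserving_eval (fun _ : Fin d => (volume : Measure ℝ)) j).ae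
    ((Set.countable_singleton a).ae_notMem volume)

/-- The two projections allowed in the algorithm: the identity, and, in dimension at least two, the
projection onto a ball of positive radius. -/
def IsAdmissibleProj (r : (Fin d → ℝ) → Fin d → ℝ) : Prop :=
  r = id ∨ 2 ≤ d ∧ ∃ ρ : ℝ, 0 < ρ ∧ r = retr ρ

theorem IsAdmissibleProj.measurable {r : (Fin d → ℝ) → Fin d → ℝ} (hr : IsAdmissibleProj r) :
    Measurable r := by
  rcases hr with rfl | ⟨-, ρ, -, rfl⟩
  · exact measurable_id
  · exact measurable_retr ρ

/-- Outside the ball, `r t j = a` forces the quadratic form ρ² tⱼ² - a²|t|² to vanish. For d ≥ 2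
this form is not identically zero, whereas in dimension one the retraction has atoms at ±ρ. -/
theorem IsAdmissibleProj.ae_ne {r : (Fin d → ℝ) → Fin d → ℝ} (hr : IsAdmissibleProj r)
    (j : Fin d) (a : ℝ) : ∀ᵐ t : Fin d → ℝ, r t j ≠ a := by
  rcases hr with rfl | ⟨h2, ρ, hρ, rfl⟩
  · exact ae_eval_ne j a
  · have : Nontrivial (Fin d) := Fin.nontrivial_iff_two_le.2 h2
    have hF : ContDiff ℝ ⊤ fun t : Fin d → ℝ => ρ ^ 2 * t j ^ 2 - a ^ 2 * (t ⬝ᵥ t) := by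
      simp only [dotProduct]
      fun_prop
    have h3 : ∀ᵐ t : Fin d → ℝ, ρ ^ 2 * t j ^ 2 - a ^ 2 * (t ⬝ᵥ t) ≠ 0 := by
      by_cases ha : a = 0
      · refine ae_ne_zero_of_analytic_of_ne_zero volume hF (p := Pi.single j 1) ?_
        simp [ha, hρ.ne']
      · obtain ⟨l, hl⟩ := exists_ne j
        refine ae_ne_zero_of_analytic_of_ne_zero volume hF (p := Pi.single l 1) ?_
        simp [ha, hl.symm]
    filter_upwards [ae_eval_ne j a, h3] with t h4 h5 h6
    unfold retr at h6
    split_ifs at h6 with h7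
    · exact h4 h6
    · have h8 : 0 < t ⬝ᵥ t := (sq_nonneg ρ).trans_lt (not_le.1 h7)
      have h9 : ρ * t j = a * √(t ⬝ᵥ t) := by
        rw [← h6]
        have := (Real.sqrt_pos.2 h8).ne'
        simp only [unitVec, Pi.smul_apply, smul_eq_mul]
        field_simp
      apply h5
      rw [← mul_pow, h9, mul_pow, Real.sq_sqrt h8.le, sub_self]

theorem ae_readout_ne_zero {r : (Fin d → ℝ) → Fin d → ℝ} (hr : IsAdmissibleProj r)
    {b : Fin Ni → ℝ} {i : Fin Ni} (hb : b i ≠ 0) :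
    ∀ᵐ Y : Fin Ni → Fin d → ℝ, ∀ j, readout b r Y j ≠ 0 := by
  refine ae_all_iff.2 fun j => ?_
  have hm := measurable_readout b hr.measurable
  refine ae_pi_of_ae_ae_update (fun _ : Fin Ni => (volume : Measure (Fin d → ℝ)))
    (S := {Y | readout b r Y j ≠ 0}) ?_ i (Filter.Eventually.of_forall fun Y => ?_)
  · exact ((measurable_pi_apply j).comp hm) (measurableSet_singleton (0 : ℝ)).compl
  · filter_upwards [hr.ae_ne j (-(b i)⁻¹ * ∑ l ∈ Finset.univ.erase i, b l * r (Y l) j)] with t ht h0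
    apply ht
    have h1 : readout b r (Function.update Y i t) j =
        ∑ l ∈ Finset.univ.erase i, b l * r (Y l) j + b i * r t j := by
      rw [readout, Finset.sum_apply, ← Finset.sum_erase_add _ _ (Finset.mem_univ i)]
      simp only [Pi.smul_apply, smul_eq_mul, Function.update_self]
      congr 1
      refine Finset.sum_congr rfl fun l hl => ?_
      rw [Function.update_of_ne (Finset.ne_of_mem_erase hl)]
    rw [h1] at h0
    have : b i * r t j = -∑ l ∈ Finset.univ.erase i, b l * r (Y l) j := by linarith
    rw [neg_mul, ← mul_neg, ← this, inv_mul_cancel_left₀ hb]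

section Data

variable (μ : Fin N → Measure ((Fin d → ℝ) × ℝ)) [∀ i, IsProbabilityMeasure (μ i)]

theorem ae_data_ne_zero (hμ : ∀ i, (μ i).map Prod.fst ≪ volume) :
    ∀ᵐ x ∂Measure.pi μ, 0 < d → ∀ i, (x i).1 ≠ 0 := by
  by_cases hd : 0 < d
  · simp only [hd, true_imp_iff]
    refine ae_all_iff.2 fun i => ?_
    have h1 : ∀ᵐ u : Fin d → ℝ, u ≠ 0 := by
      filter_upwards [ae_eval_ne ⟨0, hd⟩ 0] with u hu h0
      exact hu (congrFun h0 _)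
    exact (Measure.quasiMeasurePreserving_eval μ i).ae
      (ae_fst_of_map_fst_absolutelyContinuous (hμ i) h1)
  · simp [hd]

/-- For almost every data set, the gradient step composed with the readout pulls null sets of
hidden layers back to null sets. -/
theorem ae_gdMap_readout_notMem (hh : Differentiable ℝ h)
    (hd : ∀ᵐ t, DifferentiableAt ℝ (deriv h) t) (hC : ConditionC1 (deriv h))
    (hμ : ∀ i, (μ i).map Prod.fst ≪ volume) {r : (Fin d → ℝ) → Fin d → ℝ}
    (hr : IsAdmissibleProj r) (c : ℝ) {b : Fin Ni → ℝ} (hb1 : ∑ i, b i = 1) (hb : ∀ i, b i ≠ 0) :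
    ∀ᵐ x ∂Measure.pi μ, ∀ Z : Set (Fin d → Fin d → ℝ), MeasurableSet Z → volume Z = 0 →
      ∀ᵐ z : (Fin d → Fin d → ℝ) × (Fin Ni → Fin d → ℝ), gdMap h c x z.1 (readout b r z.2) ∉ Z := by
  obtain ⟨i⟩ : Nonempty (Fin Ni) := by
    by_contra hi
    rw [not_nonempty_iff] at hi
    simp at hb1
  rcases hr with rfl | ⟨h2, ρ, hρ, rfl⟩
  · filter_upwards [ae_data_ne_zero μ hμ] with x hx Z hZm hZ
    filter_upwards [ae_gdMap_notMem_of_free hh hd c hx b measurable_id (hb i) hZm hZ] with z hz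
    exact hz rfl
  · have h01 : (⟨0, by omega⟩ : Fin d) ≠ ⟨1, by omega⟩ := by simp
    filter_upwards [ae_data_ne_zero μ hμ,
      ae_data_actBlock_actResponse_ker h01 hh hd hC μ hμ c ρ] with x hx hker Z hZm hZ
    have h3 := ae_gdMap_notMem_of_sphere hh hd h01 c hρ (hx (by omega)) hb1 (hb i) hker hZm hZ
    have h4 := ae_all_iff.2 fun i =>
      ae_gdMap_notMem_of_free hh hd c hx b (measurable_retr ρ) (hb i) hZm hZ
    filter_upwards [h3, h4] with z h5 h6
    by_cases h7 : ∀ i, ρ ^ 2 < z.2 i ⬝ᵥ z.2 i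
    · exact h5 h7
    · push Not at h7
      obtain ⟨i, hi⟩ := h7
      exact h6 i (if_pos hi)

theorem ae_det_ne_zero : ∀ᵐ W : Fin d → Fin d → ℝ, (Matrix.of W).det ≠ 0 := by
  have hF : ContDiff ℝ ⊤ fun W : Fin d → Fin d → ℝ => (Matrix.of W).det := by
    simp only [Matrix.det_apply, Matrix.of_apply]
    fun_prop
  refine ae_ne_zero_of_analytic_of_ne_zero volume hF (p := fun j k => (1 : Matrix _ _ ℝ) j k) ?_
  change (1 : Matrix (Fin d) (Fin d) ℝ).det ≠ 0
  simp

theorem measurableSet_fullRank (h : ℝ → ℝ) :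
    MeasurableSet {p : (Fin N → (Fin d → ℝ) × ℝ) × (Fin d → Fin d → ℝ) |
      FullRankCollection (gradCollection h (fun i => (p.1 i).1) p.2)} := by
  have hgm : Measurable (deriv h) := measurable_deriv h
  refine (measurable_rank fun p i => ?_) (measurableSet_singleton (min N (d * d)))
  change Measurable fun z : (Fin N → (Fin d → ℝ) × ℝ) × (Fin d → Fin d → ℝ) =>
    deriv h (z.2 p.1 ⬝ᵥ (z.1 i).1) * (z.1 i).1 p.2
  simp only [dotProduct]
  fun_prop

/-- For almost every data set and hidden layer, the gradient collection has full rank. -/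
theorem ae_rank_gradCollection
    (hd : ∀ᵐ t, DifferentiableAt ℝ (deriv h) t) (hC : ConditionC1 (deriv h))
    (hμ : ∀ i, (μ i).map Prod.fst ≪ volume) :
    ∀ᵐ x ∂Measure.pi μ, ∀ᵐ W : Fin d → Fin d → ℝ,
      FullRankCollection (gradCollection h (fun i => (x i).1) W) := by
  have hgm : Measurable (deriv h) := measurable_deriv h
  refine (Measure.ae_ae_comm (p := fun (x : Fin N → (Fin d → ℝ) × ℝ) (W : Fin d → Fin d → ℝ) =>
    FullRankCollection (gradCollection h (fun i => (x i).1) W)) (measurableSet_fullRank h)).2 ?_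
  · filter_upwards [ae_det_ne_zero] with W hW
    have h1 := ae_rank_eq_min μ (m := Fin d × Fin d)
      (M := fun (x : (Fin d → ℝ) × ℝ) p => deriv h (W p.1 ⬝ᵥ x.1) * x.1 p.2) (by
        simp only [dotProduct]
        fun_prop) (fun i a ha => by
        have h2 : (Matrix.of fun j k => a (j, k)) ≠ 0 := by
          intro h0
          apply ha
          funext p
          exact congrFun (congrFun h0 p.1) p.2
        refine ae_fst_of_map_fst_absolutelyContinuous (hμ i) (p := fun u =>
          (a ⬝ᵥ fun p => deriv h (W p.1 ⬝ᵥ u) * u p.2) ≠ 0) ?_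
        filter_upwards [ae_sum_mul_comp_dotProduct_ne_zero hC hgm hd hW.isUnit h2] with u hu
        convert hu using 1
        simp only [dotProduct, Fintype.sum_prod_type, Finset.sum_mul, Matrix.of_apply]
        refine Finset.sum_congr rfl fun j _ => Finset.sum_congr rfl fun k _ => ?_
        ring)
    simp only [Fintype.card_prod, Fintype.card_fin] at h1
    exact h1

end Data

/-- Row (j, k) is scaled by θ j, which is left multiplication by an invertible diagonal matrix. -/
theorem rank_firstOrderMatrix (u : Fin N → Fin d → ℝ) (W : Matrix (Fin d) (Fin d) ℝ)
    {θ : EuclideanSpace ℝ (Fin d)} (hθ : ∀ j, θ j ≠ 0) :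
    (firstOrderMatrix h u W θ).rank =
      (Matrix.of fun (p : Fin d × Fin d) i => gradCollection h u W i p.1 p.2).rank := by
  have h1 : firstOrderMatrix h u W θ = Matrix.diagonal (fun p : Fin d × Fin d => θ p.1) *
      Matrix.of fun (p : Fin d × Fin d) i => gradCollection h u W i p.1 p.2 := by
    ext p i
    simp only [firstOrderMatrix, gradCollection, Matrix.diagonal_mul, Matrix.of_apply,
      Matrix.vecMulVec_apply]
    ring
  rw [h1, Matrix.rank_mul_eq_right_of_isUnit_det]
  rw [Matrix.det_diagonal, isUnit_iff_ne_zero]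
  exact Finset.prod_ne_zero_iff.2 fun p _ => hθ p.1

end Generic


/-! ### The noise law and triangular maps -/

section Noise

theorem absolutelyContinuous_pi_fin {n : ℕ} {X : Fin n → Type*} [∀ i, MeasurableSpace (X i)]
    {μ ν : ∀ i, Measure (X i)} [∀ i, SigmaFinite (μ i)] [∀ i, SigmaFinite (ν i)]
    (h : ∀ i, μ i ≪ ν i) : Measure.pi μ ≪ Measure.pi ν := by
  induction n with
  | zero => rw [Measure.pi_of_empty, Measure.pi_of_empty]
  | succ n ih =>
    have h1 := ih fun i => h ((0 : Fin (n + 1)).succAbove i)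
    have h2 := (h 0).prod h1
    have h3 := (measurePreserving_piFinSuccAbove μ 0).symm
    have h4 := (measurePreserving_piFinSuccAbove ν 0).symm
    rw [← h3.map_eq, ← h4.map_eq]
    exact h2.map h3.measurable

instance isProbabilityMeasure_noiseLaw (d Ni : ℕ) (s : ℝ≥0) :
    IsProbabilityMeasure (noiseLaw d Ni s) := by
  unfold noiseLaw
  infer_instance

theorem noiseLaw_absolutelyContinuous (d Ni : ℕ) {s : ℝ≥0} (hs : s ≠ 0) :
    noiseLaw d Ni s ≪ volume :=
  absolutelyContinuous_pi_fin fun _ => absolutelyContinuous_pi_fin fun _ =>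
    gaussianReal_absolutelyContinuous 0 hs

/-- A triangular affine perturbation of nonzero dilations of the coordinates pulls null sets back to
null sets. -/
theorem quasiMeasurePreserving_triangular {n : ℕ} {κ : Type*} [Fintype κ] {a : Fin n → ℝ}
    (ha : ∀ i, a i ≠ 0) {G : Fin n → (Fin n → κ → ℝ) → κ → ℝ} (hG : ∀ i, Measurable (G i))
    (hGi : ∀ i x y, (∀ l < i, x l = y l) → G i x = G i y) :
    Measure.QuasiMeasurePreserving (fun x : Fin n → κ → ℝ => fun i => a i • x i + G i x)
      volume volume := by
  -- Modify the last `m` coordinates, going from the last to the first: the shift of coordinate i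
  -- reads only earlier coordinates, which are still untouched at that stage.
  suffices H : ∀ m ≤ n, Measure.QuasiMeasurePreserving
      (fun x : Fin n → κ → ℝ => fun i : Fin n => if n ≤ i + m then a i • x i + G i x else x i)
      volume volume by
    simpa using H n le_rfl
  intro m
  induction m with
  | zero =>
    intro _
    have : (fun x : Fin n → κ → ℝ => fun i : Fin n =>
        if n ≤ i + 0 then a i • x i + G i x else x i) = id := by
      funext x i
      rw [if_neg (by omega), id]
    rw [this]
    exact .id _
  | succ m ih =>
    intro hm
    let i₀ : Fin n := ⟨n - (m + 1), by omega⟩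
    have h1 := (quasiMeasurePreserving_update_affine i₀ (ha i₀) (hG i₀) fun x t =>
      hGi i₀ _ _ fun l hl => Function.update_of_ne hl.ne _ _).comp (ih (by omega))
    convert h1 using 1
    funext x i
    rw [Function.comp_apply]
    have h2 : ¬ n ≤ (i₀ : ℕ) + m := by simp only [i₀]; omega
    have h3 : G i₀ (fun i : Fin n => if n ≤ i + m then a i • x i + G i x else x i) = G i₀ x := by
      refine hGi i₀ _ _ fun l hl => if_neg ?_
      have : (l : ℕ) < i₀ := hl
      omega
    simp only [h3, if_neg h2]
    by_cases hi : i = i₀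
    · subst hi
      rw [Function.update_self, if_pos (by simp only [i₀]; omega)]
    · rw [Function.update_of_ne hi]
      have h4 : (i : ℕ) ≠ n - (m + 1) := fun h5 => hi (Fin.ext h5)
      by_cases h5 : n ≤ (i : ℕ) + m
      · rw [if_pos h5, if_pos (by omega)]
      · rw [if_neg h5, if_neg (by omega)]

end Noise

/-! ### Gradients of the objective in closed form -/

section Objective

variable {d N : ℕ} {h : ℝ → ℝ}

/-- The gradient of the objective in the outer weights. -/
noncomputable def outerGrad (h : ℝ → ℝ) (x : Fin N → (Fin d → ℝ) × ℝ) (W : Fin d → Fin d → ℝ)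
    (θ : Fin d → ℝ) (j : Fin d) : ℝ :=
  -(1 / (N : ℝ)) * ∑ i, residual h W θ (x i) * h (W j ⬝ᵥ (x i).1)

theorem measurable_outerGrad (hh : Measurable h) {X : Type*} [MeasurableSpace X]
    {x : X → Fin N → (Fin d → ℝ) × ℝ} {W : X → Fin d → Fin d → ℝ} {θ : X → Fin d → ℝ}
    (hx : Measurable x) (hW : Measurable W) (hθ : Measurable θ) :
    Measurable fun z => outerGrad h (x z) (W z) (θ z) := by
  refine measurable_pi_lambda _ fun j => ?_
  unfold outerGrad residual
  simp only [dotProduct]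
  fun_prop

theorem hasDerivAt_objective_weights (hh : Differentiable ℝ h) (u : Fin N → Fin d → ℝ)
    (v : Fin N → ℝ) (W : Matrix (Fin d) (Fin d) ℝ) (θ : EuclideanSpace ℝ (Fin d)) (j k : Fin d) :
    HasDerivAt (fun t : ℝ => objective h u v (W + t • Matrix.single j k (1 : ℝ)) θ)
      (-(1 / (N : ℝ)) * ∑ i, residual h W θ (u i, v i) * θ j * deriv h (W j ⬝ᵥ u i) * u i k) 0 := by
  have h1 : ∀ (i : Fin N) (t : ℝ) (l : Fin d),
      ((W + t • Matrix.single j k (1 : ℝ)) *ᵥ u i) l =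
        W l ⬝ᵥ u i + t * (if l = j then u i k else 0) := by
    intro i t l
    rw [Matrix.add_mulVec, Matrix.smul_mulVec, Matrix.single_mulVec]
    simp [Matrix.mulVec, Function.update_apply]
  have h2 : ∀ i, HasDerivAt
      (fun t : ℝ => network h (W + t • Matrix.single j k (1 : ℝ)) θ (u i))
      (θ j * (deriv h (W j ⬝ᵥ u i) * u i k)) 0 := by
    intro i
    have h3 : ∀ l : Fin d, HasDerivAt
        (fun t : ℝ => θ l * h (W l ⬝ᵥ u i + t * (if l = j then u i k else 0)))
        (θ l * (deriv h (W l ⬝ᵥ u i) * (if l = j then u i k else 0))) 0 := by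
      intro l
      have h4 : HasDerivAt (fun t : ℝ => W l ⬝ᵥ u i + t * (if l = j then u i k else 0))
          (if l = j then u i k else 0) 0 :=
        ((hasDerivAt_mul_const _).const_add _)
      have h5 : HasDerivAt h (deriv h (W l ⬝ᵥ u i))
          (W l ⬝ᵥ u i + 0 * (if l = j then u i k else 0)) := by
        rw [zero_mul, add_zero]
        exact (hh _).hasDerivAt
      exact (h5.comp 0 h4).const_mul (θ l)
    have h6 := HasDerivAt.fun_sum (u := Finset.univ) fun l _ => h3 l
    simp only [network, h1]
    refine h6.congr_deriv ?_
    simp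
  have h7 := (HasDerivAt.fun_sum (u := Finset.univ) fun i _ =>
    (((h2 i).const_sub (v i)).fun_pow 2)).const_mul (1 / (2 * (N : ℝ)))
  refine h7.congr_deriv ?_
  rw [Finset.mul_sum, Finset.mul_sum]
  refine Finset.sum_congr rfl fun i _ => ?_
  have h8 : v i - network h (W + (0 : ℝ) • Matrix.single j k (1 : ℝ)) θ (u i) =
      residual h W θ (u i, v i) := by
    rw [zero_smul, add_zero]
    rfl
  rw [h8]
  by_cases hN : (N : ℝ) = 0
  · simp [hN]
  · field_simp
    push_cast
    ring

theorem sub_smul_gradW (hh : Differentiable ℝ h) (u : Fin N → Fin d → ℝ) (v : Fin N → ℝ)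
    (W : Matrix (Fin d) (Fin d) ℝ) (θ : EuclideanSpace ℝ (Fin d)) (γ : ℝ) :
    W - γ • gradW h u v W θ = gdMap h (γ / N) (fun i => (u i, v i)) W θ := by
  funext j k
  rw [Matrix.sub_apply, Matrix.smul_apply, gradW, Matrix.of_apply,
    (hasDerivAt_objective_weights hh u v W θ j k).deriv, smul_eq_mul]
  change _ = W j k + γ / N * _
  ring

theorem gradient_objective (u : Fin N → Fin d → ℝ) (v : Fin N → ℝ) (W : Matrix (Fin d) (Fin d) ℝ)
    (θ : EuclideanSpace ℝ (Fin d)) :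
    ∇ (fun ϑ => objective h u v W ϑ) θ =
      WithLp.toLp 2 (outerGrad h (fun i => (u i, v i)) W θ) := by
  let H : Fin N → EuclideanSpace ℝ (Fin d) := fun i => WithLp.toLp 2 fun j => h (W j ⬝ᵥ u i)
  have h1 : ∀ (ϑ : EuclideanSpace ℝ (Fin d)) i, network h W ϑ (u i) = innerSL ℝ (H i) ϑ := by
    intro ϑ i
    simp [network, H, PiLp.inner_apply, Matrix.mulVec]
  have h2 : HasFDerivAt (fun ϑ => objective h u v W ϑ)
      ((1 / (2 * (N : ℝ))) • ∑ i, (2 * (v i - innerSL ℝ (H i) θ)) • -(innerSL ℝ (H i))) θ := by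
    simp only [objective, h1]
    refine HasFDerivAt.const_mul ?_ _
    refine HasFDerivAt.fun_sum fun i _ => ?_
    refine ((hasDerivAt_pow 2 (v i - innerSL ℝ (H i) θ)).comp_hasFDerivAt θ
      (((innerSL ℝ (H i)).hasFDerivAt (x := θ)).const_sub (v i))).congr_fderiv ?_
    simp
  refine HasGradientAt.gradient ?_
  rw [hasGradientAt_iff_hasFDerivAt]
  refine h2.congr_fderiv ?_
  have h3 : ∀ i, v i - innerSL ℝ (H i) θ = residual h W θ (u i, v i) := by
    intro i
    rw [← h1]
    rfl
  simp only [h3]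
  ext y
  simp only [InnerProductSpace.toDual_apply_apply, _root_.smul_apply, _root_.sum_apply,
    _root_.neg_apply, innerSL_apply_apply, smul_eq_mul, PiLp.inner_apply, H, outerGrad,
    RCLike.inner_apply, conj_trivial, Finset.mul_sum, mul_neg]
  simp only [← Finset.sum_neg_distrib]
  rw [Finset.sum_comm]
  refine Finset.sum_congr rfl fun j _ => Finset.sum_congr rfl fun i _ => ?_
  by_cases hN : (N : ℝ) = 0
  · simp [hN]
  · field_simp

end Objective


/-! ### The prox-mapping as a projection of x - y -/

section Prox

variable {d : ℕ}

/-- Completing the square, the objective at z exceeds that at p by ½|z - p|² - ⟨x - y - p, z - p⟩.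
The variational inequality thus makes p the unique minimizer, which is what the choice operator must
return. -/
theorem proxMap_eq_of_inner_nonpos {K : Set (EuclideanSpace ℝ (Fin d))}
    {x y p : EuclideanSpace ℝ (Fin d)} (hp : p ∈ K)
    (h : ∀ z ∈ K, inner ℝ (x - y - p) (z - p) ≤ 0) : proxMap K x y = p := by
  have key : ∀ z, inner ℝ y (z - x) + 1 / 2 * ‖z - x‖ ^ 2 =
      inner ℝ y (p - x) + 1 / 2 * ‖p - x‖ ^ 2 + 1 / 2 * ‖z - p‖ ^ 2
        - inner ℝ (x - y - p) (z - p) := by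
    intro z
    have h1 : z - x = (z - p) + (p - x) := by abel
    have h2 : x - y - p = -(y + (p - x)) := by abel
    rw [h1, h2, norm_add_sq_real, inner_add_right, inner_neg_left, inner_add_left,
      real_inner_comm (z - p) (p - x)]
    ring
  have hmin : IsMinOn (fun z => inner ℝ y (z - x) + 1 / 2 * ‖z - x‖ ^ 2) K p := by
    intro z hz
    change inner ℝ y (p - x) + 1 / 2 * ‖p - x‖ ^ 2 ≤ inner ℝ y (z - x) + 1 / 2 * ‖z - x‖ ^ 2
    rw [key z]
    have := h z hz
    have := sq_nonneg ‖z - p‖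
    linarith
  have hspec := Classical.epsilon_spec (p := fun z => z ∈ K ∧
    IsMinOn (fun z' => inner ℝ y (z' - x) + 1 / 2 * ‖z' - x‖ ^ 2) K z) ⟨p, hp, hmin⟩
  change proxMap K x y ∈ K ∧ IsMinOn _ K (proxMap K x y) at hspec
  have h1 : inner ℝ y (proxMap K x y - x) + 1 / 2 * ‖proxMap K x y - x‖ ^ 2 ≤
      inner ℝ y (p - x) + 1 / 2 * ‖p - x‖ ^ 2 := hspec.2 hp
  rw [key (proxMap K x y)] at h1
  have h2 := h _ hspec.1
  have h3 : ‖proxMap K x y - p‖ ^ 2 = 0 :=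
    le_antisymm (by linarith) (sq_nonneg _)
  exact sub_eq_zero.1 (norm_eq_zero.1 (pow_eq_zero_iff two_ne_zero |>.1 h3))

theorem dotProduct_self_eq_norm_sq (y : EuclideanSpace ℝ (Fin d)) :
    y.ofLp ⬝ᵥ y.ofLp = ‖y‖ ^ 2 := by
  rw [EuclideanSpace.real_norm_sq_eq, dotProduct]
  simp only [sq]

theorem proxMap_univ (x y : EuclideanSpace ℝ (Fin d)) : proxMap Set.univ x y = x - y :=
  proxMap_eq_of_inner_nonpos (Set.mem_univ _) fun z _ => by simp

theorem proxMap_closedBall {ρ : ℝ} (hρ : 0 < ρ) (x y : EuclideanSpace ℝ (Fin d)) :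
    proxMap (Metric.closedBall 0 ρ) x y = WithLp.toLp 2 (retr ρ (x - y).ofLp) := by
  unfold retr
  rw [dotProduct_self_eq_norm_sq]
  split_ifs with h1
  · refine proxMap_eq_of_inner_nonpos ?_ fun z _ => by simp
    rw [mem_closedBall_zero_iff]
    exact (pow_le_pow_iff_left₀ (norm_nonneg _) hρ.le two_ne_zero).1 h1
  · have h2 : ρ < ‖x - y‖ :=
      lt_of_pow_lt_pow_left₀ 2 (norm_nonneg _) (not_le.1 h1)
    have h3 : 0 < ‖x - y‖ := hρ.trans h2
    have h4 : WithLp.toLp 2 (ρ • unitVec (x - y).ofLp) = (ρ * ‖x - y‖⁻¹) • (x - y) := by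
      rw [unitVec, dotProduct_self_eq_norm_sq, Real.sqrt_sq h3.le, smul_smul]
      rfl
    rw [h4]
    set w := x - y with hw
    refine proxMap_eq_of_inner_nonpos ?_ fun z hz => ?_
    · rw [mem_closedBall_zero_iff, norm_smul, Real.norm_of_nonneg (by positivity), mul_assoc,
        inv_mul_cancel₀ h3.ne', mul_one]
    · rw [mem_closedBall_zero_iff] at hz
      have h5 : w - (ρ * ‖w‖⁻¹) • w = (1 - ρ * ‖w‖⁻¹) • w := by rw [sub_smul, one_smul]
      rw [← hw, h5, real_inner_smul_left]
      refine mul_nonpos_of_nonneg_of_nonpos ?_ ?_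
      · rw [sub_nonneg, ← div_eq_mul_inv, div_le_one h3]
        exact h2.le
      · rw [inner_sub_right, real_inner_smul_right, real_inner_self_eq_norm_sq]
        have h6 := real_inner_le_norm w z
        have h7 : ρ * ‖w‖⁻¹ * ‖w‖ ^ 2 = ‖w‖ * ρ := by field_simp
        have h8 := mul_le_mul_of_nonneg_left hz h3.le
        linarith

theorem exists_admissibleProj {K : Set (EuclideanSpace ℝ (Fin d))}
    (hK : K = Set.univ ∨ (2 ≤ d ∧ ∃ R : ℝ, 0 < R ∧ K = Metric.closedBall 0 (R / 2))) :
    ∃ r : (Fin d → ℝ) → Fin d → ℝ, IsAdmissibleProj r ∧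
      ∀ x y, proxMap K x y = WithLp.toLp 2 (r (x - y).ofLp) := by
  rcases hK with rfl | ⟨hd, R, hR, rfl⟩
  · exact ⟨id, Or.inl rfl, proxMap_univ⟩
  · exact ⟨retr (R / 2), Or.inr ⟨hd, R / 2, half_pos hR, rfl⟩, proxMap_closedBall (half_pos hR)⟩

end Prox

/-! ### The inner loop in coordinates -/

section Inner

variable {d N Ni : ℕ} {h : ℝ → ℝ}

/-- The inner iterates in coordinates, for the projection `r`. -/
noncomputable def innerPoint (h : ℝ → ℝ) (x : Fin N → (Fin d → ℝ) × ℝ)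
    (r : (Fin d → ℝ) → Fin d → ℝ) (β : Fin Ni → ℝ) (W : Fin d → Fin d → ℝ) (θ : Fin d → ℝ)
    (ξ : Fin Ni → Fin d → ℝ) : ℕ → Fin d → ℝ
  | 0 => θ
  | i + 1 =>
    let θi := innerPoint h x r β W θ ξ i
    if hi : i < Ni then r (θi - β ⟨i, hi⟩ • (outerGrad h x W θi + ξ ⟨i, hi⟩)) else θi

/-- The points produced by the inner steps before projection. -/
noncomputable def unprojected (h : ℝ → ℝ) (x : Fin N → (Fin d → ℝ) × ℝ)
    (r : (Fin d → ℝ) → Fin d → ℝ) (β : Fin Ni → ℝ) (W : Fin d → Fin d → ℝ) (θ : Fin d → ℝ)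
    (ξ : Fin Ni → Fin d → ℝ) (i : Fin Ni) : Fin d → ℝ :=
  innerPoint h x r β W θ ξ i - β i • (outerGrad h x W (innerPoint h x r β W θ ξ i) + ξ i)

theorem innerPoint_succ (x : Fin N → (Fin d → ℝ) × ℝ)
    (r : (Fin d → ℝ) → Fin d → ℝ) (β : Fin Ni → ℝ) (W : Fin d → Fin d → ℝ) (θ : Fin d → ℝ)
    (ξ : Fin Ni → Fin d → ℝ) (i : Fin Ni) :
    innerPoint h x r β W θ ξ (i + 1) = r (unprojected h x r β W θ ξ i) := by
  rw [innerPoint, dif_pos i.isLt]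
  rfl

theorem measurable_innerPoint (hh : Measurable h) {X : Type*} [MeasurableSpace X]
    {x : X → Fin N → (Fin d → ℝ) × ℝ} {r : (Fin d → ℝ) → Fin d → ℝ} (hr : Measurable r)
    (β : Fin Ni → ℝ) {W : X → Fin d → Fin d → ℝ} {θ : X → Fin d → ℝ}
    {ξ : X → Fin Ni → Fin d → ℝ} (hx : Measurable x) (hW : Measurable W) (hθ : Measurable θ)
    (hξ : Measurable ξ) (i : ℕ) :
    Measurable fun z => innerPoint h (x z) r β (W z) (θ z) (ξ z) i := by
  induction i with
  | zero => exact hθ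
  | succ i ih =>
    by_cases hi : i < Ni
    · simp only [innerPoint, dif_pos hi]
      have h1 := measurable_outerGrad hh hx hW ih
      fun_prop
    · simp only [innerPoint, dif_neg hi]
      exact ih

theorem measurable_unprojected (hh : Measurable h) {X : Type*} [MeasurableSpace X]
    {x : X → Fin N → (Fin d → ℝ) × ℝ} {r : (Fin d → ℝ) → Fin d → ℝ} (hr : Measurable r)
    (β : Fin Ni → ℝ) {W : X → Fin d → Fin d → ℝ} {θ : X → Fin d → ℝ}
    {ξ : X → Fin Ni → Fin d → ℝ} (hx : Measurable x) (hW : Measurable W) (hθ : Measurable θ)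
    (hξ : Measurable ξ) :
    Measurable fun z => unprojected h (x z) r β (W z) (θ z) (ξ z) := by
  refine measurable_pi_lambda _ fun i => ?_
  have h1 := measurable_innerPoint hh hr β hx hW hθ hξ i
  have h2 := measurable_outerGrad hh hx hW h1
  unfold unprojected
  fun_prop

theorem innerPoint_congr (x : Fin N → (Fin d → ℝ) × ℝ)
    (r : (Fin d → ℝ) → Fin d → ℝ) (β : Fin Ni → ℝ) (W : Fin d → Fin d → ℝ) (θ : Fin d → ℝ)
    {ξ ξ' : Fin Ni → Fin d → ℝ} {i : ℕ} (hξ : ∀ l : Fin Ni, (l : ℕ) < i → ξ l = ξ' l) :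
    innerPoint h x r β W θ ξ i = innerPoint h x r β W θ ξ' i := by
  induction i with
  | zero => rfl
  | succ i ih =>
    have h1 := ih fun l hl => hξ l (by omega)
    by_cases hi : i < Ni
    · simp only [innerPoint, dif_pos hi, h1, hξ ⟨i, hi⟩ (Nat.lt_succ_self i)]
    · simp only [innerPoint, dif_neg hi, h1]

/-- The i-th unprojected point is -βᵢ ξᵢ plus a function of the earlier noise vectors, so the map is
triangular, whatever `r` does. -/
theorem quasiMeasurePreserving_unprojected (hh : Measurable h) (x : Fin N → (Fin d → ℝ) × ℝ)
    {r : (Fin d → ℝ) → Fin d → ℝ} (hr : Measurable r) {β : Fin Ni → ℝ} (hβ : ∀ i, β i ≠ 0)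
    (W : Fin d → Fin d → ℝ) (θ : Fin d → ℝ) :
    Measure.QuasiMeasurePreserving (unprojected h x r β W θ) volume volume := by
  have h1 := quasiMeasurePreserving_triangular (a := fun i => -β i)
    (fun i => neg_ne_zero.2 (hβ i)) (G := fun i ξ => innerPoint h x r β W θ ξ i -
      β i • outerGrad h x W (innerPoint h x r β W θ ξ i)) (fun i => by
      have h2 := measurable_innerPoint hh hr β (x := fun _ => x) (W := fun _ => W)
        (θ := fun _ => θ) measurable_const measurable_const measurable_const measurable_id i
      have h3 := measurable_outerGrad hh (x := fun _ => x) (W := fun _ => W) measurable_const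
        measurable_const h2
      exact h2.sub (h3.const_smul (β i))) (fun i ξ ξ' hξ => by
      rw [innerPoint_congr x r β W θ hξ])
  convert h1 using 1
  funext ξ i
  rw [unprojected, smul_add, neg_smul]
  abel

theorem innerIter_eq {K : Set (EuclideanSpace ℝ (Fin d))} {r : (Fin d → ℝ) → Fin d → ℝ}
    (hK : ∀ x y, proxMap K x y = WithLp.toLp 2 (r (x - y).ofLp)) (u : Fin N → Fin d → ℝ)
    (v : Fin N → ℝ) (β : Fin Ni → ℝ) (W : Matrix (Fin d) (Fin d) ℝ)
    (θ : EuclideanSpace ℝ (Fin d)) (ξ : Fin Ni → Fin d → ℝ) (i : ℕ) :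
    innerIter h u v K β W θ ξ i =
      WithLp.toLp 2 (innerPoint h (fun i => (u i, v i)) r β W θ ξ i) := by
  induction i with
  | zero => rfl
  | succ i ih =>
    by_cases hi : i < Ni
    · simp only [innerPoint, innerIter, dif_pos hi, ih, hK, stochGrad, gradient_objective]
      rfl
    · simp only [innerPoint, innerIter, dif_neg hi, ih]

theorem outerStep_eq (hh : Differentiable ℝ h) {K : Set (EuclideanSpace ℝ (Fin d))}
    {r : (Fin d → ℝ) → Fin d → ℝ}
    (hK : ∀ x y, proxMap K x y = WithLp.toLp 2 (r (x - y).ofLp)) (u : Fin N → Fin d → ℝ)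
    (v : Fin N → ℝ) (β : Fin Ni → ℝ) (γ : ℝ)
    (st : Matrix (Fin d) (Fin d) ℝ × EuclideanSpace ℝ (Fin d)) (ξ : Fin Ni → Fin d → ℝ) :
    (outerStep h u v K β γ st ξ).2.ofLp = readout (fun i => (∑ l, β l)⁻¹ * β i) r
      (unprojected h (fun i => (u i, v i)) r β st.1 st.2 ξ) ∧
    (outerStep h u v K β γ st ξ).1 = gdMap h (γ / N) (fun i => (u i, v i)) st.1
      (readout (fun i => (∑ l, β l)⁻¹ * β i) r
        (unprojected h (fun i => (u i, v i)) r β st.1 st.2 ξ)) := by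
  have h1 : (innerOutput h u v K β st.1 st.2 ξ).ofLp = readout (fun i => (∑ l, β l)⁻¹ * β i) r
      (unprojected h (fun i => (u i, v i)) r β st.1 st.2 ξ) := by
    simp only [innerOutput, innerIter_eq hK, readout, mul_smul, ← Finset.smul_sum]
    simp only [WithLp.ofLp_smul, WithLp.ofLp_sum]
    refine congrArg _ (Finset.sum_congr rfl fun i _ => congrArg _ ?_)
    exact innerPoint_succ _ r β st.1 _ ξ i
  refine ⟨h1, ?_⟩
  rw [← h1]
  exact sub_smul_gradW hh u v st.1 _ γ

end Inner


/-! ### One outer iteration -/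

section Step

variable {d N Ni : ℕ} {h : ℝ → ℝ}

/-- One outer iteration in coordinates. -/
noncomputable def pointStep (h : ℝ → ℝ) (x : Fin N → (Fin d → ℝ) × ℝ)
    (r : (Fin d → ℝ) → Fin d → ℝ) (β : Fin Ni → ℝ) (γ : ℝ) (s : (Fin d → Fin d → ℝ) × (Fin d → ℝ))
    (ξ : Fin Ni → Fin d → ℝ) : (Fin d → Fin d → ℝ) × (Fin d → ℝ) :=
  let θ := readout (fun i => (∑ l, β l)⁻¹ * β i) r (unprojected h x r β s.1 s.2 ξ)
  (gdMap h (γ / N) x s.1 θ, θ)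

/-- The trajectory of the algorithm in coordinates. -/
noncomputable def pointIter (h : ℝ → ℝ) (x : Fin N → (Fin d → ℝ) × ℝ)
    (r : (Fin d → ℝ) → Fin d → ℝ) (β : ℕ → Fin Ni → ℝ) (γ : ℕ → ℝ)
    (s : (Fin d → Fin d → ℝ) × (Fin d → ℝ)) (ξ : ℕ → Fin Ni → Fin d → ℝ) :
    ℕ → (Fin d → Fin d → ℝ) × (Fin d → ℝ)
  | 0 => s
  | k + 1 => pointStep h x r (β k) (γ k) (pointIter h x r β γ s ξ k) (ξ k)

theorem outerStep_eq_pointStep (hh : Differentiable ℝ h) {K : Set (EuclideanSpace ℝ (Fin d))}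
    {r : (Fin d → ℝ) → Fin d → ℝ}
    (hK : ∀ x y, proxMap K x y = WithLp.toLp 2 (r (x - y).ofLp)) (u : Fin N → Fin d → ℝ)
    (v : Fin N → ℝ) (β : Fin Ni → ℝ) (γ : ℝ)
    (s : (Fin d → Fin d → ℝ) × (Fin d → ℝ)) (ξ : Fin Ni → Fin d → ℝ) :
    outerStep h u v K β γ (s.1, WithLp.toLp 2 s.2) ξ =
      ((pointStep h (fun i => (u i, v i)) r β γ s ξ).1,
        WithLp.toLp 2 (pointStep h (fun i => (u i, v i)) r β γ s ξ).2) := by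
  obtain ⟨h1, h2⟩ := outerStep_eq hh hK u v β γ (s.1, WithLp.toLp 2 s.2) ξ
  refine Prod.ext h2 ?_
  rw [← WithLp.toLp_ofLp 2 (outerStep h u v K β γ (s.1, WithLp.toLp 2 s.2) ξ).2, h1]
  rfl

theorem iterate_eq_pointIter (hh : Differentiable ℝ h) {K : Set (EuclideanSpace ℝ (Fin d))}
    {r : (Fin d → ℝ) → Fin d → ℝ}
    (hK : ∀ x y, proxMap K x y = WithLp.toLp 2 (r (x - y).ofLp)) (u : Fin N → Fin d → ℝ)
    (v : Fin N → ℝ) (β : ℕ → Fin Ni → ℝ) (γ : ℕ → ℝ) (W₀ : Matrix (Fin d) (Fin d) ℝ)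
    (θ₀ : EuclideanSpace ℝ (Fin d)) (ξ : ℕ → Fin Ni → Fin d → ℝ) (k : ℕ) :
    iterate h u v K β γ W₀ θ₀ ξ k =
      ((pointIter h (fun i => (u i, v i)) r β γ (W₀, θ₀.ofLp) ξ k).1,
        WithLp.toLp 2 (pointIter h (fun i => (u i, v i)) r β γ (W₀, θ₀.ofLp) ξ k).2) := by
  induction k with
  | zero => rfl
  | succ k ih =>
    rw [iterate, ih]
    exact outerStep_eq_pointStep hh hK u v (β k) (γ k) _ (ξ k)

theorem pointIter_congr (x : Fin N → (Fin d → ℝ) × ℝ) (r : (Fin d → ℝ) → Fin d → ℝ)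
    (β : ℕ → Fin Ni → ℝ) (γ : ℕ → ℝ) (s : (Fin d → Fin d → ℝ) × (Fin d → ℝ))
    {ξ ξ' : ℕ → Fin Ni → Fin d → ℝ} {k : ℕ} (hξ : ∀ i < k, ξ i = ξ' i) :
    pointIter h x r β γ s ξ k = pointIter h x r β γ s ξ' k := by
  induction k with
  | zero => rfl
  | succ k ih => rw [pointIter, pointIter, ih fun i hi => hξ i (by omega), hξ k (by omega)]

theorem measurable_pointStep (hh : Measurable h) {X : Type*} [MeasurableSpace X]
    {x : X → Fin N → (Fin d → ℝ) × ℝ} {r : (Fin d → ℝ) → Fin d → ℝ} (hr : Measurable r)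
    (β : Fin Ni → ℝ) (γ : ℝ) {s : X → (Fin d → Fin d → ℝ) × (Fin d → ℝ)}
    {ξ : X → Fin Ni → Fin d → ℝ} (hx : Measurable x) (hs : Measurable s) (hξ : Measurable ξ) :
    Measurable fun z => pointStep h (x z) r β γ (s z) (ξ z) := by
  have h1 : Measurable fun z => readout (fun i => (∑ l, β l)⁻¹ * β i) r
      (unprojected h (x z) r β (s z).1 (s z).2 (ξ z)) :=
    (measurable_readout _ hr).comp (measurable_unprojected hh hr β hx hs.fst hs.snd hξ)
  exact (measurable_gdMap hh _ hx hs.fst h1).prodMk h1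

theorem measurable_pointIter (hh : Measurable h) {X : Type*} [MeasurableSpace X]
    {x : X → Fin N → (Fin d → ℝ) × ℝ} {r : (Fin d → ℝ) → Fin d → ℝ} (hr : Measurable r)
    (β : ℕ → Fin Ni → ℝ) (γ : ℕ → ℝ) {s : X → (Fin d → Fin d → ℝ) × (Fin d → ℝ)}
    {ξ : X → ℕ → Fin Ni → Fin d → ℝ} (hx : Measurable x) (hs : Measurable s) (hξ : Measurable ξ)
    (k : ℕ) : Measurable fun z => pointIter h (x z) r β γ (s z) (ξ z) k := by
  induction k with
  | zero => exact hs
  | succ k ih => exact measurable_pointStep hh hr (β k) (γ k) hx ih (by fun_prop)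

theorem ae_noise_pointStep_snd_ne_zero (hh : Measurable h) {r : (Fin d → ℝ) → Fin d → ℝ}
    (hr : IsAdmissibleProj r) (hNi : 1 ≤ Ni) {β : Fin Ni → ℝ} (hβ : ∀ i, 0 < β i) (γ : ℝ)
    {σ : ℝ≥0} (hσ : σ ≠ 0) (x : Fin N → (Fin d → ℝ) × ℝ)
    (s : (Fin d → Fin d → ℝ) × (Fin d → ℝ)) :
    ∀ᵐ ξ ∂noiseLaw d Ni σ, ∀ j, (pointStep h x r β γ s ξ).2 j ≠ 0 := by
  have i : Fin Ni := ⟨0, hNi⟩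
  have h1 : 0 < ∑ l, β l := Finset.sum_pos (fun i _ => hβ i) ⟨i, Finset.mem_univ i⟩
  exact noiseLaw_absolutelyContinuous d Ni hσ
    ((quasiMeasurePreserving_unprojected hh x hr.measurable (fun i => (hβ i).ne') s.1 s.2).ae
      (ae_readout_ne_zero hr (i := i) (mul_ne_zero (inv_ne_zero h1.ne') (hβ i).ne')))

variable (μ : Fin N → Measure ((Fin d → ℝ) × ℝ)) [∀ i, IsProbabilityMeasure (μ i)]

/-- The exceptional set involves data and hidden weights only; no starting readout is excluded,
because θ enters through the unprojected points alone and these pull null sets back for every θ.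
This is essential, as nothing is known about the joint law of `W_k` and `θ_k`. -/
theorem ae_noise_pointStep_notMem (hh : Differentiable ℝ h)
    (hd : ∀ᵐ t, DifferentiableAt ℝ (deriv h) t) (hC : ConditionC1 (deriv h))
    (hμ : ∀ i, (μ i).map Prod.fst ≪ volume) {r : (Fin d → ℝ) → Fin d → ℝ}
    (hr : IsAdmissibleProj r) (hNi : 1 ≤ Ni) {β : Fin Ni → ℝ} (hβ : ∀ i, 0 < β i) (γ : ℝ)
    {σ : ℝ≥0} (hσ : σ ≠ 0) {B : Set ((Fin N → (Fin d → ℝ) × ℝ) × (Fin d → Fin d → ℝ))}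
    (hBm : MeasurableSet B) (hB : (Measure.pi μ).prod volume B = 0) :
    ∀ᵐ p ∂(Measure.pi μ).prod volume, ∀ θ, ∀ᵐ ξ ∂noiseLaw d Ni σ,
      (p.1, (pointStep h p.1 r β γ (p.2, θ) ξ).1) ∉ B := by
  have i₀ : Fin Ni := ⟨0, hNi⟩
  have hhm := hh.continuous.measurable
  have h1 : 0 < ∑ l, β l := Finset.sum_pos (fun i _ => hβ i) ⟨i₀, Finset.mem_univ i₀⟩
  set b : Fin Ni → ℝ := fun i => (∑ l, β l)⁻¹ * β i with hb
  have hb1 : ∑ i, b i = 1 := by rw [hb, ← Finset.mul_sum, inv_mul_cancel₀ h1.ne']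
  have hb0 : ∀ i, b i ≠ 0 := fun i => mul_ne_zero (inv_ne_zero h1.ne') (hβ i).ne'
  have h2 : ∀ᵐ x ∂Measure.pi μ, ∀ᵐ z : (Fin d → Fin d → ℝ) × (Fin Ni → Fin d → ℝ),
      (x, gdMap h (γ / N) x z.1 (readout b r z.2)) ∉ B := by
    filter_upwards [ae_gdMap_readout_notMem μ hh hd hC hμ hr (γ / N) hb1 hb0,
      Measure.ae_ae_of_ae_prod (measure_eq_zero_iff_ae_notMem.1 hB)] with x hx hBx
    exact hx (Prod.mk x ⁻¹' B) (measurable_prodMk_left hBm) (measure_eq_zero_iff_ae_notMem.2 hBx)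
  have hset : MeasurableSet {q : (Fin N → (Fin d → ℝ) × ℝ) ×
      ((Fin d → Fin d → ℝ) × (Fin Ni → Fin d → ℝ)) |
      (q.1, gdMap h (γ / N) q.1 q.2.1 (readout b r q.2.2)) ∉ B} := by
    have h3 : Measurable fun q : (Fin N → (Fin d → ℝ) × ℝ) ×
        ((Fin d → Fin d → ℝ) × (Fin Ni → Fin d → ℝ)) =>
        (q.1, gdMap h (γ / N) q.1 q.2.1 (readout b r q.2.2)) :=
      measurable_fst.prodMk (measurable_gdMap hhm _ measurable_fst measurable_snd.fst
        ((measurable_readout b hr.measurable).comp measurable_snd.snd))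
    exact h3 hBm.compl
  have h4 := (Measure.ae_prod_iff_ae_ae hset).2 h2
  rw [Measure.volume_eq_prod] at h4
  have h5 : ∀ᵐ q ∂((Measure.pi μ).prod (volume : Measure (Fin d → Fin d → ℝ))).prod
      (volume : Measure (Fin Ni → Fin d → ℝ)),
      (q.1.1, gdMap h (γ / N) q.1.1 q.1.2 (readout b r q.2)) ∉ B := by
    rw [← Measure.prodAssoc_prod] at h4
    exact ae_of_ae_map MeasurableEquiv.prodAssoc.measurable.aemeasurable h4
  filter_upwards [Measure.ae_ae_of_ae_prod h5] with p hp θ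
  exact noiseLaw_absolutelyContinuous d Ni hσ
    ((quasiMeasurePreserving_unprojected hhm p.1 hr.measurable (fun i => (hβ i).ne') p.2 θ).ae hp)

end Step

/-! ### Independence of the past from the next noise block -/

section Independence

theorem indepFun_prodMk_of_indepFun {Ω X A B : Type*} [MeasurableSpace Ω] [MeasurableSpace X]
    [MeasurableSpace A] [MeasurableSpace B] {P : Measure Ω} [IsProbabilityMeasure P] {f : Ω → X}
    {a : Ω → A} {b : Ω → B} (hf : Measurable f) (ha : Measurable a) (hb : Measurable b)
    (h1 : IndepFun f (fun ω => (a ω, b ω)) P) (h2 : IndepFun a b P) :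
    IndepFun (fun ω => (f ω, a ω)) b P := by
  have h3 : IndepFun f a P := h1.comp measurable_id measurable_fst
  rw [indepFun_iff_map_prod_eq_prod_map_map (by fun_prop) (by fun_prop)] at h1 h2 h3 ⊢
  have := Measure.isProbabilityMeasure_map (μ := P) hf.aemeasurable
  have := Measure.isProbabilityMeasure_map (μ := P) ha.aemeasurable
  have := Measure.isProbabilityMeasure_map (μ := P) hb.aemeasurable
  refine MeasurableEquiv.prodAssoc.map_measurableEquiv_injective ?_
  rw [h3, Measure.prodAssoc_prod, ← h2, ← h1,
    Measure.map_map MeasurableEquiv.prodAssoc.measurable (by fun_prop)]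
  rfl

/-- Independence makes the joint law of state and noise a product, so a statement about a fresh
sample of the noise transfers to the actual noise. -/
theorem ae_of_indepFun_of_ae_ae {Ω S B : Type*} [MeasurableSpace Ω] [MeasurableSpace S]
    [MeasurableSpace B] {P : Measure Ω} [IsProbabilityMeasure P] {s : Ω → S} {ξ : Ω → B}
    (hs : Measurable s) (hξ : Measurable ξ) (hind : IndepFun s ξ P) {ν : Measure B} [SFinite ν]
    (hν : P.map ξ = ν) {Q : S → B → Prop} (hQ : MeasurableSet {z : S × B | Q z.1 z.2})
    (h : ∀ᵐ ω ∂P, ∀ᵐ y ∂ν, Q (s ω) y) : ∀ᵐ ω ∂P, Q (s ω) (ξ ω) := by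
  rw [indepFun_iff_map_prod_eq_prod_map_map (by fun_prop) (by fun_prop), hν] at hind
  have h1 : MeasurableSet {t : S | ∀ᵐ y ∂ν, Q t y} := by
    have : {t : S | ∀ᵐ y ∂ν, Q t y} =
        {t | ν (Prod.mk t ⁻¹' {z : S × B | Q z.1 z.2}ᶜ) = 0} := by
      ext t
      rfl
    rw [this]
    exact measurable_measure_prodMk_left hQ.compl (measurableSet_singleton 0)
  have h2 : ∀ᵐ z ∂P.map fun ω => (s ω, ξ ω), Q z.1 z.2 := by
    rw [hind, Measure.ae_prod_iff_ae_ae hQ]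
    exact (ae_map_iff hs.aemeasurable h1).2 h
  exact ae_of_ae_map (by fun_prop) h2

theorem map_noise_eq {Ω : Type*} [MeasurableSpace Ω] {P : Measure Ω} [IsProbabilityMeasure P]
    {d Ni : ℕ} {ξ : Fin Ni → Fin d → Ω → ℝ} (hξ : ∀ i l, Measurable (ξ i l))
    (hind : iIndepFun (fun (q : Fin Ni × Fin d) => ξ q.1 q.2) P) {σ : ℝ≥0}
    (hlaw : ∀ i l, P.map (ξ i l) = gaussianReal 0 σ) :
    P.map (fun ω i l => ξ i l ω) = noiseLaw d Ni σ := by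
  have h1 := (iIndepFun_iff_map_fun_eq_pi_map fun q : Fin Ni × Fin d => (hξ q.1 q.2).aemeasurable).1 hind
  simp only [hlaw] at h1
  have h2 := Measure.infinitePi_map_curry (fun (_ : Fin Ni) (_ : Fin d) => gaussianReal 0 σ)
  simp only [Measure.infinitePi_eq_pi] at h2
  rw [← h1, Measure.map_map (MeasurableEquiv.measurable _) (by fun_prop)] at h2
  exact h2

end Independence


/-! ### Absolute continuity along the trajectory -/

section Trajectory

variable {d N Ni : ℕ} {h : ℝ → ℝ} {Ω : Type*} [MeasurableSpace Ω] {P : Measure Ω}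
  {x : Ω → Fin N → (Fin d → ℝ) × ℝ}
  {s₀ : Ω → (Fin d → Fin d → ℝ) × (Fin d → ℝ)} {ξ : ℕ → Ω → Fin Ni → Fin d → ℝ}

theorem measurable_pointIter_comp (hh : Measurable h) {r : (Fin d → ℝ) → Fin d → ℝ}
    (hr : Measurable r) (β : ℕ → Fin Ni → ℝ) (γ : ℕ → ℝ) (hx : Measurable x) (hs : Measurable s₀)
    (hξ : ∀ k, Measurable (ξ k)) (k : ℕ) :
    Measurable fun ω => pointIter h (x ω) r β γ (s₀ ω) (fun i => ξ i ω) k :=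
  measurable_pointIter hh hr β γ hx hs (measurable_pi_lambda _ hξ) k

theorem indepFun_pointIter (hh : Measurable h) {r : (Fin d → ℝ) → Fin d → ℝ}
    (hr : Measurable r) (β : ℕ → Fin Ni → ℝ) (γ : ℕ → ℝ) {k : ℕ}
    (hind : IndepFun (fun ω => ((x ω, s₀ ω), fun i : Fin k => ξ i ω)) (ξ k) P) :
    IndepFun (fun ω => (x ω, pointIter h (x ω) r β γ (s₀ ω) (fun i => ξ i ω) k)) (ξ k) P := by
  -- The k-th state reads only the noise blocks before k; the padding by 0 is never consulted.
  let ext : (Fin k → Fin Ni → Fin d → ℝ) → ℕ → Fin Ni → Fin d → ℝ := fun p i =>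
    if hi : i < k then p ⟨i, hi⟩ else 0
  have hext : Measurable ext := by
    refine measurable_pi_lambda _ fun i => ?_
    by_cases hi : i < k
    · simp only [ext, dif_pos hi]
      fun_prop
    · simp only [ext, dif_neg hi]
      fun_prop
  have hF : Measurable fun q : ((Fin N → (Fin d → ℝ) × ℝ) ×
      ((Fin d → Fin d → ℝ) × (Fin d → ℝ))) × (Fin k → Fin Ni → Fin d → ℝ) =>
      (q.1.1, pointIter h q.1.1 r β γ q.1.2 (ext q.2) k) :=
    measurable_fst.fst.prodMk (measurable_pointIter hh hr β γ measurable_fst.fst measurable_fst.snd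
      (hext.comp measurable_snd) k)
  have h1 : (fun ω => (x ω, pointIter h (x ω) r β γ (s₀ ω) (fun i => ξ i ω) k)) =
      (fun q : ((Fin N → (Fin d → ℝ) × ℝ) × ((Fin d → Fin d → ℝ) × (Fin d → ℝ))) ×
        (Fin k → Fin Ni → Fin d → ℝ) => (q.1.1, pointIter h q.1.1 r β γ q.1.2 (ext q.2) k)) ∘
        fun ω => ((x ω, s₀ ω), fun i : Fin k => ξ i ω) := by
    funext ω
    refine Prod.ext rfl (pointIter_congr _ _ _ _ _ fun i hi => ?_)
    simp only [ext, dif_pos hi]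
  rw [h1]
  exact hind.comp hF measurable_id

variable [IsProbabilityMeasure P] (μ : Fin N → Measure ((Fin d → ℝ) × ℝ)) [∀ i, IsProbabilityMeasure (μ i)]

/-- The joint law of the data and the hidden layer stays absolutely continuous along the
trajectory. -/
theorem map_pointIter_absolutelyContinuous (hh : Differentiable ℝ h)
    (hd : ∀ᵐ t, DifferentiableAt ℝ (deriv h) t) (hC : ConditionC1 (deriv h))
    (hμ : ∀ i, (μ i).map Prod.fst ≪ volume) {r : (Fin d → ℝ) → Fin d → ℝ}
    (hr : IsAdmissibleProj r) (hNi : 1 ≤ Ni) {β : ℕ → Fin Ni → ℝ} (hβ : ∀ k i, 0 < β k i)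
    (γ : ℕ → ℝ) {σ : ℝ≥0} (hσ : σ ≠ 0) (hx : Measurable x) (hs : Measurable s₀)
    (hξ : ∀ k, Measurable (ξ k))
    (hind : ∀ k, IndepFun (fun ω => ((x ω, s₀ ω), fun i : Fin k => ξ i ω)) (ξ k) P)
    (hlaw : ∀ k, P.map (ξ k) = noiseLaw d Ni σ)
    (hac : P.map (fun ω => (x ω, (s₀ ω).1)) ≪ (Measure.pi μ).prod volume) (k : ℕ) :
    P.map (fun ω => (x ω, (pointIter h (x ω) r β γ (s₀ ω) (fun i => ξ i ω) k).1)) ≪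
      (Measure.pi μ).prod volume := by
  have hhm := hh.continuous.measurable
  have hSm := measurable_pointIter_comp hhm hr.measurable β γ hx hs hξ
  induction k with
  | zero => exact hac
  | succ k ih =>
    refine Measure.AbsolutelyContinuous.mk fun B hBm hB => ?_
    rw [Measure.map_apply (hx.prodMk (hSm (k + 1)).fst) hBm]
    -- The induction hypothesis carries the one-step statement from generic (x, W) to the actual
    -- data and `W_k`, for every readout and hence for the current one.
    have h1 := ae_of_ae_map (hx.prodMk (hSm k).fst).aemeasurable
      (ih (ae_noise_pointStep_notMem μ hh hd hC hμ hr hNi (hβ k) (γ k) hσ hBm hB))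
    have h2 := ae_of_indepFun_of_ae_ae (hx.prodMk (hSm k)) (hξ k)
      (indepFun_pointIter hhm hr.measurable β γ (hind k)) (hlaw k)
      (Q := fun s y => (s.1, (pointStep h s.1 r (β k) (γ k) s.2 y).1) ∉ B)
      ((measurable_fst.fst.prodMk (measurable_pointStep hhm hr.measurable (β k) (γ k)
        measurable_fst.fst measurable_fst.snd measurable_snd).fst) hBm.compl)
      (h1.mono fun ω hω => hω _)
    exact measure_eq_zero_iff_ae_notMem.2 h2

end Trajectory

/-! ### The exceptional null set -/

section FullRank

variable {d N : ℕ} {h : ℝ → ℝ}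

theorem measurableSet_not_fullRank (h : ℝ → ℝ) :
    MeasurableSet {p : (Fin N → (Fin d → ℝ) × ℝ) × (Fin d → Fin d → ℝ) |
      ¬ FullRankCollection (gradCollection h (fun i => (p.1 i).1) p.2)} :=
  (measurableSet_fullRank h).compl

theorem measure_not_fullRank_eq_zero (μ : Fin N → Measure ((Fin d → ℝ) × ℝ))
    [∀ i, IsProbabilityMeasure (μ i)] (hd : ∀ᵐ t, DifferentiableAt ℝ (deriv h) t)
    (hC : ConditionC1 (deriv h)) (hμ : ∀ i, (μ i).map Prod.fst ≪ volume) :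
    (Measure.pi μ).prod volume {p : (Fin N → (Fin d → ℝ) × ℝ) × (Fin d → Fin d → ℝ) |
      ¬ FullRankCollection (gradCollection h (fun i => (p.1 i).1) p.2)} = 0 :=
  (Measure.ae_prod_iff_ae_ae (measurableSet_fullRank h)).2 (ae_rank_gradCollection μ hd hC hμ)

end FullRank

theorem indepFun_block {Ni d : ℕ} {Ω : Type*} [MeasurableSpace Ω] {P : Measure Ω}
    [IsProbabilityMeasure P] {X : Type*} [MeasurableSpace X] {f : Ω → X} (hf : Measurable f)
    {ξ : ℕ → Fin Ni → Fin d → Ω → ℝ} (hξ : ∀ k i l, Measurable (ξ k i l))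
    (hind : iIndepFun (fun (q : ℕ × Fin Ni × Fin d) => ξ q.1 q.2.1 q.2.2) P)
    (hnoise : IndepFun f (fun ω (q : ℕ × Fin Ni × Fin d) => ξ q.1 q.2.1 q.2.2 ω) P) (k : ℕ) :
    IndepFun (fun ω => (f ω, fun (j : Fin k) i l => ξ j i l ω)) (fun ω i l => ξ k i l ω) P := by
  refine indepFun_prodMk_of_indepFun hf (by fun_prop) (by fun_prop) ?_ ?_
  · exact hnoise.comp measurable_id (ψ := fun y : ℕ × Fin Ni × Fin d → ℝ =>
      ((fun (j : Fin k) i l => y (j, i, l)), fun i l => y (k, i, l))) (by fun_prop)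
  · have h1 := hind.indepFun_finset (Finset.range k ×ˢ Finset.univ) ({k} ×ˢ Finset.univ) (by
      rw [Finset.disjoint_left]
      rintro ⟨a, b⟩ h1 h2
      simp only [Finset.mem_product, Finset.mem_range, Finset.mem_singleton] at h1 h2
      omega) fun q => hξ _ _ _
    exact h1.comp
      (φ := fun y (j : Fin k) (i : Fin Ni) (l : Fin d) =>
        y ⟨((j : ℕ), i, l), by simp⟩)
      (ψ := fun y (i : Fin Ni) (l : Fin d) => y ⟨(k, i, l), by simp⟩)
      (measurable_pi_lambda _ fun _ => measurable_pi_lambda _ fun _ => measurable_pi_lambda _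
        fun _ => measurable_pi_apply _)
      (measurable_pi_lambda _ fun _ => measurable_pi_lambda _ fun _ => measurable_pi_apply _)

end TwoLayer

/-! ### The theorem for the algorithm -/

theorem mainTheorem7 {d N Ni : ℕ} (hNi : 1 ≤ Ni)
    (h : ℝ → ℝ) (hdiff : Differentiable ℝ h)
    (hdiff' : ∀ᵐ x : ℝ, DifferentiableAt ℝ (deriv h) x)
    (hC1 : TwoLayer.ConditionC1 (deriv h))
    (K : Set (EuclideanSpace ℝ (Fin d)))
    (hK : K = Set.univ ∨ (2 ≤ d ∧ ∃ R : ℝ, 0 < R ∧ K = Metric.closedBall 0 (R / 2)))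
    (β : ℕ → Fin Ni → ℝ) (hβ : ∀ k i, 0 < β k i) (γ : ℕ → ℝ)
    (s : ℝ≥0) (hs : s ≠ 0)
    {Ω : Type*} [MeasurableSpace Ω] (P : Measure Ω) [IsProbabilityMeasure P]
    (u : Fin N → Ω → Fin d → ℝ) (v : Fin N → Ω → ℝ)
    (W₀ : Ω → Matrix (Fin d) (Fin d) ℝ) (θ₀ : Ω → EuclideanSpace ℝ (Fin d))
    (ξ : ℕ → Fin Ni → Fin d → Ω → ℝ)
    (hu : ∀ i, Measurable (u i)) (hv : ∀ i, Measurable (v i))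
    (hW₀ : Measurable fun ω (j k : Fin d) => W₀ ω j k) (hθ₀ : Measurable θ₀)
    (hξ : ∀ k i l, Measurable (ξ k i l))
    -- the data points are independent, and the law of each input has a Lebesgue density
    (hdata : iIndepFun (fun i ω => (u i ω, v i ω)) P)
    (hulaw : ∀ i, P.map (u i) ≪ volume)
    -- the law of the initial hidden layer has a Lebesgue density
    (hWlaw : P.map (fun ω (j k : Fin d) => W₀ ω j k) ≪ volume)
    -- the coordinates of the noise vectors are i.i.d. centred Gaussian variables
    (hξindep : iIndepFun (fun (q : ℕ × Fin Ni × Fin d) => ξ q.1 q.2.1 q.2.2) P)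
    (hξlaw : ∀ k i l, P.map (ξ k i l) = gaussianReal 0 s)
    -- data, initialization and noise are independent of one another
    (hinit : IndepFun (fun ω (i : Fin N) => (u i ω, v i ω))
      (fun ω => ((fun j k : Fin d => W₀ ω j k), θ₀ ω)) P)
    (hnoise : IndepFun
      (fun ω => ((fun i : Fin N => (u i ω, v i ω)), ((fun j k : Fin d => W₀ ω j k), θ₀ ω)))
      (fun ω (q : ℕ × Fin Ni × Fin d) => ξ q.1 q.2.1 q.2.2 ω) P) :
    -- given the past, full rank for almost every value of the noise of the next inner loop
    (∀ k : ℕ, ∀ᵐ ω ∂P, ∀ᵐ x ∂(TwoLayer.noiseLaw d Ni s),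
      TwoLayer.FullRankCollection (TwoLayer.gradCollection h (fun i => u i ω)
        (TwoLayer.outerStep h (fun i => u i ω) (fun i => v i ω) K (β k) (γ k)
          (TwoLayer.iterate h (fun i => u i ω) (fun i => v i ω) K β γ (W₀ ω) (θ₀ ω)
            (fun k i l => ξ k i l ω) k) x).1)) ∧
    -- along the whole trajectory
    (∀ᵐ ω ∂P, ∀ k : ℕ,
      let st := TwoLayer.iterate h (fun i => u i ω) (fun i => v i ω) K β γ (W₀ ω) (θ₀ ω)
        (fun k i l => ξ k i l ω)
      TwoLayer.FullRankCollection (TwoLayer.gradCollection h (fun i => u i ω) (st (k + 1)).1) ∧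
      (TwoLayer.firstOrderMatrix h (fun i => u i ω) (st k).1 (st (k + 1)).2).rank
        = min N (d * d) ∧
      (TwoLayer.firstOrderMatrix h (fun i => u i ω) (st (k + 1)).1 (st (k + 1)).2).rank
        = min N (d * d)) := by
  obtain ⟨r, hr, hKr⟩ := TwoLayer.exists_admissibleProj hK
  have hhm := hdiff.continuous.measurable
  let x : Ω → Fin N → (Fin d → ℝ) × ℝ := fun ω i => (u i ω, v i ω)
  let s₀ : Ω → (Fin d → Fin d → ℝ) × (Fin d → ℝ) := fun ω => (W₀ ω, (θ₀ ω).ofLp)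
  let η : ℕ → Ω → Fin Ni → Fin d → ℝ := fun k ω i l => ξ k i l ω
  let μ : Fin N → Measure ((Fin d → ℝ) × ℝ) := fun i => P.map fun ω => (u i ω, v i ω)
  have hμp : ∀ i, IsProbabilityMeasure (μ i) := fun i =>
    Measure.isProbabilityMeasure_map ((hu i).prodMk (hv i)).aemeasurable
  have hμ : ∀ i, (μ i).map Prod.fst ≪ volume := fun i => by
    rw [Measure.map_map measurable_fst ((hu i).prodMk (hv i))]
    exact hulaw i
  have hx : Measurable x := measurable_pi_lambda _ fun i => (hu i).prodMk (hv i)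
  have hW : Measurable fun ω => (s₀ ω).1 := hW₀
  have hs₀ : Measurable s₀ := hW.prodMk ((WithLp.measurable_ofLp 2 _).comp hθ₀)
  have hη : ∀ k, Measurable (η k) := fun k => by fun_prop
  have hinit' : IndepFun x (fun ω => (s₀ ω).1) P := hinit.comp measurable_id measurable_fst
  -- Start of the induction: by independence the joint law of data and `W₀` is a product. The
  -- measure `μ` keeps the true laws of the pairs, so no density of the `v i` is needed.
  have hac : P.map (fun ω => (x ω, (s₀ ω).1)) ≪ (Measure.pi μ).prod volume := by
    rw [(indepFun_iff_map_prod_eq_prod_map_map hx.aemeasurable hW.aemeasurable).1 hinit',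
      ← (iIndepFun_iff_map_fun_eq_pi_map fun i => ((hu i).prodMk (hv i)).aemeasurable).1 hdata]
    exact Measure.AbsolutelyContinuous.rfl.prod hWlaw
  have hnoise' : IndepFun (fun ω => (x ω, s₀ ω))
      (fun ω (q : ℕ × Fin Ni × Fin d) => ξ q.1 q.2.1 q.2.2 ω) P :=
    hnoise.comp (φ := fun y : (Fin N → (Fin d → ℝ) × ℝ) ×
        ((Fin d → Fin d → ℝ) × EuclideanSpace ℝ (Fin d)) => (y.1, (y.2.1, y.2.2.ofLp)))
      (measurable_fst.prodMk (measurable_snd.fst.prodMk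
        ((WithLp.measurable_ofLp 2 _).comp measurable_snd.snd))) measurable_id
  have hind : ∀ k, IndepFun (fun ω => ((x ω, s₀ ω), fun i : Fin k => η i ω)) (η k) P :=
    TwoLayer.indepFun_block (hx.prodMk hs₀) hξ hξindep hnoise'
  have hlaw : ∀ k, P.map (η k) = TwoLayer.noiseLaw d Ni s := fun k =>
    TwoLayer.map_noise_eq (hξ k)
      (hξindep.precomp (g := fun q : Fin Ni × Fin d => (k, q.1, q.2)) fun a b hab => by
        simpa [Prod.ext_iff] using hab) (hξlaw k)
  let S : ℕ → Ω → (Fin d → Fin d → ℝ) × (Fin d → ℝ) := fun k ω =>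
    TwoLayer.pointIter h (x ω) r β γ (s₀ ω) (fun i => η i ω) k
  have hSm : ∀ k, Measurable (S k) :=
    TwoLayer.measurable_pointIter_comp hhm hr.measurable β γ hx hs₀ hη
  have hI : ∀ k, P.map (fun ω => (x ω, (S k ω).1)) ≪ (Measure.pi μ).prod volume :=
    TwoLayer.map_pointIter_absolutelyContinuous μ hdiff hdiff' hC1 hμ hr hNi hβ γ hs hx hs₀ hη
      hind hlaw hac
  have hBm := TwoLayer.measurableSet_not_fullRank (N := N) (d := d) h
  have hB := TwoLayer.measure_not_fullRank_eq_zero μ hdiff' hC1 hμ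
  have hit : ∀ k ω, TwoLayer.iterate h (fun i => u i ω) (fun i => v i ω) K β γ (W₀ ω) (θ₀ ω)
      (fun k i l => ξ k i l ω) k = ((S k ω).1, WithLp.toLp 2 (S k ω).2) := fun k ω =>
    TwoLayer.iterate_eq_pointIter hdiff hKr _ _ β γ _ _ _ k
  refine ⟨fun k => ?_, ae_all_iff.2 fun k => ?_⟩
  · have h1 := ae_of_ae_map (hx.prodMk (hSm k).fst).aemeasurable
      (hI k (TwoLayer.ae_noise_pointStep_notMem μ hdiff hdiff' hC1 hμ hr hNi (hβ k) (γ k) hs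
        hBm hB))
    filter_upwards [h1] with ω hω
    filter_upwards [hω (S k ω).2] with y hy
    rw [hit k ω]
    have h2 := congrArg Prod.fst (TwoLayer.outerStep_eq_pointStep hdiff hKr (fun i => u i ω)
      (fun i => v i ω) (β k) (γ k) (S k ω) y)
    exact (congrArg (fun W => TwoLayer.FullRankCollection
      (TwoLayer.gradCollection h (fun i => u i ω) W)) h2).mpr (not_not.1 hy)
  -- Full rank is recorded at every index including 0, because the first-order matrix is also
  -- evaluated at the old weights `W_k`.
  · have hfull : ∀ k, ∀ᵐ ω ∂P, TwoLayer.FullRankCollection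
        (TwoLayer.gradCollection h (fun i => u i ω) (S k ω).1) := fun k =>
      (ae_of_ae_map (hx.prodMk (hSm k).fst).aemeasurable
        (hI k (measure_eq_zero_iff_ae_notMem.1 hB))).mono fun ω hω => not_not.1 hω
    have hθ : ∀ᵐ ω ∂P, ∀ j, (S (k + 1) ω).2 j ≠ 0 := by
      refine TwoLayer.ae_of_indepFun_of_ae_ae (hx.prodMk (hSm k)) (hη k)
        (TwoLayer.indepFun_pointIter hhm hr.measurable β γ (hind k)) (hlaw k)
        (Q := fun z y => ∀ j, (TwoLayer.pointStep h z.1 r (β k) (γ k) z.2 y).2 j ≠ 0) ?_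
        (Filter.Eventually.of_forall fun ω =>
          TwoLayer.ae_noise_pointStep_snd_ne_zero hhm hr hNi (hβ k) (γ k) hs _ _)
      have h1 := (TwoLayer.measurable_pointStep (N := N) hhm hr.measurable (β k) (γ k)
        (measurable_fst.comp measurable_fst) (measurable_snd.comp measurable_fst)
        (measurable_snd (α := (Fin N → (Fin d → ℝ) × ℝ) ×
          ((Fin d → Fin d → ℝ) × (Fin d → ℝ))) (β := Fin Ni → Fin d → ℝ))).snd
      rw [Set.ofPred_forall]
      exact MeasurableSet.iInter fun j =>
        ((measurable_pi_apply j).comp h1) (measurableSet_singleton (0 : ℝ)).compl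
    filter_upwards [hfull k, hfull (k + 1), hθ] with ω h1 h2 h3
    simp only [hit]
    exact ⟨h2, (TwoLayer.rank_firstOrderMatrix _ _ h3).trans h1,
      (TwoLayer.rank_firstOrderMatrix _ _ h3).trans h2⟩
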